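/- Let $M$ be a finite-dimensional, Hausdorff, second countable real analytic manifold (without boundary) and $\star\in M$. \emph{Loops.} A path $\gamma:[0,1]\to M$ is piecewise analytic if it is continuous and, for some partition $0=t_0\le\dots\le t_n=1$, agrees on each $[t_i,t_{i+1}]$ with an analytic map. Let $Loop_\star(M)$ be the group, under composition, of piecewise analytic loops based at $\star$ modulo the equivalence relation generated by order preserving (continuous, monotone, end point preserving) reparametrizations and by the insertion of retracings, $pq\sim p\,\gamma\gamma^{-1}q$. An edge is an analytic path $e:[0,1]\to M$ whose restriction to $(0,1)$ is an embedding; its vertices are $e(0)$ and $e(1)$. A finite family of loops $\beta_1,\dots,\beta_n$ ($n\ge 0$) is independent if the union of their images is a finite embedded graph (a union of the images of finitely many edges, distinct edges meeting only in common vertices) such that every $\beta_i$ has an edge $e_i$ of the graph whose interior points are passed exactly once by $\beta_i$ and whose image meets the other loops at most in the vertices of $e_i$. Let $J$ be the set of subgroups $L\subseteq Loop_\star(M)$ generated by the classes of a finite independent family, ordered by inclusion. \emph{Spaces.} For a group $\Lambda$, $Hom(\Lambda,U(1))$ carries pointwise multiplication and the topology of pointwise convergence; it is a compact Abelian group. Put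 $\overline{\mathcal A/\mathcal G}=Hom(Loop_\star(M),U(1))$, with normalized Haar measure $\mu_0$, and, for $L\in J$, $\overline{\mathcal A/\mathcal G}_L=Hom(L,U(1))$, with normalized Haar measure $\mu_L$ and (discrete) dual group $\mathcal W_L$. For $\alpha\in Loop_\star(M)$ let $T_\alpha(H)=H(\alpha)$ be the Wilson function, and let $\mathcal W=Hoop_\star(M)=\{T_\alpha\}$ be the group of hoops, with pointwise multiplication and the discrete topology. $L^2$ of a discrete group is taken with respect to counting measure. \emph{Inductive limits.} An inductive family of Hilbert spaces over a (nonempty) directed set $J$ consists of Hilbert spaces $\mathcal H_\mu$ and isometric linear maps $i_{\nu\mu}:\mathcal H_\mu\to\mathcal H_\nu$ ($\mu\le\nu$) with $i_{\mu\mu}=\mathrm{id}$ and $i_{\lambda\nu}i_{\nu\mu}=i_{\lambda\mu}$. A Hilbert space $\mathcal H$ with isometric linear maps $i_\mu:\mathcal H_\mu\to\mathcal H$ such that $i_\nu i_{\nu\mu}=i_\mu$ is its inductive limit if the images of the $i_\mu$ cover a dense linear subspace of $\mathcal H$. Given a second such family $(\mathcal H'_\mu,i'_{\nu\mu})$ with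 limit $(\mathcal H',i'_\mu)$, unitary maps $\phi_\mu:\mathcal H_\mu\to\mathcal H'_\mu$ form an inductive family if $i'_{\nu\mu}\phi_\mu=\phi_\nu i_{\nu\mu}$ for $\mu\le\nu$, and their inductive limit is the unique unitary map $\phi:\mathcal H\to\mathcal H'$ with $\phi\, i_\mu=i'_\mu\phi_\mu$ for all $\mu$. \textbf{Theorem.} For every independent family $\beta_1,\dots,\beta_n$ with generated subgroup $L$, the evaluation $H\mapsto(H(\beta_1),\dots,H(\beta_n))$ is an isomorphism of topological groups $\overline{\mathcal A/\mathcal G}_L\to U(1)^n$, and composition with it is a unitary map $L^2(U(1)^n)\to L^2(\overline{\mathcal A/\mathcal G}_L)$. Moreover the following maps are well defined: the isometric linear inclusions $i_{L'L}:L^2(\overline{\mathcal A/\mathcal G}_L)\to L^2(\overline{\mathcal A/\mathcal G}_{L'})$, for $L\le L'$ in $J$, and $i_L:L^2(\overline{\mathcal A/\mathcal G}_L)\to L^2(\overline{\mathcal A/\mathcal G})$, given by $(i_{L'L}\psi)(H)=\psi(H|_L)$ and $(i_L\psi)(H)=\psi(H|_L)$; the Fourier transforms $F_L:L^2(\overline{\mathcal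 A/\mathcal G}_L)\to L^2(\mathcal W_L)$, $(F_L\psi)(\chi)=\int\overline{\chi}\,\psi\,d\mu_L$, which are unitary; the loop transform $\mathcal L:L^2(\overline{\mathcal A/\mathcal G})\to L^2(Hoop_\star(M))$, $(\mathcal L\psi)(T_\alpha)=\int\overline{T_\alpha}\,\psi\,d\mu_0$, which is unitary (in particular its range is all of $L^2(Hoop_\star(M))$); and the isometric linear inclusions $j_{L'L}=F_{L'}\,i_{L'L}\,F_L^{-1}$ and $j_L=\mathcal L\,i_L\,F_L^{-1}$. With these maps: \begin{enumerate} \item $J$ is directed, and $L^2(\overline{\mathcal A/\mathcal G})$, with the inclusions $i_L$, is the inductive limit of the inductive family $\{L^2(\overline{\mathcal A/\mathcal G}_L),i_{L'L}\}_{L\in J}$; \item $L^2(\mathcal W)=L^2(Hoop_\star(M))$, with the inclusions $j_L$, is the inductive limit of the inductive family $\{L^2(\mathcal W_L),j_{L'L}\}_{L\in J}$; \item the loop transform $\mathcal L$ is the inductive limit of the inductive family of unitary maps $\{F_L\}_{L\in J}$. \end{enumerate} -/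

import Mathlib

open Set MeasureTheory Topology
open scoped Manifold ContDiff unitInterval ComplexConjugate

/-! ### Piecewise analytic paths -/

section Paths

variable (E : Type*) [NormedAddCommGroup E] [NormedSpace ℝ E]
  {M : Type*} [TopologicalSpace M] [ChartedSpace E M]

/-- `f` agrees on `[a, b]` with a map that is real analytic (in a neighbourhood of each point
of `[a, b]`). -/
def AgreesWithAnalytic (f : ℝ → M) (a b : ℝ) : Prop :=
  ∃ η : ℝ → M, (∀ s ∈ Icc a b, ContMDiffAt 𝓘(ℝ, ℝ) 𝓘(ℝ, E) ω η s) ∧ EqOn f η (Icc a b)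

/-- A continuous path is piecewise analytic if there is a partition
`0 = t₀ ≤ t₁ ≤ ⋯ ≤ tₙ = 1` such that it agrees with an analytic map on each `[tᵢ, tᵢ₊₁]`. -/
def IsPiecewiseAnalytic {x y : M} (γ : Path x y) : Prop :=
  ∃ (n : ℕ) (t : ℕ → ℝ), Monotone t ∧ t 0 = 0 ∧ t n = 1 ∧
    ∀ i < n, AgreesWithAnalytic E γ.extend (t i) (t (i + 1))

variable {E}

theorem AgreesWithAnalytic.comp_affine {f g : ℝ → M} {a b a' b' : ℝ}
    (h : AgreesWithAnalytic E f a b) (c d : ℝ)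
    (hmaps : ∀ s ∈ Icc a' b', c * s + d ∈ Icc a b) (hg : ∀ s ∈ Icc a' b', g s = f (c * s + d)) :
    AgreesWithAnalytic E g a' b' := by
  obtain ⟨η, hη, hEq⟩ := h
  refine ⟨fun s => η (c * s + d), fun s hs => ?_, fun s hs => ?_⟩
  · have h1 : ContMDiffAt 𝓘(ℝ, ℝ) 𝓘(ℝ, ℝ) ω (fun s : ℝ => c * s + d) s := by
      apply ContDiffAt.contMDiffAt
      fun_prop
    exact ContMDiffAt.comp (g := η) (f := fun s : ℝ => c * s + d) s (hη _ (hmaps s hs)) h1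
  · rw [hg s hs]
    exact hEq (hmaps s hs)

theorem IsPiecewiseAnalytic.refl (x : M) : IsPiecewiseAnalytic E (Path.refl x) :=
  ⟨1, fun n => n, Nat.mono_cast, by simp, by simp, fun _ _ =>
    ⟨fun _ => x, fun _ _ => contMDiffAt_const, fun _ _ => by simp⟩⟩

theorem IsPiecewiseAnalytic.symm {x y : M} {γ : Path x y} (h : IsPiecewiseAnalytic E γ) :
    IsPiecewiseAnalytic E γ.symm := by
  obtain ⟨n, t, ht, h0, h1, hp⟩ := h
  refine ⟨n, fun k => 1 - t (n - k), fun k l hkl => ?_, by simp [h1], by simp [h0],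
    fun i hi => ?_⟩
  · have := ht (Nat.sub_le_sub_left hkl n)
    dsimp only
    linarith
  · have e : n - i = (n - (i + 1)) + 1 := by omega
    refine (hp (n - (i + 1)) (by omega)).comp_affine (-1) 1 (fun s hs => ?_) (fun s hs => ?_)
    · rw [← e]
      constructor <;> linarith [hs.1, hs.2]
    · rw [Path.extend_symm_apply]
      congr 1
      ring

theorem IsPiecewiseAnalytic.trans {x y z : M} {γ : Path x y} {γ' : Path y z}
    (h : IsPiecewiseAnalytic E γ) (h' : IsPiecewiseAnalytic E γ') :
    IsPiecewiseAnalytic E (γ.trans γ') := by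
  obtain ⟨n, t, ht, h0, h1, hp⟩ := h
  obtain ⟨m, u, hu, h0', h1', hp'⟩ := h'
  have htn : ∀ k ≤ n, t k ≤ 1 := fun k hk => h1 ▸ ht hk
  have hu0 : ∀ k, 0 ≤ u k := fun k => h0' ▸ hu (Nat.zero_le k)
  have ht0 : ∀ k, 0 ≤ t k := fun k => h0 ▸ ht (Nat.zero_le k)
  have hum : ∀ k ≤ m, u k ≤ 1 := fun k hk => h1' ▸ hu hk
  let v : ℕ → ℝ := fun k => if k ≤ n then t k / 2 else (1 + u (k - n)) / 2
  have hv1 : ∀ k ≤ n, v k = t k / 2 := fun k hk => if_pos hk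
  have hv2 : ∀ k, n ≤ k → v k = (1 + u (k - n)) / 2 := by
    intro k hk
    rcases hk.eq_or_lt with rfl | hk
    · rw [hv1 _ le_rfl, h1]
      simp [h0']
    · exact if_neg (by omega)
  refine ⟨n + m, v, fun k l hkl => ?_, ?_, ?_, fun i hi => ?_⟩
  · by_cases hl : l ≤ n
    · rw [hv1 k (hkl.trans hl), hv1 l hl]
      linarith [ht hkl]
    · rw [hv2 l (by omega)]
      by_cases hk : k ≤ n
      · rw [hv1 k hk]
        linarith [htn k hk, hu0 (l - n)]
      · rw [hv2 k (by omega)]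
        linarith [hu (Nat.sub_le_sub_right hkl n)]
  · rw [hv1 0 (Nat.zero_le _), h0]
    simp
  · rw [hv2 _ (by omega), Nat.add_sub_cancel_left, h1']
    norm_num
  · by_cases hin : i < n
    · rw [hv1 i hin.le, hv1 (i + 1) hin]
      refine (hp i hin).comp_affine 2 0 (fun s hs => ?_) (fun s hs => ?_)
      · constructor <;> linarith [hs.1, hs.2]
      · rw [Path.extend_trans_of_le_half _ _ (by linarith [hs.2, htn (i + 1) hin])]
        simp
    · have e : i + 1 - n = (i - n) + 1 := by omega
      rw [hv2 i (by omega), hv2 (i + 1) (by omega), e]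
      refine (hp' (i - n) (by omega)).comp_affine 2 (-1) (fun s hs => ?_) (fun s hs => ?_)
      · constructor <;> linarith [hs.1, hs.2]
      · rw [Path.extend_trans_of_half_le _ _ (by linarith [hs.1, hu0 (i - n)])]
        rfl

variable (E)

/-- Piecewise analytic paths from `x` to `y`, parametrized by the unit interval. -/
def PAPath (x y : M) : Type _ := {γ : Path x y // IsPiecewiseAnalytic E γ}

variable {E}

namespace PAPath

/-- The constant path. -/
def refl (x : M) : PAPath E x x := ⟨Path.refl x, .refl x⟩

/-- The reversed path `γ⁻¹`. -/
def symm {x y : M} (γ : PAPath E x y) : PAPath E y x := ⟨γ.1.symm, γ.2.symm⟩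

/-- The composition `γ γ'`: first `γ`, then `γ'`. -/
noncomputable def trans {x y z : M} (γ : PAPath E x y) (γ' : PAPath E y z) : PAPath E x z :=
  ⟨γ.1.trans γ'.1, γ.2.trans γ'.2⟩

end PAPath

/-! ### The group of loops -/

/-- The two elementary moves between piecewise analytic paths with the same end points:
an order preserving reparametrization, and the insertion of a retracing `γ γ⁻¹`. -/
inductive ElementaryMove {x y : M} : PAPath E x y → PAPath E x y → Prop
  | reparam (α β : PAPath E x y) (φ : I → I) (hφ : Continuous φ) (hmono : Monotone φ)
      (h0 : φ 0 = 0) (h1 : φ 1 = 1) (h : ∀ t, β.1 t = α.1 (φ t)) : ElementaryMove α β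
  | retrace {z w : M} (p : PAPath E x z) (q : PAPath E z y) (γ : PAPath E z w) :
      ElementaryMove (p.trans q) (p.trans ((γ.trans γ.symm).trans q))

variable (E)

/-- Elementary equivalence: equivalence up to reparametrizations and immediate retracings. -/
def elementarySetoid (x y : M) : Setoid (PAPath E x y) :=
  Relation.EqvGen.setoid ElementaryMove

/-- The group of loops based at `x`: piecewise analytic loops modulo elementary equivalence. -/
def LoopGroup (x : M) : Type _ := Quotient (elementarySetoid E x x)

variable {E}

/-- The class of a parametrized loop in the group of loops. -/
def loopClass {x : M} (α : PAPath E x x) : LoopGroup E x :=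
  Quotient.mk (elementarySetoid E x x) α

namespace PAPath

theorem rel_of_move {x y : M} {α β : PAPath E x y} (h : ElementaryMove α β) :
    elementarySetoid E x y α β :=
  Relation.EqvGen.rel _ _ h

theorem rel_reparam {x y : M} (α β : PAPath E x y) (φ : I → I) (hφ : Continuous φ)
    (hmono : Monotone φ) (h0 : φ 0 = 0) (h1 : φ 1 = 1) (h : ∀ t, β.1 t = α.1 (φ t)) :
    elementarySetoid E x y α β :=
  rel_of_move (.reparam α β φ hφ hmono h0 h1 h)

theorem rel_assoc {x y z w : M} (p : PAPath E x y) (q : PAPath E y z) (r : PAPath E z w) :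
    elementarySetoid E x w (p.trans (q.trans r)) ((p.trans q).trans r) := by
  refine rel_reparam _ _
    (fun t => ⟨Path.Homotopy.transAssocReparamAux t, Path.Homotopy.transAssocReparamAux_mem_I t⟩)
    (by fun_prop) ?_ (Subtype.ext Path.Homotopy.transAssocReparamAux_zero)
    (Subtype.ext Path.Homotopy.transAssocReparamAux_one) ?_
  · intro s t hst
    have hst' : (s : ℝ) ≤ t := hst
    change Path.Homotopy.transAssocReparamAux s ≤ Path.Homotopy.transAssocReparamAux t
    unfold Path.Homotopy.transAssocReparamAux
    split_ifs <;> linarith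
  · intro t
    change ((p.1.trans q.1).trans r.1) t = _
    rw [Path.Homotopy.trans_assoc_reparam]
    rfl

theorem rel_trans_refl {x y : M} (p : PAPath E x y) :
    elementarySetoid E x y p (p.trans (refl y)) := by
  refine rel_reparam _ _
    (fun t => ⟨Path.Homotopy.transReflReparamAux t, Path.Homotopy.transReflReparamAux_mem_I t⟩)
    (by fun_prop) ?_ (Subtype.ext Path.Homotopy.transReflReparamAux_zero)
    (Subtype.ext Path.Homotopy.transReflReparamAux_one) ?_
  · intro s t hst
    have hst' : (s : ℝ) ≤ t := hst
    change Path.Homotopy.transReflReparamAux s ≤ Path.Homotopy.transReflReparamAux t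
    unfold Path.Homotopy.transReflReparamAux
    split_ifs <;> linarith [unitInterval.le_one s, unitInterval.le_one t]
  · intro t
    change (p.1.trans (Path.refl y)) t = _
    rw [Path.Homotopy.trans_refl_reparam]
    rfl

theorem rel_symm {x y : M} {p q : PAPath E x y} (h : elementarySetoid E x y p q) :
    elementarySetoid E x y q p := (elementarySetoid E x y).symm h

theorem rel_tr {x y : M} {p q r : PAPath E x y} (h : elementarySetoid E x y p q)
    (h' : elementarySetoid E x y q r) : elementarySetoid E x y p r :=
  (elementarySetoid E x y).trans h h'

theorem rel_refl_trans {x y : M} (p : PAPath E x y) :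
    elementarySetoid E x y p ((refl x).trans p) := by
  refine rel_reparam _ _ (fun t => ⟨max 0 (2 * (t : ℝ) - 1), ?_⟩) ?_ ?_ ?_ ?_ ?_
  · constructor
    · exact le_max_left _ _
    · exact max_le zero_le_one (by linarith [unitInterval.le_one t])
  · fun_prop
  · intro s t hst
    have hst' : (s : ℝ) ≤ t := hst
    change max 0 (2 * (s : ℝ) - 1) ≤ max 0 (2 * (t : ℝ) - 1)
    exact max_le_max le_rfl (by linarith)
  · exact Subtype.ext (by norm_num)
  · exact Subtype.ext (by norm_num)
  · intro t
    change ((Path.refl x).trans p.1) t = _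
    rw [Path.trans_apply]
    split_ifs with h
    · have : max 0 (2 * (t : ℝ) - 1) = 0 := max_eq_left (by linarith)
      simp only [this, Path.refl_apply]
      exact p.1.source.symm
    · congr 1
      exact Subtype.ext (max_eq_right (by linarith [not_le.1 h])).symm

theorem rel_trans_of_reparam {x y z : M} {a b : PAPath E x y} {c d : PAPath E y z}
    (φ ψ : I → I) (hφ : Continuous φ) (hφm : Monotone φ) (hφ0 : φ 0 = 0) (hφ1 : φ 1 = 1)
    (hψ : Continuous ψ) (hψm : Monotone ψ) (hψ0 : ψ 0 = 0) (hψ1 : ψ 1 = 1)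
    (hab : ∀ t, b.1 t = a.1 (φ t)) (hcd : ∀ t, d.1 t = c.1 (ψ t)) :
    elementarySetoid E x z (a.trans c) (b.trans d) := by
  have m1 : ∀ t : I, (t : ℝ) / 2 ∈ I := fun t => ⟨by linarith [t.2.1], by linarith [t.2.2]⟩
  have m2 : ∀ t : I, (1 + (t : ℝ)) / 2 ∈ I := fun t => ⟨by linarith [t.2.1], by linarith [t.2.2]⟩
  let P : Path (0 : I) ⟨1 / 2, by norm_num, by norm_num⟩ :=
    { toFun := fun t => ⟨(φ t : ℝ) / 2, m1 _⟩
      continuous_toFun := by fun_prop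
      source' := Subtype.ext (by simp [hφ0])
      target' := Subtype.ext (by simp [hφ1]) }
  let Q : Path (⟨1 / 2, by norm_num, by norm_num⟩ : I) 1 :=
    { toFun := fun t => ⟨(1 + (ψ t : ℝ)) / 2, m2 _⟩
      continuous_toFun := by fun_prop
      source' := Subtype.ext (by simp [hψ0])
      target' := Subtype.ext (by simp [hψ1]) }
  have hP : ∀ t, (P t : ℝ) = φ t / 2 := fun _ => rfl
  have hQ : ∀ t, (Q t : ℝ) = (1 + ψ t) / 2 := fun _ => rfl
  refine rel_reparam _ _ (P.trans Q) (P.trans Q).continuous ?_ (P.trans Q).source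
    (P.trans Q).target ?_
  · intro s t hst
    have hst' : (s : ℝ) ≤ t := hst
    change ((P.trans Q) s : ℝ) ≤ (P.trans Q) t
    rw [Path.trans_apply, Path.trans_apply]
    split_ifs with hs ht ht
    · rw [hP, hP]
      have h : φ ⟨2 * s, (unitInterval.mul_pos_mem_iff zero_lt_two).2 ⟨s.2.1, hs⟩⟩ ≤
          φ ⟨2 * t, (unitInterval.mul_pos_mem_iff zero_lt_two).2 ⟨t.2.1, ht⟩⟩ :=
        hφm (Subtype.mk_le_mk.2 (by linarith))
      have h' := Subtype.coe_le_coe.2 h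
      linarith
    · rw [hP, hQ]
      have h1 := (φ ⟨2 * s, (unitInterval.mul_pos_mem_iff zero_lt_two).2 ⟨s.2.1, hs⟩⟩).2.2
      have h2 := (ψ ⟨2 * t - 1, unitInterval.two_mul_sub_one_mem_iff.2
        ⟨(not_le.1 ht).le, t.2.2⟩⟩).2.1
      linarith
    · linarith
    · rw [hQ, hQ]
      have h : ψ ⟨2 * s - 1, unitInterval.two_mul_sub_one_mem_iff.2 ⟨(not_le.1 hs).le, s.2.2⟩⟩ ≤
          ψ ⟨2 * t - 1, unitInterval.two_mul_sub_one_mem_iff.2 ⟨(not_le.1 ht).le, t.2.2⟩⟩ :=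
        hψm (Subtype.mk_le_mk.2 (by linarith))
      have h' := Subtype.coe_le_coe.2 h
      linarith
  · intro t
    change (b.1.trans d.1) t = (a.1.trans c.1) ((P.trans Q) t)
    have key : ((P.trans Q) t) = if h : (t : ℝ) ≤ 1 / 2 then
        P ⟨2 * t, (unitInterval.mul_pos_mem_iff zero_lt_two).2 ⟨t.2.1, h⟩⟩
        else Q ⟨2 * t - 1, unitInterval.two_mul_sub_one_mem_iff.2 ⟨(not_le.1 h).le, t.2.2⟩⟩ :=
      Path.trans_apply _ _ _
    rw [← Path.extend_extends' (a.1.trans c.1), key]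
    by_cases ht : (t : ℝ) ≤ 1 / 2
    · rw [dif_pos ht, hP, Path.extend_trans_of_le_half, Path.trans_apply, dif_pos ht, hab,
        ← Path.extend_extends']
      · congr 1
        ring
      · linarith [(φ ⟨2 * t, (unitInterval.mul_pos_mem_iff zero_lt_two).2 ⟨t.2.1, ht⟩⟩).2.2]
    · rw [dif_neg ht, hQ, Path.extend_trans_of_half_le, Path.trans_apply, dif_neg ht, hcd,
        ← Path.extend_extends']
      · congr 1
        ring
      · linarith [(ψ ⟨2 * t - 1, unitInterval.two_mul_sub_one_mem_iff.2
          ⟨(not_le.1 ht).le, t.2.2⟩⟩).2.1]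

theorem rel_trans_right {x y z : M} (p : PAPath E x y) {q q' : PAPath E y z}
    (h : elementarySetoid E y z q q') : elementarySetoid E x z (p.trans q) (p.trans q') := by
  induction h with
  | refl => exact (elementarySetoid E x z).refl _
  | symm _ _ _ ih => exact rel_symm ih
  | trans _ _ _ _ _ ih ih' => exact rel_tr ih ih'
  | rel a b hab =>
    cases hab with
    | reparam _ _ φ hφ hmono h0 h1 h =>
      exact rel_trans_of_reparam id φ continuous_id monotone_id rfl rfl hφ hmono h0 h1
        (fun _ => rfl) h
    | retrace u v γ =>
      exact rel_tr (rel_assoc _ _ _) (rel_tr (rel_of_move (.retrace _ _ γ))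
        (rel_symm (rel_assoc _ _ _)))

theorem rel_trans_left {x y z : M} {p p' : PAPath E x y} (q : PAPath E y z)
    (h : elementarySetoid E x y p p') : elementarySetoid E x z (p.trans q) (p'.trans q) := by
  induction h with
  | refl => exact (elementarySetoid E x z).refl _
  | symm _ _ _ ih => exact rel_symm ih
  | trans _ _ _ _ _ ih ih' => exact rel_tr ih ih'
  | rel a b hab =>
    cases hab with
    | reparam _ _ φ hφ hmono h0 h1 h =>
      exact rel_trans_of_reparam φ id hφ hmono h0 h1 continuous_id monotone_id rfl rfl
        h (fun _ => rfl)
    | retrace u v γ =>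
      refine rel_tr (rel_symm (rel_assoc _ _ _)) (rel_tr (rel_of_move (.retrace _ _ γ)) ?_)
      exact rel_tr (rel_trans_right _ (rel_assoc _ _ _)) (rel_assoc _ _ _)

theorem rel_trans {x y z : M} {p p' : PAPath E x y} {q q' : PAPath E y z}
    (h : elementarySetoid E x y p p') (h' : elementarySetoid E y z q q') :
    elementarySetoid E x z (p.trans q) (p'.trans q') :=
  rel_tr (rel_trans_left q h) (rel_trans_right p' h')

theorem rel_trans_symm {x y : M} (p : PAPath E x y) :
    elementarySetoid E x x (refl x) (p.trans p.symm) :=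
  rel_tr (rel_trans_refl _) (rel_tr (rel_of_move (.retrace _ _ p))
    (rel_tr (rel_symm (rel_refl_trans _)) (rel_symm (rel_trans_refl _))))

theorem symm_symm {x y : M} (p : PAPath E x y) : p.symm.symm = p :=
  Subtype.ext (Path.symm_symm p.1)

theorem rel_symm_trans {x y : M} (p : PAPath E x y) :
    elementarySetoid E y y (refl y) (p.symm.trans p) := by
  have h := rel_trans_symm p.symm
  rwa [symm_symm] at h

theorem rel_inv {x y : M} {p q : PAPath E x y} (h : elementarySetoid E x y p q) :
    elementarySetoid E y x p.symm q.symm :=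
  rel_tr (rel_trans_refl _) <| rel_tr (rel_trans_right _ (rel_trans_symm q)) <|
    rel_tr (rel_assoc _ _ _) <|
    rel_tr (rel_trans_left _ (rel_trans_right _ (rel_symm h))) <|
    rel_tr (rel_trans_left _ (rel_symm (rel_symm_trans p))) (rel_symm (rel_refl_trans _))

end PAPath

noncomputable instance (x : M) : Group (LoopGroup E x) where
  mul := Quotient.map₂ PAPath.trans fun _ _ h _ _ h' => PAPath.rel_trans h h'
  one := loopClass (PAPath.refl x)
  inv := Quotient.map PAPath.symm fun _ _ h => PAPath.rel_inv h
  mul_assoc := by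
    rintro ⟨a⟩ ⟨b⟩ ⟨c⟩
    exact Quotient.sound (PAPath.rel_symm (PAPath.rel_assoc a b c))
  one_mul := by
    rintro ⟨a⟩
    exact Quotient.sound (PAPath.rel_symm (PAPath.rel_refl_trans a))
  mul_one := by
    rintro ⟨a⟩
    exact Quotient.sound (PAPath.rel_symm (PAPath.rel_trans_refl a))
  inv_mul_cancel := by
    rintro ⟨a⟩
    exact Quotient.sound (PAPath.rel_symm (PAPath.rel_symm_trans a))

/-! ### Graphs and independent families of loops -/

variable (E)

/-- An edge: an analytic path `e : [0, 1] → M` whose restriction to `(0, 1)` is an embedding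
(an immersion and a homeomorphism onto its image). Only the values on `[0, 1]` matter. -/
structure IsEdge (e : ℝ → M) : Prop where
  analytic : ∀ t ∈ Icc (0 : ℝ) 1, ContMDiffAt 𝓘(ℝ, ℝ) 𝓘(ℝ, E) ω e t
  immersion : ∀ t ∈ Ioo (0 : ℝ) 1, mfderiv 𝓘(ℝ, ℝ) 𝓘(ℝ, E) e t ≠ 0
  embedding : IsEmbedding ((Ioo (0 : ℝ) 1).domRestrict e)

/-- The vertices of an edge. -/
def edgeVertices (e : ℝ → M) : Set M := {e 0, e 1}

/-- The edges `e₁, …, eₘ` form a finite embedded graph with underlying set `Γ`: distinct edges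
meet only in common vertices, and the union of their images is `Γ`. -/
structure IsGraph {m : ℕ} (e : Fin m → ℝ → M) (Γ : Set M) : Prop where
  isEdge : ∀ k, IsEdge E (e k)
  inter : ∀ k l, k ≠ l →
    e k '' Icc 0 1 ∩ e l '' Icc 0 1 ⊆ edgeVertices (e k) ∩ edgeVertices (e l)
  union : ⋃ k, e k '' Icc 0 1 = Γ

variable {E}

/-- The loops `β₁, …, βₙ` are independent: their images form a finite embedded graph such that
every `βᵢ` has an edge whose interior points are passed exactly once by `βᵢ`, and which meets the
other loops at most in its vertices. -/
def IndependentLoops {x : M} {n : ℕ} (β : Fin n → PAPath E x x) : Prop :=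
  ∃ (m : ℕ) (e : Fin m → ℝ → M), IsGraph E e (⋃ i, range (β i).1) ∧
    ∀ i, ∃ k : Fin m,
      (∀ s ∈ Ioo (0 : ℝ) 1, ∃! t : I, (β i).1 t = e k s) ∧
      ∀ j, j ≠ i → e k '' Icc 0 1 ∩ range (β j).1 ⊆ edgeVertices (e k)

/-- The subgroup of the group of loops generated by a finite family of loops. -/
noncomputable def generatedSubgroup {x : M} {n : ℕ} (β : Fin n → PAPath E x x) : Subgroup (LoopGroup E x) :=
  Subgroup.closure (range fun i => loopClass (β i))

variable (E)

/-- The index set: subgroups of the group of loops generated by a finite independent family,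
ordered by inclusion. -/
abbrev LoopIndex (x : M) : Type _ :=
  {L : Subgroup (LoopGroup E x) //
    ∃ (n : ℕ) (β : Fin n → PAPath E x x), IndependentLoops β ∧ L = generatedSubgroup β}

end Paths

/-! ### The compact groups `Hom(L, U(1))` and their Hilbert spaces -/

noncomputable section

/-- `Hom(G, U(1))`, with pointwise multiplication and the topology of pointwise convergence. -/
def HomU1 (G : Type*) [Group G] : Type _ := G →* Circle

namespace HomU1

variable {G : Type*} [Group G]

instance : CommGroup (HomU1 G) := inferInstanceAs (CommGroup (G →* Circle))

instance : FunLike (HomU1 G) G Circle := inferInstanceAs (FunLike (G →* Circle) G Circle)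

instance : MonoidHomClass (HomU1 G) G Circle :=
  inferInstanceAs (MonoidHomClass (G →* Circle) G Circle)

instance : TopologicalSpace (HomU1 G) :=
  TopologicalSpace.induced (fun (H : HomU1 G) (g : G) => H g) inferInstance

/-- The inclusion of `Hom(G, U(1))` in the product group `U(1)^G`. -/
def toPi : HomU1 G →* (G → Circle) where
  toFun H g := H g
  map_one' := rfl
  map_mul' _ _ := rfl

instance : IsTopologicalGroup (HomU1 G) := topologicalGroup_induced (toPi (G := G))

theorem isClosedEmbedding_toPi : IsClosedEmbedding (toPi (G := G)) where
  eq_induced := rfl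
  injective := fun _ _ h => DFunLike.ext _ _ fun g => congrFun h g
  isClosed_range := by
    have : range (toPi (G := G)) = ⋂ (a : G) (b : G), {f | f (a * b) = f a * f b} := by
      ext f
      simp only [mem_range, mem_iInter, mem_ofPred_eq]
      constructor
      · rintro ⟨H, rfl⟩ a b
        exact map_mul H a b
      · intro h
        exact ⟨MonoidHom.mk' f h, rfl⟩
    rw [this]
    refine isClosed_iInter fun a => isClosed_iInter fun b => isClosed_eq ?_ ?_ <;> fun_prop

instance : CompactSpace (HomU1 G) := isClosedEmbedding_toPi.compactSpace

instance : T2Space (HomU1 G) := isClosedEmbedding_toPi.isEmbedding.t2Space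

instance : MeasurableSpace (HomU1 G) := borel _

instance : BorelSpace (HomU1 G) := ⟨rfl⟩

theorem continuous_eval (g : G) : Continuous fun H : HomU1 G => H g :=
  (continuous_apply g).comp isClosedEmbedding_toPi.continuous

/-- The projection `Hom(G, U(1)) → Hom(L, U(1))`, restriction to the subgroup `L`. -/
def restrict (L : Subgroup G) (H : HomU1 G) : HomU1 L := MonoidHom.comp (H : G →* Circle) L.subtype

/-- The projection `Hom(L', U(1)) → Hom(L, U(1))`, restriction to `L ≤ L'`. -/
def restrictLE {L L' : Subgroup G} (h : L ≤ L') (H : HomU1 L') : HomU1 L :=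
  MonoidHom.comp (H : L' →* Circle) (Subgroup.inclusion h)

/-- The Wilson functions `T_α(H) = H(α)`, as characters of `Hom(G, U(1))`. -/
def wilson : G →* PontryaginDual (HomU1 G) where
  toFun α :=
    { toFun := fun H => H α
      map_one' := rfl
      map_mul' := fun _ _ => rfl
      continuous_toFun := continuous_eval α }
  map_one' := PontryaginDual.ext fun H => map_one H
  map_mul' α β := PontryaginDual.ext fun H => map_mul H α β

end HomU1

/-- The torus `U(1)ⁿ`. -/
def Torus (n : ℕ) : Type := Fin n → Circle

namespace Torus

variable (n : ℕ)

instance : CommGroup (Torus n) := inferInstanceAs (CommGroup (Fin n → Circle))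
instance : TopologicalSpace (Torus n) := inferInstanceAs (TopologicalSpace (Fin n → Circle))
instance : IsTopologicalGroup (Torus n) := inferInstanceAs (IsTopologicalGroup (Fin n → Circle))
instance : CompactSpace (Torus n) := inferInstanceAs (CompactSpace (Fin n → Circle))
instance : MeasurableSpace (Torus n) := borel _
instance : BorelSpace (Torus n) := ⟨rfl⟩

end Torus

section HaarL2

variable (G : Type*) [Group G] [TopologicalSpace G] [IsTopologicalGroup G] [CompactSpace G]
  [MeasurableSpace G] [BorelSpace G]

/-- The normalized Haar measure of a compact group. -/
def normHaar : Measure G := Measure.haarMeasure ⊤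

/-- `L²(G)` for the normalized Haar measure. -/
abbrev HaarL2 : Type _ := Lp ℂ 2 (normHaar G)

end HaarL2

/-- `L²` of a discrete group (Haar measure = counting measure). -/
abbrev DiscreteL2 (W : Type*) : Type _ := lp (fun _ : W => ℂ) 2

section Maps

variable {G G' : Type*} [Group G] [TopologicalSpace G] [IsTopologicalGroup G] [CompactSpace G]
  [MeasurableSpace G] [BorelSpace G] [Group G'] [TopologicalSpace G'] [IsTopologicalGroup G']
  [CompactSpace G'] [MeasurableSpace G'] [BorelSpace G']

/-- `i` is the pull-back `ψ ↦ ψ ∘ π`. -/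
def IsPullback (π : G' → G) (i : HaarL2 G → HaarL2 G') : Prop :=
  ∀ ψ : HaarL2 G, (i ψ : G' → ℂ) =ᵐ[normHaar G'] fun H => ψ (π H)

/-- `F` is the Fourier transform of the compact Abelian group `G`:
`(F ψ)(χ) = ∫ conj(χ) ψ` for every `χ` in the dual group. -/
def IsFourierTransform (F : HaarL2 G → DiscreteL2 (PontryaginDual G)) : Prop :=
  ∀ (ψ : HaarL2 G) (χ : PontryaginDual G),
    F ψ χ = ∫ H, conj (χ H : ℂ) * ψ H ∂normHaar G

end Maps

/-! ### Inductive limits of Hilbert spaces -/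

section InductiveLimits

variable {J : Type*} [PartialOrder J]
  {𝓗 : J → Type*} [∀ a, NormedAddCommGroup (𝓗 a)] [∀ a, InnerProductSpace ℂ (𝓗 a)]
  {𝓗' : J → Type*} [∀ a, NormedAddCommGroup (𝓗' a)] [∀ a, InnerProductSpace ℂ (𝓗' a)]
  {𝓚 : Type*} [NormedAddCommGroup 𝓚] [InnerProductSpace ℂ 𝓚]
  {𝓚' : Type*} [NormedAddCommGroup 𝓚'] [InnerProductSpace ℂ 𝓚']

/-- Isometric linear maps `i a b : 𝓗 a → 𝓗 b`, for `a ≤ b` in a directed set, form an inductive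
family. -/
structure IsInductiveFamily (i : ∀ a b, a ≤ b → 𝓗 a →ₗᵢ[ℂ] 𝓗 b) : Prop where
  nonempty : Nonempty J
  directed : ∀ a b : J, ∃ c, a ≤ c ∧ b ≤ c
  id : ∀ a x, i a a le_rfl x = x
  comp : ∀ a b c (hab : a ≤ b) (hbc : b ≤ c) x,
    i b c hbc (i a b hab x) = i a c (hab.trans hbc) x

/-- `𝓚`, with the isometric linear maps `ι a : 𝓗 a → 𝓚`, is the inductive limit of the inductive
family `i`: the inclusions are compatible and they cover a dense linear subspace. -/
structure IsInductiveLimit (i : ∀ a b, a ≤ b → 𝓗 a →ₗᵢ[ℂ] 𝓗 b)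
    (ι : ∀ a, 𝓗 a →ₗᵢ[ℂ] 𝓚) : Prop where
  family : IsInductiveFamily i
  complete : CompleteSpace 𝓚
  compat : ∀ a b (h : a ≤ b) x, ι b (i a b h x) = ι a x
  dense : ∃ V : Submodule ℂ 𝓚, (V : Set 𝓚) = ⋃ a, range (ι a) ∧ Dense (V : Set 𝓚)

/-- The unitary map `Φ : 𝓚 → 𝓚'` between the inductive limits of `i` and `i'` is the inductive
limit of the family of unitary maps `φ a : 𝓗 a → 𝓗' a`: the `φ a` form an inductive family, and
`Φ` is the unique unitary map that is compatible with them. -/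
structure IsInductiveLimitOfUnitaries (i : ∀ a b, a ≤ b → 𝓗 a →ₗᵢ[ℂ] 𝓗 b)
    (i' : ∀ a b, a ≤ b → 𝓗' a →ₗᵢ[ℂ] 𝓗' b) (ι : ∀ a, 𝓗 a →ₗᵢ[ℂ] 𝓚) (ι' : ∀ a, 𝓗' a →ₗᵢ[ℂ] 𝓚')
    (φ : ∀ a, 𝓗 a ≃ₗᵢ[ℂ] 𝓗' a) (Φ : 𝓚 ≃ₗᵢ[ℂ] 𝓚') : Prop where
  family : ∀ a b (h : a ≤ b) x, i' a b h (φ a x) = φ b (i a b h x)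
  compat : ∀ a x, Φ (ι a x) = ι' a (φ a x)
  unique : ∀ Ψ : 𝓚 ≃ₗᵢ[ℂ] 𝓚', (∀ a x, Ψ (ι a x) = ι' a (φ a x)) → Ψ = Φ

end InductiveLimits

/-! ### Generalized connections and hoops -/

section Hoops

variable (E : Type*) [NormedAddCommGroup E] [NormedSpace ℝ E]
  {M : Type*} [TopologicalSpace M] [ChartedSpace E M]

/-- The compact Abelian group of generalized `U(1)`-connections modulo gauge transformations:
the homomorphisms from the group of loops to `U(1)`. -/
abbrev GenConn (x : M) : Type _ := HomU1 (LoopGroup E x)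

/-- `Hom(L, U(1))` for an index `L`. -/
abbrev GenConnAt {x : M} (L : LoopIndex E x) : Type _ := HomU1 L.1

/-- The group of hoops: the Wilson functions `T_α`, with pointwise multiplication. -/
abbrev HoopGroup (x : M) : Type _ := (HomU1.wilson (G := LoopGroup E x)).range

variable {E}

/-- `T_α` as an element of the group of hoops. -/
def hoop {x : M} (α : LoopGroup E x) : HoopGroup E x := HomU1.wilson.rangeRestrict α

/-- `T` is the loop transform: `(T ψ)(T_α) = ∫ conj(T_α) ψ` for every loop `α`. -/
def IsLoopTransform {x : M} (T : HaarL2 (GenConn E x) → DiscreteL2 (HoopGroup E x)) : Prop :=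
  ∀ (ψ : HaarL2 (GenConn E x)) (α : LoopGroup E x),
    T ψ (hoop α) = ∫ H : GenConn E x, conj (H α : ℂ) * ψ H ∂normHaar (GenConn E x)

end Hoops

end

/-! ### Germs of analytic curves -/

section Germs

open Filter

/-- A germ `z ↦ z ^ k * a z` with `a 0 > 0` is the `k`-th power of a local analytic coordinate. -/
theorem exists_analytic_root {h a : ℝ → ℝ} {k : ℕ} (hk : k ≠ 0) (ha : AnalyticAt ℝ a 0)
    (ha0 : 0 < a 0) (hh : ∀ᶠ z in 𝓝 0, h z = z ^ k * a z) :
    ∃ u ρ : ℝ → ℝ, AnalyticAt ℝ ρ 0 ∧ ρ 0 = 0 ∧ Tendsto u (𝓝[>] 0) (𝓝[>] 0) ∧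
      Tendsto ρ (𝓝[>] 0) (𝓝[>] 0) ∧ (∀ᶠ z in 𝓝 0, ρ (u z) = z) ∧
      ∀ᶠ z in 𝓝 0, u z ^ k = h z := by
  -- This is `z * a(z)^(1/k)`, analytic because `a 0 > 0`. Its derivative at `0` is `a(0)^(1/k) ≠
  -- 0`, so it has an analytic local inverse `ρ`.
  let u : ℝ → ℝ := fun z => z * Real.exp (Real.log (a z) / k)
  have hu : AnalyticAt ℝ u 0 := by
    have h1 : AnalyticAt ℝ (fun z => Real.log (a z)) 0 := ha.log ha0
    exact analyticAt_id.mul (h1.div_const (c := (k : ℝ))).rexp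
  have hu0 : u 0 = 0 := by simp [u]
  have hd : deriv u 0 ≠ 0 := by
    have h1 : HasDerivAt (fun z => Real.exp (Real.log (a z) / k)) _ 0 :=
      (((ha.log ha0).div_const (c := (k : ℝ))).rexp.differentiableAt).hasDerivAt
    have h2 : HasDerivAt u _ 0 := (hasDerivAt_id (0 : ℝ)).mul h1
    rw [h2.deriv]
    simp [Real.exp_ne_zero]
  let ρ := hu.hasStrictDerivAt.localInverse _ _ _ hd
  have hρ : AnalyticAt ℝ ρ 0 := by
    have := hu.analyticAt_localInverse hd
    rwa [hu0] at this
  have hl : ∀ᶠ z in 𝓝 0, ρ (u z) = z := HasStrictDerivAt.eventually_left_inverse ..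
  have hr : ∀ᶠ w in 𝓝 (0 : ℝ), u (ρ w) = w := by
    have : ∀ᶠ w in 𝓝 (u 0), u (ρ w) = w := HasStrictDerivAt.eventually_right_inverse ..
    rwa [hu0] at this
  have hρ0 : ρ 0 = 0 := by
    have := hl.self_of_nhds
    rwa [hu0] at this
  refine ⟨u, ρ, hρ, hρ0, ?_, ?_, hl, ?_⟩
  · refine tendsto_nhdsWithin_iff.2 ⟨?_, ?_⟩
    · have := hu.continuousAt.tendsto
      rw [hu0] at this
      exact this.mono_left nhdsWithin_le_nhds
    · filter_upwards [self_mem_nhdsWithin] with z hz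
      exact mul_pos hz (Real.exp_pos _)
  · refine tendsto_nhdsWithin_iff.2 ⟨?_, ?_⟩
    · have := hρ.continuousAt.tendsto
      rw [hρ0] at this
      exact this.mono_left nhdsWithin_le_nhds
    · filter_upwards [self_mem_nhdsWithin, hr.filter_mono nhdsWithin_le_nhds] with w hw h1
      have h2 : 0 < ρ w * Real.exp (Real.log (a (ρ w)) / k) := by
        change 0 < u (ρ w)
        rw [h1]
        exact hw
      exact pos_of_mul_pos_left h2 (Real.exp_pos _).le
  · filter_upwards [hh, ha.continuousAt.eventually (lt_mem_nhds ha0)] with z hz hpos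
    simp only [u]
    rw [mul_pow, ← Real.exp_nat_mul, mul_div_cancel₀ _ (Nat.cast_ne_zero.2 hk),
      Real.exp_log hpos, hz]

variable {E : Type*} [NormedAddCommGroup E] [NormedSpace ℝ E]

/-- Order of vanishing of a nonzero analytic germ. -/
theorem AnalyticAt.exists_eq_pow_smul {f : ℝ → E} {z₀ : ℝ} (hf : AnalyticAt ℝ f z₀)
    (hne : ¬ ∀ᶠ z in 𝓝 z₀, f z = 0) :
    ∃ (k : ℕ) (F : ℝ → E), AnalyticAt ℝ F z₀ ∧ F z₀ ≠ 0 ∧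
      ∀ᶠ z in 𝓝 z₀, f z = (z - z₀) ^ k • F z :=
  hf.exists_eventuallyEq_pow_smul_nonzero_iff.2 hne

theorem exists_dual_ne_zero₂ {v w : E} (hv : v ≠ 0) (hw : w ≠ 0) :
    ∃ φ : E →L[ℝ] ℝ, φ v ≠ 0 ∧ φ w ≠ 0 := by
  obtain ⟨φ, hφ⟩ := SeparatingDual.exists_ne_zero (R := ℝ) hv
  obtain ⟨ψ, hψ⟩ := SeparatingDual.exists_ne_zero (R := ℝ) hw
  by_cases h1 : φ w = 0
  · by_cases h2 : ψ v = 0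
    · exact ⟨φ + ψ, by simpa [h2], by simpa [h1]⟩
    · exact ⟨ψ, h2, hψ⟩
  · exact ⟨φ, hφ, h1⟩

/-- If two nonconstant analytic half-branches through a point meet arbitrarily close to it,
then one is contained in the other near that point. -/
theorem halfBranch_subset_of_frequently_eq {f g : ℝ → E} (hf : AnalyticAt ℝ f 0)
    (hg : AnalyticAt ℝ g 0) (h0 : f 0 = g 0) (hfc : ¬ ∀ᶠ z in 𝓝 0, f z = f 0)
    (hgc : ¬ ∀ᶠ z in 𝓝 0, g z = g 0)
    (hfg : ∃ᶠ p : ℝ × ℝ in 𝓝[>] 0 ×ˢ 𝓝[>] 0, f p.1 = g p.2) {δ : ℝ} (hδ : 0 < δ) :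
    ∀ᶠ s in 𝓝[>] 0, ∃ t ∈ Ioo 0 δ, f s = g t := by
  obtain ⟨k, A, hA, hA0, hfA⟩ :=
    (hf.sub analyticAt_const).exists_eq_pow_smul (f := f - fun _ => f 0)
    (by simpa [sub_eq_zero] using hfc)
  obtain ⟨l, B, hB, hB0, hgB⟩ :=
    (hg.sub analyticAt_const).exists_eq_pow_smul (f := g - fun _ => g 0)
    (by simpa [sub_eq_zero] using hgc)
  simp only [sub_zero, Pi.sub_apply] at hfA hgB
  have hk : k ≠ 0 := by
    rintro rfl
    have := hfA.self_of_nhds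
    simp at this
    exact hA0 this.symm
  have hl : l ≠ 0 := by
    rintro rfl
    have := hgB.self_of_nhds
    simp at this
    exact hB0 this.symm
  -- A functional that is nonzero on both leading coefficients has the same sign on them: a meeting
  -- at `(s, t)` gives `s ^ k * φ (A s) = t ^ l * φ (B t)` with `s, t > 0`. Replacing `φ` by `-φ` if
  -- necessary makes both values positive.
  have key : ∃ φ : E →L[ℝ] ℝ, 0 < φ (A 0) ∧ 0 < φ (B 0) := by
    obtain ⟨φ, h1, h2⟩ := exists_dual_ne_zero₂ hA0 hB0
    have hprod : 0 < φ (A 0) * φ (B 0) := by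
      by_contra hneg
      have hneg : φ (A 0) * φ (B 0) < 0 :=
        lt_of_le_of_ne (not_lt.1 hneg) (mul_ne_zero h1 h2)
      have c1 : Tendsto (fun p : ℝ × ℝ => φ (A p.1) * φ (B p.2)) (𝓝[>] 0 ×ˢ 𝓝[>] 0)
          (𝓝 (φ (A 0) * φ (B 0))) := by
        have a1 : Tendsto (fun z => φ (A z)) (𝓝[>] 0) (𝓝 (φ (A 0))) :=
          (φ.continuous.continuousAt.comp hA.continuousAt).tendsto.mono_left nhdsWithin_le_nhds
        have a2 : Tendsto (fun z => φ (B z)) (𝓝[>] 0) (𝓝 (φ (B 0))) :=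
          (φ.continuous.continuousAt.comp hB.continuousAt).tendsto.mono_left nhdsWithin_le_nhds
        exact (a1.comp tendsto_fst).mul (a2.comp tendsto_snd)
      have c2 := c1.eventually (gt_mem_nhds hneg)
      have c3 : ∀ᶠ p : ℝ × ℝ in 𝓝[>] 0 ×ˢ 𝓝[>] 0,
          (0 < p.1 ∧ f p.1 - f 0 = p.1 ^ k • A p.1) ∧ (0 < p.2 ∧ g p.2 - g 0 = p.2 ^ l • B p.2) :=
        ((eventually_mem_nhdsWithin).and (hfA.filter_mono nhdsWithin_le_nhds)).prod_mk
          ((eventually_mem_nhdsWithin).and (hgB.filter_mono nhdsWithin_le_nhds))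
      obtain ⟨p, hp, hp2, ⟨hp3, hp4⟩, hp5, hp6⟩ := (hfg.and_eventually (c2.and c3)).exists
      have e : p.1 ^ k * φ (A p.1) = p.2 ^ l * φ (B p.2) := by
        rw [hp, h0, hp6] at hp4
        simpa using congrArg φ hp4.symm
      have q1 : 0 < p.1 ^ k := pow_pos hp3 _
      have q2 : 0 < p.2 ^ l := pow_pos hp5 _
      have : 0 ≤ p.1 ^ k * (φ (A p.1) * φ (B p.2)) := by
        rw [← mul_assoc, e, mul_assoc]
        exact mul_nonneg q2.le (mul_self_nonneg _)
      nlinarith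
    rcases lt_or_gt_of_ne h1 with h | h
    · exact ⟨-φ, by simpa using h, by simpa using (by nlinarith : φ (B 0) < 0)⟩
    · exact ⟨φ, h, (pos_iff_pos_of_mul_pos hprod).1 h⟩
  obtain ⟨φ, hφA, hφB⟩ := key
  obtain ⟨u, ρ, hρ, hρ0, hu, hρt, hρu, huk⟩ := exists_analytic_root
    (h := fun z => φ (f z) - φ (f 0)) (a := fun z => φ (A z)) hk
    ((φ.analyticAt _).comp hA) hφA (by
      filter_upwards [hfA] with z hz
      rw [← map_sub, hz]
      simp)
  obtain ⟨v, τ, hτ, hτ0, hv, hτt, hτv, hvl⟩ := exists_analytic_root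
    (h := fun z => φ (g z) - φ (g 0)) (a := fun z => φ (B z)) hl
    ((φ.analyticAt _).comp hB) hφB (by
      filter_upwards [hgB] with z hz
      rw [← map_sub, hz]
      simp)
  -- The common parameter `w` of the two branches. At a meeting, `u ^ k = v ^ l`, since both equal
  -- the value of `φ` on the common displacement. Putting `u = w ^ l` then forces `v = w ^ k`.
  let root : ℝ → ℝ := fun s => u s ^ ((l : ℝ)⁻¹)
  have hroot : Tendsto root (𝓝[>] 0) (𝓝[>] 0) := by
    refine Tendsto.comp (g := fun y : ℝ => y ^ ((l : ℝ)⁻¹)) (tendsto_nhdsWithin_iff.2 ⟨?_, ?_⟩) hu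
    · have hc := (Real.continuous_rpow_const (q := (l : ℝ)⁻¹) (by positivity)).tendsto 0
      rw [Real.zero_rpow (by positivity)] at hc
      exact hc.mono_left nhdsWithin_le_nhds
    · filter_upwards [self_mem_nhdsWithin] with y hy
      exact Real.rpow_pos_of_pos hy _
  have hroot_pow : ∀ s, 0 < u s → root s ^ l = u s := fun s hs =>
    Real.rpow_inv_natCast_pow hs.le hl
  have hF : AnalyticAt ℝ (fun w : ℝ => f (ρ (w ^ l))) 0 := by
    refine AnalyticAt.fun_comp (g := fun w => f (ρ w)) ?_ (analyticAt_id.pow l)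
    simp only [zero_pow hl]
    exact AnalyticAt.fun_comp (by rwa [hρ0]) hρ
  have hG : AnalyticAt ℝ (fun w : ℝ => g (τ (w ^ k))) 0 := by
    refine AnalyticAt.fun_comp (g := fun w => g (τ w)) ?_ (analyticAt_id.pow k)
    simp only [zero_pow hk]
    exact AnalyticAt.fun_comp (by rwa [hτ0]) hτ
  have hfreq : ∃ᶠ w in 𝓝[≠] (0 : ℝ), f (ρ (w ^ l)) = g (τ (w ^ k)) := by
    have ht : Tendsto (fun p : ℝ × ℝ => root p.1) (𝓝[>] 0 ×ˢ 𝓝[>] 0) (𝓝[≠] 0) :=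
      (hroot.comp tendsto_fst).mono_right
        (nhdsWithin_mono _ fun y (hy : 0 < y) => ne_of_gt hy)
    refine ht.frequently ?_
    have c : ∀ᶠ p : ℝ × ℝ in 𝓝[>] 0 ×ˢ 𝓝[>] 0,
        (0 < u p.1 ∧ ρ (u p.1) = p.1 ∧ u p.1 ^ k = φ (f p.1) - φ (f 0)) ∧
        (0 < v p.2 ∧ τ (v p.2) = p.2 ∧ v p.2 ^ l = φ (g p.2) - φ (g 0)) :=
      ((hu.eventually eventually_mem_nhdsWithin).and
        ((hρu.filter_mono nhdsWithin_le_nhds).and (huk.filter_mono nhdsWithin_le_nhds))).prod_mk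
      ((hv.eventually eventually_mem_nhdsWithin).and
        ((hτv.filter_mono nhdsWithin_le_nhds).and (hvl.filter_mono nhdsWithin_le_nhds)))
    refine (hfg.and_eventually c).mono ?_
    rintro ⟨s, t⟩ ⟨hst, ⟨h1, h2, h3⟩, h4, h5, h6⟩
    dsimp only at *
    have e : v t = root s ^ k := by
      refine (pow_left_inj₀ h4.le (pow_nonneg (Real.rpow_nonneg h1.le _) _) hl).1 ?_
      rw [h6, ← pow_mul, mul_comm k l, pow_mul, hroot_pow s h1, h3, hst, h0]
    rw [hroot_pow s h1, h2, ← e, h5, hst]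
  -- Both branches are analytic in `w` and agree for values of `w` accumulating at `0`, so the
  -- identity theorem makes them agree for all small `w`.
  have hev := (hF.frequently_eq_iff_eventually_eq hG).1 hfreq
  have htend : Tendsto (fun s => τ (root s ^ k)) (𝓝[>] 0) (𝓝[>] 0) := by
    refine hτt.comp ((tendsto_nhdsWithin_iff.2 ⟨?_, ?_⟩ : Tendsto (fun y : ℝ => y ^ k)
      (𝓝[>] 0) (𝓝[>] 0)).comp hroot)
    · have hc := (continuous_pow (M := ℝ) k).tendsto 0
      rw [zero_pow hk] at hc
      exact hc.mono_left nhdsWithin_le_nhds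
    · filter_upwards [self_mem_nhdsWithin] with y hy
      exact pow_pos (mem_Ioi.1 hy) _
  have hev' : ∀ᶠ s in 𝓝[>] 0, f (ρ (root s ^ l)) = g (τ (root s ^ k)) :=
    (hroot.mono_right nhdsWithin_le_nhds).eventually hev
  filter_upwards [hev', hu.eventually eventually_mem_nhdsWithin,
    hρu.filter_mono nhdsWithin_le_nhds, htend.eventually (Ioo_mem_nhdsGT hδ)] with s h1 h2 h3 h4
  refine ⟨_, h4, ?_⟩
  rw [← h1, hroot_pow s h2, h3]

/-- A nonconstant analytic curve is, near a parameter, injective on each side of it. -/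
theorem AnalyticAt.exists_injOn_sides [CompleteSpace E] {f : ℝ → E} {t₀ : ℝ}
    (hf : AnalyticAt ℝ f t₀)
    (hfc : ¬ ∀ᶠ z in 𝓝 t₀, f z = f t₀) :
    ∃ ε > 0, InjOn f (Icc t₀ (t₀ + ε)) ∧ InjOn f (Icc (t₀ - ε) t₀) ∧
      ∀ t, t ≠ t₀ → |t - t₀| ≤ ε → deriv f t ≠ 0 := by
  -- The derivative is not identically zero near `t₀`, for otherwise `f` would be constant on a
  -- ball.
  obtain ⟨k, A, hA, hA0, hfA⟩ := (hf.deriv).exists_eq_pow_smul (by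
    intro h
    apply hfc
    obtain ⟨ε, hε, hball⟩ := Metric.eventually_nhds_iff_ball.1 (h.and hf.eventually_analyticAt)
    filter_upwards [Metric.ball_mem_nhds t₀ hε] with z hz
    exact (convex_ball t₀ ε).is_const_of_fderivWithin_eq_zero (𝕜 := ℝ)
      (fun y hy => (hball y hy).2.differentiableAt.differentiableWithinAt)
      (fun y hy => by
        rw [fderivWithin_of_isOpen Metric.isOpen_ball hy]
        ext
        simpa using (hball y hy).1) hz (Metric.mem_ball_self hε))
  obtain ⟨φ, hφ⟩ := SeparatingDual.exists_ne_zero (R := ℝ) hA0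
  have hev : ∀ᶠ t in 𝓝 t₀, AnalyticAt ℝ f t ∧ (t ≠ t₀ → φ (deriv f t) ≠ 0) := by
    filter_upwards [hf.eventually_analyticAt, hfA,
      (φ.continuous.continuousAt.comp hA.continuousAt).eventually_ne hφ] with t h1 h2 h3
    refine ⟨h1, fun hne => ?_⟩
    rw [h2, map_smul, smul_eq_mul]
    exact mul_ne_zero (pow_ne_zero _ (sub_ne_zero.2 hne)) h3
  obtain ⟨ε, hε, hball⟩ := Metric.eventually_nhds_iff_ball.1 hev
  have hmem : ∀ t, |t - t₀| ≤ ε / 2 → t ∈ Metric.ball t₀ ε := fun t ht => by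
    rw [Metric.mem_ball, Real.dist_eq]
    linarith
  -- Rolle's theorem applied to the scalar function `φ ∘ f`, whose derivative vanishes at most at
  -- `t₀` in this neighbourhood.
  have rolle : ∀ a b, a < b → (∀ t ∈ Icc a b, |t - t₀| ≤ ε / 2) → t₀ ∉ Ioo a b → f a ≠ f b := by
    intro a b hab hI ht₀ hfab
    obtain ⟨c, hc, hc0⟩ := exists_hasDerivAt_eq_zero (f := fun t => φ (f t))
      (f' := fun t => φ (deriv f t)) hab
      (fun t ht => (φ.continuous.continuousAt.comp
        (hball t (hmem t (hI t ht))).1.continuousAt).continuousWithinAt) (by rw [hfab])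
      (fun t ht => by
        have := (hball t (hmem t (hI t (Ioo_subset_Icc_self ht)))).1.differentiableAt.hasDerivAt
        exact φ.hasFDerivAt.comp_hasDerivAt t this)
    exact (hball c (hmem c (hI c (Ioo_subset_Icc_self hc)))).2 (fun h => ht₀ (h ▸ hc)) hc0
  have inj : ∀ a b, a ≤ b → (∀ t ∈ Icc a b, |t - t₀| ≤ ε / 2) → t₀ ∉ Ioo a b →
      InjOn f (Icc a b) := by
    intro a b _ hI ht₀ s hs t ht hst
    by_contra hne
    rcases lt_or_gt_of_ne hne with h | h
    · exact rolle s t h (fun r hr => hI r ⟨hs.1.trans hr.1, hr.2.trans ht.2⟩)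
        (fun h' => ht₀ ⟨hs.1.trans_lt h'.1, h'.2.trans_le ht.2⟩) hst
    · exact rolle t s h (fun r hr => hI r ⟨ht.1.trans hr.1, hr.2.trans hs.2⟩)
        (fun h' => ht₀ ⟨ht.1.trans_lt h'.1, h'.2.trans_le hs.2⟩) hst.symm
  refine ⟨ε / 2, by positivity, inj _ _ (by linarith) ?_ (fun h => lt_irrefl _ h.1),
    inj _ _ (by linarith) ?_ (fun h => lt_irrefl _ h.2), fun t ht ht' h => ?_⟩
  · intro t ht
    rw [abs_le]
    constructor <;> linarith [ht.1, ht.2]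
  · intro t ht
    rw [abs_le]
    constructor <;> linarith [ht.1, ht.2]
  · exact (hball t (hmem t ht')).2 ht (by rw [h, map_zero])

end Germs

/-! ### Analytic curves in a manifold -/

section Curves

open Filter

variable {E : Type*} [NormedAddCommGroup E] [NormedSpace ℝ E]
  {M : Type*} [TopologicalSpace M] [ChartedSpace E M]

theorem ContMDiffAt.analyticAt_extChartAt {η : ℝ → M} {t : ℝ}
    (h : ContMDiffAt 𝓘(ℝ, ℝ) 𝓘(ℝ, E) ω η t) :
    AnalyticAt ℝ (fun s => extChartAt 𝓘(ℝ, E) (η t) (η s)) t :=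
  (contMDiffAt_iff_contDiffAt.1 (contMDiffAt_iff_target.1 h).2).analyticAt

theorem ContMDiffAt.eventually_mem_extChartAt_source {η : ℝ → M} {t : ℝ}
    (h : ContMDiffAt 𝓘(ℝ, ℝ) 𝓘(ℝ, E) ω η t) :
    ∀ᶠ s in 𝓝 t, η s ∈ (extChartAt 𝓘(ℝ, E) (η t)).source :=
  h.continuousAt.eventually (extChartAt_source_mem_nhds (η t))

theorem ContMDiffAt.eventually_const_of_extChartAt {η : ℝ → M} {t : ℝ}
    (h : ContMDiffAt 𝓘(ℝ, ℝ) 𝓘(ℝ, E) ω η t)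
    (hc : ∀ᶠ s in 𝓝 t, extChartAt 𝓘(ℝ, E) (η t) (η s) = extChartAt 𝓘(ℝ, E) (η t) (η t)) :
    ∀ᶠ s in 𝓝 t, η s = η t := by
  filter_upwards [hc, h.eventually_mem_extChartAt_source] with s hs hs'
  exact (extChartAt 𝓘(ℝ, E) (η t)).injOn hs' (mem_extChartAt_source _) hs

theorem ContMDiffAt.comp_affine {η : ℝ → M} {c d t : ℝ}
    (h : ContMDiffAt 𝓘(ℝ, ℝ) 𝓘(ℝ, E) ω η (c * t + d)) :
    ContMDiffAt 𝓘(ℝ, ℝ) 𝓘(ℝ, E) ω (fun s => η (c * s + d)) t := by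
  have h1 : ContMDiffAt 𝓘(ℝ, ℝ) 𝓘(ℝ, ℝ) ω (fun s : ℝ => c * s + d) t := by
    apply ContDiffAt.contMDiffAt
    fun_prop
  exact ContMDiffAt.comp (g := η) (f := fun s : ℝ => c * s + d) t h h1

theorem ContMDiffAt.comp_neg {η : ℝ → M} {t : ℝ}
    (h : ContMDiffAt 𝓘(ℝ, ℝ) 𝓘(ℝ, E) ω η (-t)) :
    ContMDiffAt 𝓘(ℝ, ℝ) 𝓘(ℝ, E) ω (fun s => η (-s)) t := by
  have h1 : ContMDiffAt 𝓘(ℝ, ℝ) 𝓘(ℝ, ℝ) ω (fun s : ℝ => -s) t := by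
    apply ContDiffAt.contMDiffAt
    fun_prop
  exact ContMDiffAt.comp (g := η) (f := fun s : ℝ => -s) t h h1

/-- Manifold version of `halfBranch_subset_of_frequently_eq`. -/
theorem ContMDiffAt.eventually_exists_eq {f g : ℝ → M} {s₀ t₀ : ℝ}
    (hf : ContMDiffAt 𝓘(ℝ, ℝ) 𝓘(ℝ, E) ω f s₀) (hg : ContMDiffAt 𝓘(ℝ, ℝ) 𝓘(ℝ, E) ω g t₀)
    (h0 : f s₀ = g t₀) (hfc : ¬ ∀ᶠ s in 𝓝 s₀, f s = f s₀) (hgc : ¬ ∀ᶠ t in 𝓝 t₀, g t = g t₀)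
    (hfg : ∃ᶠ p : ℝ × ℝ in 𝓝[>] s₀ ×ˢ 𝓝[>] t₀, f p.1 = g p.2) {δ : ℝ} (hδ : 0 < δ) :
    ∀ᶠ s in 𝓝[>] s₀, ∃ t ∈ Ioo t₀ (t₀ + δ), f s = g t := by
  have sub_tendsto : ∀ a : ℝ, Tendsto (fun s => s - a) (𝓝[>] a) (𝓝[>] 0) := by
    intro a
    refine tendsto_nhdsWithin_iff.2 ⟨?_, ?_⟩
    · have h : Tendsto (fun s => s - a) (𝓝 a) (𝓝 (a - a)) :=
        (continuous_id.sub continuous_const).tendsto a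
      rw [sub_self] at h
      exact h.mono_left nhdsWithin_le_nhds
    · filter_upwards [self_mem_nhdsWithin] with s hs
      exact mem_Ioi.2 (sub_pos.2 hs)
  have add_tendsto : ∀ a : ℝ, Tendsto (fun z => a + z) (𝓝 0) (𝓝 a) := fun a => by
    have h : Tendsto (fun z => a + z) (𝓝 0) (𝓝 (a + 0)) :=
      (continuous_const.add continuous_id).tendsto 0
    rwa [add_zero] at h
  have sub_tendsto' : ∀ a : ℝ, Tendsto (fun s => s - a) (𝓝 a) (𝓝 0) := fun a => by
    have h : Tendsto (fun s => s - a) (𝓝 a) (𝓝 (a - a)) :=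
      (continuous_id.sub continuous_const).tendsto a
    rwa [sub_self] at h
  set κ := extChartAt 𝓘(ℝ, E) (f s₀) with hκ
  have aF : AnalyticAt ℝ (fun z => κ (f (s₀ + z))) 0 := by
    refine AnalyticAt.fun_comp (g := fun s => κ (f s)) (f := fun z => s₀ + z) ?_ (by fun_prop)
    rw [add_zero]
    exact hf.analyticAt_extChartAt
  have hκ' : κ = extChartAt 𝓘(ℝ, E) (g t₀) := by rw [hκ, h0]
  have aG : AnalyticAt ℝ (fun z => κ (g (t₀ + z))) 0 := by
    refine AnalyticAt.fun_comp (g := fun s => κ (g s)) (f := fun z => t₀ + z) ?_ (by fun_prop)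
    rw [add_zero, hκ']
    exact hg.analyticAt_extChartAt
  have hfs := hf.eventually_mem_extChartAt_source
  have hgs := hg.eventually_mem_extChartAt_source
  rw [← hκ'] at hgs
  -- The parameter found on `g` has to stay in the domain of the chart, where equal coordinates mean
  -- equal points; this is why the half-branch lemma is used with `min δ δ'`.
  obtain ⟨δ', hδ', hball⟩ := Metric.eventually_nhds_iff_ball.1 hgs
  have key := halfBranch_subset_of_frequently_eq aF aG (by simp [h0])
    (fun h => hfc (hf.eventually_const_of_extChartAt (by
      have := (sub_tendsto' s₀).eventually h
      simpa [hκ] using this)))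
    (fun h => hgc (hg.eventually_const_of_extChartAt (by
      have := (sub_tendsto' t₀).eventually h
      simpa [hκ'] using this)))
    (by
      have ht : Tendsto (fun p : ℝ × ℝ => (p.1 - s₀, p.2 - t₀)) (𝓝[>] s₀ ×ˢ 𝓝[>] t₀)
          (𝓝[>] 0 ×ˢ 𝓝[>] 0) := (sub_tendsto s₀).prodMap (sub_tendsto t₀)
      refine ht.frequently (hfg.mono fun p hp => ?_)
      simp [hp]) (lt_min hδ hδ')
  filter_upwards [(sub_tendsto s₀).eventually key, hfs.filter_mono nhdsWithin_le_nhds]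
    with s ⟨t, ht, hst⟩ hs
  have ht2 := lt_min_iff.1 ht.2
  refine ⟨t₀ + t, ⟨by linarith [ht.1], by linarith⟩, ?_⟩
  simp only [add_sub_cancel] at hst
  refine κ.injOn hs (hball _ ?_) hst
  rw [Metric.mem_ball, Real.dist_eq, add_sub_cancel_left, abs_of_pos ht.1]
  exact ht2.2

theorem not_eventually_const_of_injOn {N : Type*} {g : ℝ → N} {c d t : ℝ} (hcd : c < d)
    (hinj : InjOn g (Icc c d)) (ht : t ∈ Icc c d) : ¬ ∀ᶠ s in 𝓝 t, g s = g t := by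
  intro h
  rcases ht.2.lt_or_eq with hd | rfl
  · obtain ⟨s, hs, hs'⟩ := ((h.filter_mono nhdsWithin_le_nhds).and (Ioo_mem_nhdsGT hd)).exists
    exact hs'.1.ne' (hinj ⟨ht.1.trans hs'.1.le, hs'.2.le⟩ ht hs)
  · obtain ⟨s, hs, hs'⟩ := ((h.filter_mono nhdsWithin_le_nhds).and (Ioo_mem_nhdsLT hcd)).exists
    exact hs'.2.ne (hinj ⟨hs'.1.le, hs'.2.le⟩ ht hs)

/-- On the right of a parameter, an analytic curve runs inside a given analytic arc, or avoids
it. -/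
theorem ContMDiffAt.eventually_mem_or_notMem_arc_right [T2Space M] {f g : ℝ → M} {s₀ c d : ℝ}
    (hf : ContMDiffAt 𝓘(ℝ, ℝ) 𝓘(ℝ, E) ω f s₀)
    (hg : ∀ t ∈ Icc c d, ContMDiffAt 𝓘(ℝ, ℝ) 𝓘(ℝ, E) ω g t) (hcd : c < d)
    (hinj : InjOn g (Icc c d)) :
    (∀ᶠ s in 𝓝[>] s₀, f s ∈ g '' Icc c d) ∨ ∀ᶠ s in 𝓝[>] s₀, f s ∉ g '' Icc c d := by
  by_cases hev : ∀ᶠ s in 𝓝[>] s₀, f s ∉ g '' Icc c d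
  · exact Or.inr hev
  left
  have hfreq : ∃ᶠ s in 𝓝[>] s₀, f s ∈ g '' Icc c d := hev
  by_cases hfc : ∀ᶠ s in 𝓝 s₀, f s = f s₀
  · have hfc' := hfc.filter_mono (nhdsWithin_le_nhds (s := Ioi s₀))
    obtain ⟨s, hs, hs'⟩ := (hfreq.and_eventually hfc').exists
    filter_upwards [hfc'] with r hr
    rw [hr, ← hs']
    exact hs
  -- Meetings at the point `f s₀` itself are excluded, so that the corresponding parameters on the
  -- arc never equal their limit `t₀`.
  have hne : ∀ᶠ s in 𝓝[>] s₀, f s ≠ f s₀ := by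
    rcases hf.analyticAt_extChartAt.eventually_eq_or_eventually_ne
      (analyticAt_const (v := extChartAt 𝓘(ℝ, E) (f s₀) (f s₀))) with h | h
    · exact absurd (hf.eventually_const_of_extChartAt h) hfc
    · refine (h.filter_mono (nhdsWithin_mono _ fun y (hy : s₀ < y) => ne_of_gt hy)).mono ?_
      intro s hs hs'
      exact hs (by rw [hs'])
  obtain ⟨s, hs, hs'⟩ := exists_seq_forall_of_frequently (hfreq.and_eventually hne)
  choose hmem hne' using hs'
  choose t ht hst using hmem
  obtain ⟨t₀, ht₀, φ, hφ, htφ⟩ := isCompact_Icc.tendsto_subseq ht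
  have hsφ : Tendsto (s ∘ φ) atTop (𝓝[>] s₀) := hs.comp hφ.tendsto_atTop
  have h0 : f s₀ = g t₀ := by
    have h1 : Tendsto (fun n => f (s (φ n))) atTop (𝓝 (f s₀)) :=
      hf.continuousAt.tendsto.comp (hsφ.mono_right nhdsWithin_le_nhds)
    have h2 : Tendsto (fun n => g (t (φ n))) atTop (𝓝 (g t₀)) :=
      (hg t₀ ht₀).continuousAt.tendsto.comp htφ
    simp only [hst] at h2
    exact tendsto_nhds_unique h1 h2
  have hgc := not_eventually_const_of_injOn hcd hinj ht₀
  -- The meeting parameters approach `t₀` infinitely often from one fixed side. Approach from the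
  -- left is reduced to approach from the right by reversing `g`.
  have hside : (∃ᶠ n in atTop, t₀ < t (φ n)) ∨ ∃ᶠ n in atTop, t (φ n) < t₀ := by
    rw [← frequently_or_distrib]
    refine Eventually.frequently (Eventually.of_forall fun n => ?_)
    refine (lt_or_gt_of_ne fun h => hne' (φ n) ?_).symm
    rw [← hst, h, h0]
  rcases hside with hside | hside
  · have htd : t₀ < d := by
      obtain ⟨n, hn⟩ := hside.exists
      exact hn.trans_le (ht _).2
    obtain ⟨ψ, hψ, hψt⟩ := extraction_of_frequently_atTop hside
    have hfg : ∃ᶠ p : ℝ × ℝ in 𝓝[>] s₀ ×ˢ 𝓝[>] t₀, f p.1 = g p.2 := by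
      have hT : Tendsto (fun n => (s (φ (ψ n)), t (φ (ψ n)))) atTop (𝓝[>] s₀ ×ˢ 𝓝[>] t₀) :=
        (hsφ.comp hψ.tendsto_atTop).prodMk (tendsto_nhdsWithin_iff.2
          ⟨htφ.comp hψ.tendsto_atTop, Eventually.of_forall hψt⟩)
      exact hT.frequently (Eventually.of_forall fun n => (hst _).symm).frequently
    filter_upwards [hf.eventually_exists_eq (hg t₀ ht₀) h0 hfc hgc hfg (sub_pos.2 htd)]
      with r ⟨w, hw, hrw⟩
    exact ⟨w, ⟨ht₀.1.trans hw.1.le, by linarith [hw.2]⟩, hrw.symm⟩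
  · have htd : c < t₀ := by
      obtain ⟨n, hn⟩ := hside.exists
      exact (ht _).1.trans_lt hn
    obtain ⟨ψ, hψ, hψt⟩ := extraction_of_frequently_atTop hside
    have hfg : ∃ᶠ p : ℝ × ℝ in 𝓝[>] s₀ ×ˢ 𝓝[>] (-t₀), f p.1 = g (-p.2) := by
      have hT : Tendsto (fun n => (s (φ (ψ n)), -t (φ (ψ n)))) atTop
          (𝓝[>] s₀ ×ˢ 𝓝[>] (-t₀)) :=
        (hsφ.comp hψ.tendsto_atTop).prodMk (tendsto_nhdsWithin_iff.2
          ⟨(htφ.comp hψ.tendsto_atTop).neg,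
            Eventually.of_forall fun n => mem_Ioi.2 (neg_lt_neg (hψt n))⟩)
      exact hT.frequently (Eventually.of_forall fun n => by simp [hst]).frequently
    have hg' : ContMDiffAt 𝓘(ℝ, ℝ) 𝓘(ℝ, E) ω (fun r => g (-r)) (-t₀) :=
      ContMDiffAt.comp_neg (by rw [neg_neg]; exact hg t₀ ht₀)
    filter_upwards [hf.eventually_exists_eq hg' (by simpa using h0) hfc (fun h => hgc (by
        have h1 : Tendsto (fun r : ℝ => -r) (𝓝 t₀) (𝓝 (-t₀)) := continuous_neg.tendsto t₀
        simpa using h1.eventually h)) hfg (sub_pos.2 htd)] with r ⟨w, hw, hrw⟩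
    exact ⟨-w, ⟨by linarith [hw.2], by linarith [hw.1, ht₀.2]⟩, hrw.symm⟩

theorem ContMDiffAt.eventually_mem_or_notMem_arc_left [T2Space M] {f g : ℝ → M} {s₀ c d : ℝ}
    (hf : ContMDiffAt 𝓘(ℝ, ℝ) 𝓘(ℝ, E) ω f s₀)
    (hg : ∀ t ∈ Icc c d, ContMDiffAt 𝓘(ℝ, ℝ) 𝓘(ℝ, E) ω g t) (hcd : c < d)
    (hinj : InjOn g (Icc c d)) :
    (∀ᶠ s in 𝓝[<] s₀, f s ∈ g '' Icc c d) ∨ ∀ᶠ s in 𝓝[<] s₀, f s ∉ g '' Icc c d := by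
  have hT : Tendsto (fun s : ℝ => -s) (𝓝[<] s₀) (𝓝[>] (-s₀)) :=
    tendsto_nhdsWithin_iff.2 ⟨(continuous_neg.tendsto s₀).mono_left nhdsWithin_le_nhds, by
      filter_upwards [self_mem_nhdsWithin] with s hs
      exact mem_Ioi.2 (neg_lt_neg hs)⟩
  have hf' : ContMDiffAt 𝓘(ℝ, ℝ) 𝓘(ℝ, E) ω (fun r => f (-r)) (-s₀) :=
    ContMDiffAt.comp_neg (by rwa [neg_neg])
  refine (hf'.eventually_mem_or_notMem_arc_right hg hcd hinj).imp (fun h => ?_) fun h => ?_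
  · simpa using hT.eventually h
  · simpa using hT.eventually h

/-- An analytic curve is, near a parameter, constant, or immersed and injective on each side. -/
theorem ContMDiffAt.const_or_injOn_sides [CompleteSpace E] [IsManifold 𝓘(ℝ, E) ω M] {η : ℝ → M}
    {t : ℝ} (h : ContMDiffAt 𝓘(ℝ, ℝ) 𝓘(ℝ, E) ω η t) :
    ∃ ε > 0, (∀ s, |s - t| ≤ ε → ContMDiffAt 𝓘(ℝ, ℝ) 𝓘(ℝ, E) ω η s) ∧
      ((∀ s, |s - t| ≤ ε → η s = η t) ∨
        (InjOn η (Icc t (t + ε)) ∧ InjOn η (Icc (t - ε) t) ∧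
          ∀ s, s ≠ t → |s - t| ≤ ε → mfderiv 𝓘(ℝ, ℝ) 𝓘(ℝ, E) η s ≠ 0)) := by
  set κ := extChartAt 𝓘(ℝ, E) (η t) with hκ
  have han : ∀ᶠ s in 𝓝 t, ContMDiffAt 𝓘(ℝ, ℝ) 𝓘(ℝ, E) ω η s :=
    (contMDiffAt_iff_contMDiffAt_nhds (by simp)).1 h
  have main : ∀ P : ℝ → Prop, (∀ᶠ s in 𝓝 t, P s) → ∃ ε > 0, ∀ s, |s - t| ≤ ε → P s := by
    intro P hP
    obtain ⟨ε, hε, hb⟩ := Metric.eventually_nhds_iff_ball.1 hP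
    refine ⟨ε / 2, by positivity, fun s hs => hb s ?_⟩
    rw [Metric.mem_ball, Real.dist_eq]
    linarith
  by_cases hc : ∀ᶠ s in 𝓝 t, η s = η t
  · obtain ⟨ε, hε, hb⟩ := main _ (han.and hc)
    exact ⟨ε, hε, fun s hs => (hb s hs).1, Or.inl fun s hs => (hb s hs).2⟩
  obtain ⟨ε₁, hε₁, hi1, hi2, hd⟩ := h.analyticAt_extChartAt.exists_injOn_sides
    (fun h' => hc (h.eventually_const_of_extChartAt h'))
  obtain ⟨ε₂, hε₂, hb⟩ := main _ (han.and h.eventually_mem_extChartAt_source)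
  have hε : 0 < min ε₁ ε₂ := lt_min hε₁ hε₂
  refine ⟨min ε₁ ε₂, hε, fun s hs => (hb s (hs.trans (min_le_right _ _))).1,
    Or.inr ⟨?_, ?_, fun s hst hs h0 => ?_⟩⟩
  · intro a ha b hb' hab
    refine hi1 ⟨ha.1, ha.2.trans ?_⟩ ⟨hb'.1, hb'.2.trans ?_⟩ (by simp only [hab]) <;>
    linarith [min_le_left ε₁ ε₂]
  · intro a ha b hb' hab
    refine hi2 ⟨le_trans ?_ ha.1, ha.2⟩ ⟨le_trans ?_ hb'.1, hb'.2⟩ (by simp only [hab]) <;>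
    linarith [min_le_left ε₁ ε₂]
  · refine hd s hst (hs.trans (min_le_left _ _)) ?_
    obtain ⟨h1, h2⟩ := hb s (hs.trans (min_le_right _ _))
    -- By the chain rule, a zero velocity of `η` would be a zero velocity of its coordinate
    -- expression.
    have h3 : HasMFDerivAt 𝓘(ℝ, ℝ) 𝓘(ℝ, E) η s 0 := by
      rw [← h0]
      exact (h1.mdifferentiableAt (by simp)).hasMFDerivAt
    have h4 : MDifferentiableAt 𝓘(ℝ, E) 𝓘(ℝ, E) κ (η s) := by
      refine (contMDiffAt_extChartAt' (n := 1) ?_).mdifferentiableAt one_ne_zero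
      simpa [hκ] using h2
    have h5 := h4.hasMFDerivAt.comp s h3
    rw [ContinuousLinearMap.comp_zero] at h5
    have h6 : HasFDerivAt (κ ∘ η) (0 : ℝ →L[ℝ] E) s := h5.hasFDerivAt
    have h7 := h6.hasDerivAt.deriv
    rw [zero_apply] at h7
    exact h7

end Curves

/-! ### Finite sets of break points -/

section Breaks

/-- A property of intervals that holds on small intervals to the right and to the left of every
point holds on all intervals between consecutive points of some finite set. -/
theorem exists_finite_breaks {P : ℝ → ℝ → Prop} {A B : ℝ}
    (hR : ∀ t ∈ Icc A B, ∃ ε > 0, ∀ a b, A ≤ a → b ≤ B → t ≤ a → a < b → b ≤ t + ε → P a b)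
    (hL : ∀ t ∈ Icc A B, ∃ ε > 0, ∀ a b, A ≤ a → b ≤ B → t - ε ≤ a → a < b → b ≤ t → P a b) :
    ∃ V : Set ℝ, V.Finite ∧ ∀ a b, A ≤ a → b ≤ B → a < b → Disjoint (Ioo a b) V → P a b := by
  choose! ε hε hPR using hR
  choose! δ hδ hPL using hL
  obtain ⟨s, hs, hcov⟩ := isCompact_Icc.elim_nhds_subcover (s := Icc A B)
    (fun t => Ioo (t - δ t) (t + ε t))
    (fun t ht => Ioo_mem_nhds (by linarith [hδ t ht]) (by linarith [hε t ht]))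
  refine ⟨⋃ t ∈ s, {t - δ t, t, t + ε t},
    s.finite_toSet.biUnion fun t _ => by simp, fun a b ha hb hab hdisj => ?_⟩
  -- The midpoint of `(a, b)` selects one interval of the cover. Since `(a, b)` contains neither the
  -- centre nor the end points of that interval, it lies in one of its two halves.
  have hmid : (a + b) / 2 ∈ Icc A B := ⟨by linarith, by linarith⟩
  obtain ⟨t, ht, hmem⟩ := mem_iUnion₂.1 (hcov hmid)
  have hno : ∀ v ∈ ({t - δ t, t, t + ε t} : Set ℝ), a < v → b ≤ v := by
    intro v hv hav
    by_contra hvb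
    exact Set.disjoint_left.1 hdisj ⟨hav, not_le.1 hvb⟩ (mem_iUnion₂.2 ⟨t, ht, hv⟩)
  have h1 := hno (t - δ t) (by simp)
  have h2 := hno t (by simp)
  have h3 := hno (t + ε t) (by simp) (by
    have := hmem.2
    by_contra h
    linarith)
  have h4 : t - δ t ≤ a := by
    by_contra h
    have := h1 (not_le.1 h)
    linarith [hmem.1]
  by_cases hta : t ≤ a
  · exact hPR t (hs t ht) a b ha hb hta hab h3
  · exact hPL t (hs t ht) a b ha hb h4 hab (h2 (not_le.1 hta))

theorem exists_Ioo_right_disjoint {V : Set ℝ} (hV : V.Finite) (t : ℝ) :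
    ∃ ε > 0, Disjoint (Ioo t (t + ε)) V := by
  have h : (V \ {t})ᶜ ∈ 𝓝 t := (hV.subset sdiff_subset).isClosed.isOpen_compl.mem_nhds (by simp)
  obtain ⟨ε, hε, hb⟩ := Metric.mem_nhds_iff.1 h
  refine ⟨ε, hε, Set.disjoint_left.2 fun s hs hsV => hb ?_ ⟨hsV, hs.1.ne'⟩⟩
  rw [Metric.mem_ball, Real.dist_eq, abs_lt]
  constructor <;> linarith [hs.1, hs.2]

theorem exists_Ioo_left_disjoint {V : Set ℝ} (hV : V.Finite) (t : ℝ) :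
    ∃ ε > 0, Disjoint (Ioo (t - ε) t) V := by
  have h : (V \ {t})ᶜ ∈ 𝓝 t := (hV.subset sdiff_subset).isClosed.isOpen_compl.mem_nhds (by simp)
  obtain ⟨ε, hε, hb⟩ := Metric.mem_nhds_iff.1 h
  refine ⟨ε, hε, Set.disjoint_left.2 fun s hs hsV => hb ?_ ⟨hsV, hs.2.ne⟩⟩
  rw [Metric.mem_ball, Real.dist_eq, abs_lt]
  constructor <;> linarith [hs.1, hs.2]

variable {E : Type*} [NormedAddCommGroup E] [NormedSpace ℝ E]
  {M : Type*} [TopologicalSpace M] [ChartedSpace E M]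

/-- Break points are kept as a finite set rather than an indexed partition: finite sets can be
enlarged freely, and the property persists. -/
theorem IsPiecewiseAnalytic.exists_analytic_breaks {x y : M} {γ : Path x y}
    (h : IsPiecewiseAnalytic E γ) :
    ∃ V : Set ℝ, V.Finite ∧ ∀ a b, 0 ≤ a → b ≤ 1 → a < b → Disjoint (Ioo a b) V →
      AgreesWithAnalytic E γ.extend a b := by
  obtain ⟨n, t, ht, h0, h1, hp⟩ := h
  refine ⟨t '' Iic n, (finite_Iic n).image t, fun a b ha hb hab hdisj => ?_⟩
  have hex : ∃ i, i < n ∧ t i ≤ a ∧ b ≤ t (i + 1) := by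
    have hP : ∃ k, a < t k := ⟨n, by rw [h1]; linarith⟩
    classical
    have hk := Nat.find_spec hP
    have hkn : Nat.find hP ≤ n := Nat.find_min' hP (by rw [h1]; linarith)
    have hk0 : Nat.find hP ≠ 0 := by
      intro h
      rw [h, h0] at hk
      linarith
    obtain ⟨i, hi⟩ := Nat.exists_eq_succ_of_ne_zero hk0
    refine ⟨i, by omega, ?_, ?_⟩
    · exact not_lt.1 (Nat.find_min hP (m := i) (by omega))
    · rw [hi] at hk hkn
      by_contra hlt
      exact Set.disjoint_left.1 hdisj ⟨hk, not_le.1 hlt⟩ ⟨i + 1, hkn, rfl⟩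
  obtain ⟨i, hi, hia, hib⟩ := hex
  obtain ⟨η, hη, heq⟩ := hp i hi
  have hsub : Icc a b ⊆ Icc (t i) (t (i + 1)) := Icc_subset_Icc hia hib
  exact ⟨η, fun s hs => hη s (hsub hs), heq.mono hsub⟩

/-- A property of intervals that can be checked on analytic germs holds between consecutive
points of a finite set. -/
theorem IsPiecewiseAnalytic.exists_breaks {x y : M} {γ : Path x y}
    (h : IsPiecewiseAnalytic E γ) {P : ℝ → ℝ → Prop}
    (hR : ∀ (η : ℝ → M) (t : ℝ), ContMDiffAt 𝓘(ℝ, ℝ) 𝓘(ℝ, E) ω η t →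
      ∃ ε > 0, ∀ a b, t ≤ a → a < b → b ≤ t + ε → EqOn γ.extend η (Icc a b) → P a b)
    (hL : ∀ (η : ℝ → M) (t : ℝ), ContMDiffAt 𝓘(ℝ, ℝ) 𝓘(ℝ, E) ω η t →
      ∃ ε > 0, ∀ a b, t - ε ≤ a → a < b → b ≤ t → EqOn γ.extend η (Icc a b) → P a b) :
    ∃ V : Set ℝ, V.Finite ∧ ∀ a b, 0 ≤ a → b ≤ 1 → a < b → Disjoint (Ioo a b) V → P a b := by
  obtain ⟨V, hV, hVb⟩ := h.exists_analytic_breaks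
  refine exists_finite_breaks (fun t ht => ?_) (fun t ht => ?_)
  · rcases ht.2.lt_or_eq with h1 | rfl
    · obtain ⟨ε, hε, hd⟩ := exists_Ioo_right_disjoint hV t
      obtain ⟨η, hη, heq⟩ := hVb t (min (t + ε) 1) ht.1 (min_le_right _ _)
        (lt_min (by linarith) h1)
        (hd.mono_left (Ioo_subset_Ioo_right (min_le_left _ _)))
      obtain ⟨ε', hε', hP⟩ := hR η t (hη t (left_mem_Icc.2 (le_min (by linarith) ht.2)))
      refine ⟨min ε ε', lt_min hε hε', fun a b _ hb1 hta hab hb => hP a b hta hab ?_ ?_⟩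
      · linarith [min_le_right ε ε']
      · refine heq.mono (Icc_subset_Icc hta (le_min ?_ hb1))
        linarith [min_le_left ε ε']
    · exact ⟨1, one_pos, fun a b _ hb hta hab _ => by linarith⟩
  · rcases ht.1.lt_or_eq with h0 | rfl
    · obtain ⟨ε, hε, hd⟩ := exists_Ioo_left_disjoint hV t
      obtain ⟨η, hη, heq⟩ := hVb (max (t - ε) 0) t (le_max_right _ _) ht.2
        (max_lt (by linarith) h0)
        (hd.mono_left (Ioo_subset_Ioo_left (le_max_left _ _)))
      obtain ⟨ε', hε', hP⟩ := hL η t (hη t (right_mem_Icc.2 (max_le (by linarith) ht.1)))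
      refine ⟨min ε ε', lt_min hε hε', fun a b ha0 _ hta hab hb => hP a b ?_ hab hb ?_⟩
      · linarith [min_le_right ε ε']
      · refine heq.mono (Icc_subset_Icc (max_le ?_ ha0) hb)
        linarith [min_le_left ε ε']
    · exact ⟨1, one_pos, fun a b ha _ _ hab hb => by linarith⟩

/-- A piecewise analytic path meets an analytic arc in finitely many intervals and points. -/
theorem IsPiecewiseAnalytic.exists_breaks_arc [T2Space M] {x y : M} {γ : Path x y}
    (h : IsPiecewiseAnalytic E γ) {g : ℝ → M} {c d : ℝ}
    (hg : ∀ t ∈ Icc c d, ContMDiffAt 𝓘(ℝ, ℝ) 𝓘(ℝ, E) ω g t) (hcd : c < d)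
    (hinj : InjOn g (Icc c d)) :
    ∃ V : Set ℝ, V.Finite ∧ ∀ a b, 0 ≤ a → b ≤ 1 → a < b → Disjoint (Ioo a b) V →
      (∀ s ∈ Ioo a b, γ.extend s ∈ g '' Icc c d) ∨ ∀ s ∈ Ioo a b, γ.extend s ∉ g '' Icc c d := by
  refine h.exists_breaks (fun η t hη => ?_) (fun η t hη => ?_)
  · have key : ∀ Q : ℝ → Prop, (∀ᶠ s in 𝓝[>] t, Q s) → ∃ ε > 0, ∀ s ∈ Ioo t (t + ε), Q s := by
      intro Q hQ
      obtain ⟨u, hu, hsub⟩ := mem_nhdsGT_iff_exists_Ioo_subset.1 hQ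
      exact ⟨u - t, sub_pos.2 hu, fun s hs => hsub ⟨hs.1, by linarith [hs.2]⟩⟩
    rcases hη.eventually_mem_or_notMem_arc_right hg hcd hinj with h | h
    · obtain ⟨ε, hε, hQ⟩ := key _ h
      refine ⟨ε, hε, fun a b hta hab hb heq => Or.inl fun s hs => ?_⟩
      rw [heq (Ioo_subset_Icc_self hs)]
      exact hQ s ⟨hta.trans_lt hs.1, hs.2.trans_le hb⟩
    · obtain ⟨ε, hε, hQ⟩ := key _ h
      refine ⟨ε, hε, fun a b hta hab hb heq => Or.inr fun s hs => ?_⟩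
      rw [heq (Ioo_subset_Icc_self hs)]
      exact hQ s ⟨hta.trans_lt hs.1, hs.2.trans_le hb⟩
  · have key : ∀ Q : ℝ → Prop, (∀ᶠ s in 𝓝[<] t, Q s) → ∃ ε > 0, ∀ s ∈ Ioo (t - ε) t, Q s := by
      intro Q hQ
      obtain ⟨u, hu, hsub⟩ := mem_nhdsLT_iff_exists_Ioo_subset.1 hQ
      exact ⟨t - u, sub_pos.2 hu, fun s hs => hsub ⟨by linarith [hs.1], hs.2⟩⟩
    rcases hη.eventually_mem_or_notMem_arc_left hg hcd hinj with h | h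
    · obtain ⟨ε, hε, hQ⟩ := key _ h
      refine ⟨ε, hε, fun a b hta hab hb heq => Or.inl fun s hs => ?_⟩
      rw [heq (Ioo_subset_Icc_self hs)]
      exact hQ s ⟨hta.trans_lt hs.1, hs.2.trans_le hb⟩
    · obtain ⟨ε, hε, hQ⟩ := key _ h
      refine ⟨ε, hε, fun a b hta hab hb heq => Or.inr fun s hs => ?_⟩
      rw [heq (Ioo_subset_Icc_self hs)]
      exact hQ s ⟨hta.trans_lt hs.1, hs.2.trans_le hb⟩

variable (E) in
/-- On `[a, b]`, `f` is an injective analytic curve, immersed on `(a, b)`. -/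
def IsArc (f : ℝ → M) (a b : ℝ) : Prop :=
  ∃ η : ℝ → M, (∀ s ∈ Icc a b, ContMDiffAt 𝓘(ℝ, ℝ) 𝓘(ℝ, E) ω η s) ∧ EqOn f η (Icc a b) ∧
    InjOn η (Icc a b) ∧ ∀ s ∈ Ioo a b, mfderiv 𝓘(ℝ, ℝ) 𝓘(ℝ, E) η s ≠ 0

theorem IsArc.mono {f : ℝ → M} {a b a' b' : ℝ} (h : IsArc E f a b) (ha : a ≤ a') (hb : b' ≤ b) :
    IsArc E f a' b' := by
  obtain ⟨η, h1, h2, h3, h4⟩ := h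
  have hs : Icc a' b' ⊆ Icc a b := Icc_subset_Icc ha hb
  exact ⟨η, fun s hs' => h1 s (hs hs'), h2.mono hs, h3.mono hs,
    fun s hs' => h4 s (Ioo_subset_Ioo ha hb hs')⟩

theorem IsArc.injOn {f : ℝ → M} {a b : ℝ} (h : IsArc E f a b) : InjOn f (Icc a b) := by
  obtain ⟨η, h1, h2, h3, h4⟩ := h
  exact h3.congr h2.symm

/-- A piecewise analytic path is composed of finitely many arcs and constant paths. -/
theorem IsPiecewiseAnalytic.exists_breaks_isArc [CompleteSpace E] [IsManifold 𝓘(ℝ, E) ω M]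
    {x y : M} {γ : Path x y} (h : IsPiecewiseAnalytic E γ) :
    ∃ V : Set ℝ, V.Finite ∧ ∀ a b, 0 ≤ a → b ≤ 1 → a < b → Disjoint (Ioo a b) V →
      (∀ s ∈ Icc a b, γ.extend s = γ.extend a) ∨ IsArc E γ.extend a b := by
  refine h.exists_breaks (fun η t hη => ?_) (fun η t hη => ?_)
  · obtain ⟨ε, hε, han, hc | ⟨hi, -, hd⟩⟩ := hη.const_or_injOn_sides
    · refine ⟨ε, hε, fun a b hta hab hb heq => Or.inl fun s hs => ?_⟩
      rw [heq hs, heq (left_mem_Icc.2 hab.le), hc s, hc a]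
      all_goals
        rw [abs_le]
        constructor <;> linarith [hs.1, hs.2]
    · refine ⟨ε, hε, fun a b hta hab hb heq => Or.inr ⟨η, fun s hs => han s ?_, heq,
        hi.mono (Icc_subset_Icc hta hb), fun s hs => hd s (hta.trans_lt hs.1).ne' ?_⟩⟩
      all_goals
        rw [abs_le]
        constructor <;> linarith [hs.1, hs.2]
  · obtain ⟨ε, hε, han, hc | ⟨-, hi, hd⟩⟩ := hη.const_or_injOn_sides
    · refine ⟨ε, hε, fun a b hta hab hb heq => Or.inl fun s hs => ?_⟩
      rw [heq hs, heq (left_mem_Icc.2 hab.le), hc s, hc a]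
      all_goals
        rw [abs_le]
        constructor <;> linarith [hs.1, hs.2]
    · refine ⟨ε, hε, fun a b hta hab hb heq => Or.inr ⟨η, fun s hs => han s ?_, heq,
        hi.mono (Icc_subset_Icc hta hb), fun s hs => hd s (hs.2.trans_le hb).ne ?_⟩⟩
      all_goals
        rw [abs_le]
        constructor <;> linarith [hs.1, hs.2]

end Breaks

/-! ### Holonomy along an arc -/

section Development

/-- Induction over the intervals cut out by a finite set of break points. -/
theorem Set.Finite.interval_induction {V : Set ℝ} (hV : V.Finite) {Q : ℝ → ℝ → Prop}
    (base : ∀ a b, a < b → Disjoint (Ioo a b) V → Q a b)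
    (step : ∀ a v b, a < v → v < b → v ∈ V → Q a v → Q v b → Q a b) {a b : ℝ} (hab : a < b) :
    Q a b := by
  have key : ∀ n : ℕ, ∀ a b, a < b → (Ioo a b ∩ V).ncard = n → Q a b := by
    intro n
    induction n using Nat.strong_induction_on with
    | _ n ih =>
      intro a b hab hn
      by_cases hd : Disjoint (Ioo a b) V
      · exact base a b hab hd
      · obtain ⟨v, hv, hvV⟩ := Set.not_disjoint_iff.1 hd
        have hfin : (Ioo a b ∩ V).Finite := hV.subset inter_subset_right
        refine step a v b hv.1 hv.2 hvV (ih _ ?_ a v hv.1 rfl) (ih _ ?_ v b hv.2 rfl)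
        · rw [← hn]
          refine Set.ncard_lt_ncard ⟨fun u hu => ⟨⟨hu.1.1, hu.1.2.trans hv.2⟩, hu.2⟩, fun h => ?_⟩
            hfin
          exact lt_irrefl _ (h ⟨hv, hvV⟩).1.2
        · rw [← hn]
          refine Set.ncard_lt_ncard ⟨fun u hu => ⟨⟨hv.1.trans hu.1.1, hu.1.2⟩, hu.2⟩, fun h => ?_⟩
            hfin
          exact lt_irrefl _ (h ⟨hv, hvV⟩).1.1
  exact key _ a b hab rfl

variable {M : Type*}

/-- `D` records the change of the function `r` along `f`, as long as `f` runs inside `K`. -/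
def IsDevelopment (f : ℝ → M) (K : Set M) (r : M → ℝ) (a b : ℝ) (D : ℝ → ℝ) : Prop :=
  ∀ s t, a ≤ s → s ≤ t → t ≤ b →
    (MapsTo f (Ioo s t) K → D t - D s = r (f t) - r (f s)) ∧ (MapsTo f (Ioo s t) Kᶜ → D t = D s)

namespace IsDevelopment

variable {f f' : ℝ → M} {K : Set M} {r : M → ℝ} {a b c : ℝ} {D D' : ℝ → ℝ}

/-- Shift `D'` by a constant so that it matches `D` at `b`. Running inside `K` and avoiding `K` both
pass to subintervals, so an interval across `b` is treated through its two halves. -/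
theorem glue (h : IsDevelopment f K r a b D) (h' : IsDevelopment f K r b c D') (hab : a ≤ b)
    (hbc : b ≤ c) : ∃ D'', IsDevelopment f K r a c D'' ∧
      D'' c - D'' a = (D b - D a) + (D' c - D' b) := by
  classical
  let D'' : ℝ → ℝ := fun t => if t ≤ b then D t else D b + (D' t - D' b)
  have e1 : ∀ t, t ≤ b → D'' t = D t := fun t ht => if_pos ht
  have e2 : ∀ t, b ≤ t → D'' t = D b + (D' t - D' b) := by
    intro t ht
    rcases ht.eq_or_lt with rfl | ht
    · rw [e1 _ le_rfl]
      ring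
    · exact if_neg (not_le.2 ht)
  refine ⟨D'', fun s t hs hst ht => ?_, by rw [e2 c hbc, e1 a hab]; ring⟩
  rcases le_total t b with htb | hbt
  · rw [e1 t htb, e1 s (hst.trans htb)]
    exact h s t hs hst htb
  rcases le_total b s with hbs | hsb
  · rw [e2 t hbt, e2 s hbs]
    obtain ⟨h1, h2⟩ := h' s t hbs hst ht
    exact ⟨fun hm => by linarith [h1 hm], fun hm => by rw [h2 hm]⟩
  · rw [e2 t hbt, e1 s hsb]
    obtain ⟨h1, h2⟩ := h s b hs hsb le_rfl
    obtain ⟨h3, h4⟩ := h' b t le_rfl hbt ht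
    have s1 : Ioo s b ⊆ Ioo s t := Ioo_subset_Ioo_right hbt
    have s2 : Ioo b t ⊆ Ioo s t := Ioo_subset_Ioo_left hsb
    refine ⟨fun hm => ?_, fun hm => ?_⟩
    · linarith [h1 (hm.mono_left s1), h3 (hm.mono_left s2)]
    · rw [h2 (hm.mono_left s1), h4 (hm.mono_left s2)]
      ring

/-- Developments are compatible with order preserving reparametrizations. -/
theorem comp_monotone (h : IsDevelopment f K r a b D) {φ : ℝ → ℝ} {a' b' : ℝ}
    (hφ : ContinuousOn φ (Icc a' b')) (hmono : MonotoneOn φ (Icc a' b'))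
    (hmaps : MapsTo φ (Icc a' b') (Icc a b)) (hf : ∀ t ∈ Icc a' b', f' t = f (φ t)) :
    IsDevelopment f' K r a' b' (D ∘ φ) := by
  intro s t hs hst ht
  have ms : s ∈ Icc a' b' := ⟨hs, hst.trans ht⟩
  have mt : t ∈ Icc a' b' := ⟨hs.trans hst, ht⟩
  have hsub : Icc s t ⊆ Icc a' b' := Icc_subset_Icc hs ht
  -- By the intermediate value theorem, every parameter strictly between `φ s` and `φ t` is attained
  -- strictly between `s` and `t`, even if `φ` is constant on some intervals.
  have transfer : ∀ S : Set M, MapsTo f' (Ioo s t) S → MapsTo f (Ioo (φ s) (φ t)) S := by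
    intro S hS y hy
    obtain ⟨u, hu, rfl⟩ := intermediate_value_Ioo hst (hφ.mono hsub) hy
    rw [← hf u (hsub (Ioo_subset_Icc_self hu))]
    exact hS hu
  obtain ⟨h1, h2⟩ := h (φ s) (φ t) (hmaps ms).1 (hmono ms mt hst) (hmaps mt).2
  rw [hf s ms, hf t mt]
  exact ⟨fun hm => h1 (transfer _ hm), fun hm => h2 (transfer _ hm)⟩

theorem comp_sub (h : IsDevelopment f K r 0 1 D) (hf : ∀ t ∈ Icc (0 : ℝ) 1, f' t = f (1 - t)) :
    IsDevelopment f' K r 0 1 (fun t => D (1 - t)) := by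
  intro s t hs hst ht
  have transfer : ∀ S : Set M, MapsTo f' (Ioo s t) S → MapsTo f (Ioo (1 - t) (1 - s)) S := by
    intro S hS y hy
    have hu : 1 - y ∈ Ioo s t := ⟨by linarith [hy.2], by linarith [hy.1]⟩
    have := hS hu
    rwa [hf _ ⟨by linarith [hu.1], by linarith [hu.2]⟩, sub_sub_cancel] at this
  obtain ⟨h1, h2⟩ := h (1 - t) (1 - s) (by linarith) (by linarith) (by linarith)
  rw [hf s ⟨hs, hst.trans ht⟩, hf t ⟨hs.trans hst, ht⟩]
  exact ⟨fun hm => by linarith [h1 (transfer _ hm)], fun hm => (h2 (transfer _ hm)).symm⟩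

theorem of_notMem (h : ∀ t ∈ Icc a b, f t ∉ K) : IsDevelopment f K r a b (fun _ => 0) := by
  intro s t hs hst ht
  refine ⟨fun hm => ?_, fun _ => rfl⟩
  rcases hst.eq_or_lt with rfl | hlt
  · ring
  · have hmid : (s + t) / 2 ∈ Ioo s t := ⟨by linarith, by linarith⟩
    exact absurd (hm hmid) (h _ ⟨by linarith, by linarith⟩)

end IsDevelopment

/-- `V` cuts `[0, 1]` into intervals on which `f` runs inside `K` or avoids `K`. -/
def BreaksAlong (f : ℝ → M) (K : Set M) (V : Set ℝ) : Prop :=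
  ∀ a b, 0 ≤ a → b ≤ 1 → a < b → Disjoint (Ioo a b) V →
    MapsTo f (Ioo a b) K ∨ MapsTo f (Ioo a b) Kᶜ

/-- Between break points, `r ∘ f` or a constant is a development, according to whether the curve
runs inside `K` or avoids it; these are glued. The alternatives exclude each other on a nonempty
open interval. -/
theorem BreaksAlong.exists_isDevelopment {f : ℝ → M} {K : Set M} {V : Set ℝ} (hV : V.Finite)
    (h : BreaksAlong f K V) (r : M → ℝ) : ∃ D, IsDevelopment f K r 0 1 D := by
  have key : ∀ {a b : ℝ}, a < b → 0 ≤ a → b ≤ 1 → ∃ D, IsDevelopment f K r a b D := by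
    intro a b hab
    refine hV.interval_induction (Q := fun a b => 0 ≤ a → b ≤ 1 → ∃ D, IsDevelopment f K r a b D)
      ?_ ?_ hab
    · intro a b hab hd ha hb
      have hmid : ∀ s t : ℝ, s < t → (s + t) / 2 ∈ Ioo s t := fun s t h =>
        ⟨by linarith, by linarith⟩
      rcases h a b ha hb hab hd with hm | hm
      · refine ⟨fun t => r (f t), fun s t hs hst ht => ⟨fun _ => rfl, fun hm' => ?_⟩⟩
        rcases hst.eq_or_lt with rfl | hlt
        · rfl
        · exact absurd (hm (Ioo_subset_Ioo hs ht (hmid s t hlt))) (hm' (hmid s t hlt))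
      · refine ⟨fun _ => 0, fun s t hs hst ht => ⟨fun hm' => ?_, fun _ => rfl⟩⟩
        rcases hst.eq_or_lt with rfl | hlt
        · ring
        · exact absurd (hm' (hmid s t hlt)) (hm (Ioo_subset_Ioo hs ht (hmid s t hlt)))
    · intro a v b hav hvb _ h1 h2 ha hb
      obtain ⟨D, hD⟩ := h1 ha (hvb.le.trans hb)
      obtain ⟨D', hD'⟩ := h2 (ha.trans hav.le) hb
      obtain ⟨D'', hD'', -⟩ := hD.glue hD' hav.le hvb.le
      exact ⟨D'', hD''⟩
  exact key zero_lt_one le_rfl le_rfl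

/-- On each piece one of the two conditions prescribes the change of any development, so the total
change depends only on the curve. The holonomy can therefore be computed from whichever development
is convenient. -/
theorem BreaksAlong.development_unique {f : ℝ → M} {K : Set M} {V : Set ℝ} (hV : V.Finite)
    (h : BreaksAlong f K V) {r : M → ℝ} {D D' : ℝ → ℝ} (hD : IsDevelopment f K r 0 1 D)
    (hD' : IsDevelopment f K r 0 1 D') : D 1 - D 0 = D' 1 - D' 0 := by
  have key : ∀ {a b : ℝ}, a < b → 0 ≤ a → b ≤ 1 → D b - D a = D' b - D' a := by
    intro a b hab
    refine hV.interval_induction (Q := fun a b => 0 ≤ a → b ≤ 1 → D b - D a = D' b - D' a)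
      ?_ ?_ hab
    · intro a b hab hd ha hb
      rcases h a b ha hb hab hd with hm | hm
      · rw [(hD a b ha hab.le hb).1 hm, (hD' a b ha hab.le hb).1 hm]
      · rw [(hD a b ha hab.le hb).2 hm, (hD' a b ha hab.le hb).2 hm, sub_self, sub_self]
    · intro a v b hav hvb _ h1 h2 ha hb
      linarith [h1 ha (hvb.le.trans hb), h2 (ha.trans hav.le) hb]
  exact key zero_lt_one le_rfl le_rfl

variable {E : Type*} [NormedAddCommGroup E] [NormedSpace ℝ E] [TopologicalSpace M]
  [ChartedSpace E M]

/-- The total change of `r` along the part of a path that runs inside `K`, as a homomorphism on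
the group of loops. -/
theorem exists_development_hom {K : Set M}
    (hK : ∀ {y z : M} (γ : PAPath E y z), ∃ V : Set ℝ, V.Finite ∧ BreaksAlong γ.1.extend K V)
    (r : M → ℝ) (x : M) :
    ∃ h : LoopGroup E x →* Multiplicative ℝ, ∀ (α : PAPath E x x) (D : ℝ → ℝ),
      IsDevelopment α.1.extend K r 0 1 D → (h (loopClass α)).toAdd = D 1 - D 0 := by
  -- The holonomy is defined for paths between arbitrary points, because a retracing inserts paths
  -- that need not be closed.
  have hex : ∀ (y z : M) (γ : PAPath E y z), ∃ c : ℝ, ∀ D,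
      IsDevelopment γ.1.extend K r 0 1 D → D 1 - D 0 = c := by
    intro y z γ
    obtain ⟨V, hV, hVb⟩ := hK γ
    obtain ⟨D, hD⟩ := hVb.exists_isDevelopment hV r
    exact ⟨D 1 - D 0, fun D' hD' => hVb.development_unique hV hD' hD⟩
  have hdev : ∀ {y z : M} (γ : PAPath E y z), ∃ D, IsDevelopment γ.1.extend K r 0 1 D := by
    intro y z γ
    obtain ⟨V, hV, hVb⟩ := hK γ
    exact hVb.exists_isDevelopment hV r
  choose hol hhol using hex
  have hol_trans : ∀ {y z w : M} (γ : PAPath E y z) (γ' : PAPath E z w),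
      hol _ _ (γ.trans γ') = hol _ _ γ + hol _ _ γ' := by
    intro y z w γ γ'
    obtain ⟨D, hD⟩ := hdev γ
    obtain ⟨D', hD'⟩ := hdev γ'
    have h1 : IsDevelopment (γ.trans γ').1.extend K r 0 (1 / 2) (D ∘ fun t => 2 * t) :=
      hD.comp_monotone (by fun_prop) (fun s _ t _ hst => by linarith)
        (fun t ht => ⟨by linarith [ht.1], by linarith [ht.2]⟩)
        (fun t ht => Path.extend_trans_of_le_half _ _ ht.2)
    have h2 : IsDevelopment (γ.trans γ').1.extend K r (1 / 2) 1 (D' ∘ fun t => 2 * t - 1) :=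
      hD'.comp_monotone (by fun_prop) (fun s _ t _ hst => by linarith)
        (fun t ht => ⟨by linarith [ht.1], by linarith [ht.2]⟩)
        (fun t ht => Path.extend_trans_of_half_le _ _ ht.1)
    obtain ⟨D'', hD'', he⟩ := h1.glue h2 (by norm_num) (by norm_num)
    rw [← hhol _ _ _ _ hD'', ← hhol _ _ _ _ hD, ← hhol _ _ _ _ hD', he]
    norm_num
  have hol_symm : ∀ {y z : M} (γ : PAPath E y z), hol _ _ γ.symm = - hol _ _ γ := by
    intro y z γ
    obtain ⟨D, hD⟩ := hdev γ
    have h1 : IsDevelopment γ.symm.1.extend K r 0 1 (fun t => D (1 - t)) :=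
      hD.comp_sub fun t _ => Path.extend_symm_apply _ _
    rw [← hhol _ _ _ _ h1, ← hhol _ _ _ _ hD]
    norm_num
  have hol_move : ∀ {y z : M} (γ γ' : PAPath E y z), ElementaryMove γ γ' →
      hol _ _ γ = hol _ _ γ' := by
    intro y z γ γ' hm
    cases hm with
    | reparam _ _ φ hφ hmono h0 h1 h =>
      obtain ⟨D, hD⟩ := hdev γ
      have h2 : IsDevelopment γ'.1.extend K r 0 1
          (D ∘ fun t => (φ (projIcc 0 1 zero_le_one t) : ℝ)) := by
        refine hD.comp_monotone ?_ ?_ (fun t _ => (φ _).2) ?_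
        · exact (continuous_subtype_val.comp (hφ.comp continuous_projIcc)).continuousOn
        · intro s _ t _ hst
          exact hmono (monotone_projIcc _ hst)
        · intro t ht
          rw [Path.extend_apply _ ht, h, Path.extend_apply _ (φ _).2, projIcc_of_mem _ ht]
      rw [← hhol _ _ _ _ hD, ← hhol _ _ _ _ h2]
      simp [h0, h1]
    | retrace p q δ =>
      rw [hol_trans, hol_trans, hol_trans, hol_trans, hol_symm]
      ring
  have hol_rel : ∀ γ γ' : PAPath E x x, elementarySetoid E x x γ γ' →
      hol _ _ γ = hol _ _ γ' := by
    intro γ γ' hr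
    induction hr with
    | refl => rfl
    | symm _ _ _ ih => exact ih.symm
    | trans _ _ _ _ _ ih ih' => exact ih.trans ih'
    | rel a b hab => exact hol_move a b hab
  refine ⟨MonoidHom.mk' (fun α => Quotient.lift (fun γ : PAPath E x x =>
    Multiplicative.ofAdd (hol _ _ γ)) (fun γ γ' hr => congrArg _ (hol_rel γ γ' hr)) α) ?_, ?_⟩
  · rintro ⟨a⟩ ⟨b⟩
    exact congrArg Multiplicative.ofAdd (hol_trans a b)
  · intro α D hD
    exact (hhol _ _ α D hD).symm

end Development

/-! ### Prescribing holonomies on independent loops -/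

section IndependentLoops

/-- A lift of a continuous map through an injective curve is continuous. -/
theorem continuousOn_of_comp_injOn {Y : Type*} [TopologicalSpace Y] {N : Type*}
    [TopologicalSpace N] [T2Space N] {f : Y → N} {S : Set Y} (hS : IsCompact S)
    (hf : ContinuousOn f S) (hinj : InjOn f S) {X : Type*} [TopologicalSpace X] {g : X → N}
    {T : Set X} (hg : ContinuousOn g T) {h : X → Y} (hh : MapsTo h T S)
    (hcomp : ∀ t ∈ T, f (h t) = g t) : ContinuousOn h T := by
  rw [continuousOn_iff_isClosed]
  intro C hC
  -- The preimage of `C` under the lift is, within `T`, the preimage under `g` of this compact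
  -- image.
  have hcl : IsClosed (f '' (S ∩ C)) :=
    ((hS.inter_right hC).image_of_continuousOn (hf.mono inter_subset_left)).isClosed
  obtain ⟨u, hu, hu'⟩ := continuousOn_iff_isClosed.1 hg _ hcl
  refine ⟨u, hu, ?_⟩
  rw [← hu']
  ext t
  simp only [mem_inter_iff, mem_preimage]
  refine and_congr_left fun ht => ⟨fun hc => ⟨h t, ⟨hh ht, hc⟩, hcomp t ht⟩, ?_⟩
  rintro ⟨s, ⟨hs, hsC⟩, hst⟩
  rwa [← hinj hs (hh ht) (hst.trans (hcomp t ht).symm)]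

variable {E : Type*} [NormedAddCommGroup E] [NormedSpace ℝ E]
  {M : Type*} [TopologicalSpace M] [ChartedSpace E M]

theorem IsEdge.injOn_Ioo {e : ℝ → M} (he : IsEdge E e) : InjOn e (Ioo 0 1) :=
  injOn_iff_injective.2 he.embedding.injective

/-- An edge may close up, but it cannot end at one of its interior points: if `e v = e s`,
parameters of `(0, 1)` close to `v` have images close to `e s`, and the embedding property forces
them to be close to `s` as well. -/
theorem IsEdge.ne_of_mem_Ioo {e : ℝ → M} (he : IsEdge E e) {s v : ℝ} (hs : s ∈ Ioo (0 : ℝ) 1)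
    (hv : v ∈ Icc (0 : ℝ) 1) (hsv : s ≠ v) : e s ≠ e v := by
  intro heq
  have hopen : IsOpen {t : Ioo (0 : ℝ) 1 | |(t : ℝ) - s| < |v - s| / 2} :=
    isOpen_lt (by fun_prop) continuous_const
  obtain ⟨O, hO, hO'⟩ := he.embedding.isInducing.isOpen_iff.1 hopen
  have hpos : 0 < |v - s| := abs_pos.2 (sub_ne_zero.2 hsv.symm)
  have hsO : e s ∈ O := by
    have h : (⟨s, hs⟩ : Ioo (0 : ℝ) 1) ∈ (Ioo (0 : ℝ) 1).domRestrict e ⁻¹' O := by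
      rw [hO']
      simpa using sub_ne_zero.2 hsv.symm
    exact h
  have hcl : v ∈ closure (Ioo (0 : ℝ) 1) := by rwa [closure_Ioo zero_ne_one]
  have h1 : ∀ᶠ t in 𝓝[Ioo 0 1] v, e t ∈ O :=
    ((he.analytic v hv).continuousAt.eventually
      (hO.mem_nhds (heq ▸ hsO))).filter_mono nhdsWithin_le_nhds
  have h2 : ∀ᶠ t in 𝓝[Ioo 0 1] v, |t - v| < |v - s| / 2 := by
    have : ∀ᶠ t in 𝓝 v, |t - v| < |v - s| / 2 := by
      have := Metric.ball_mem_nhds v (half_pos hpos)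
      filter_upwards [this] with t ht
      rwa [Metric.mem_ball, Real.dist_eq] at ht
    exact this.filter_mono nhdsWithin_le_nhds
  have hne : (𝓝[Ioo (0 : ℝ) 1] v).NeBot := mem_closure_iff_nhdsWithin_neBot.1 hcl
  obtain ⟨t, ⟨ht1, ht2⟩, ht3⟩ := ((h1.and h2).and eventually_mem_nhdsWithin).exists
  have h3 : (⟨t, ht3⟩ : Ioo (0 : ℝ) 1) ∈ {t : Ioo (0 : ℝ) 1 | |(t : ℝ) - s| < |v - s| / 2} := by
    rw [← hO']
    exact ht1
  have h4 : |t - s| < |v - s| / 2 := h3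
  have h5 : |v - s| ≤ |t - v| + |t - s| := by
    have := abs_sub_le v t s
    rwa [abs_sub_comm v t] at this
  linarith

theorem IsEdge.notMem_vertices {e : ℝ → M} (he : IsEdge E e) {s : ℝ} (hs : s ∈ Ioo (0 : ℝ) 1) :
    e s ∉ edgeVertices e := by
  rintro (h | h)
  · exact he.ne_of_mem_Ioo hs (by simp) hs.1.ne' h
  · exact he.ne_of_mem_Ioo hs (by simp) hs.2.ne h

variable [T2Space M]

/-- A path that passes every point of an arc exactly once runs along the arc, once. -/
theorem IsDevelopment.sub_ne_zero_of_existsUnique {x : M} (β : Path x x) {e : ℝ → M} {c d : ℝ}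
    (hcd : c < d) (he : ContinuousOn e (Icc c d)) (hinj : InjOn e (Icc c d))
    (hβ : ∀ s ∈ Icc c d, ∃! t : I, β t = e s) {r : M → ℝ} (hr : ∀ s ∈ Icc c d, r (e s) = s)
    {D : ℝ → ℝ} (hD : IsDevelopment β.extend (e '' Icc c d) r 0 1 D) : D 1 - D 0 ≠ 0 := by
  -- `τ s` is the unique time at which `β` passes `e s`. It is continuous and injective in `s`,
  -- hence strictly monotone: `β` traverses the arc in one direction during a single time interval.
  choose! τ hτ hτ' using hβ
  dsimp only at hτ hτ'
  have hK : IsClosed (e '' Icc c d) := (isCompact_Icc.image_of_continuousOn he).isClosed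
  let S : Set I := β ⁻¹' (e '' Icc c d)
  have hS : IsCompact S := (hK.preimage β.continuous).isCompact
  have hmaps : MapsTo τ (Icc c d) S := fun s hs => ⟨s, hs, (hτ s hs).symm⟩
  have hSτ : ∀ t ∈ S, ∃ s ∈ Icc c d, τ s = t := by
    rintro t ⟨s, hs, hst⟩
    exact ⟨s, hs, (hτ' s hs t hst.symm).symm⟩
  have hinjS : InjOn β S := by
    rintro t ⟨s, hs, hst⟩ t' _ htt'
    rw [hτ' s hs t hst.symm, hτ' s hs t' (htt'.symm.trans hst.symm)]
  have hτc : ContinuousOn (fun s => (τ s : ℝ)) (Icc c d) :=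
    continuous_subtype_val.comp_continuousOn
      (continuousOn_of_comp_injOn hS β.continuous.continuousOn hinjS he hmaps hτ)
  have hτi : InjOn (fun s => (τ s : ℝ)) (Icc c d) := by
    intro s hs s' hs' hss'
    refine hinj hs hs' ?_
    rw [← hτ s hs, ← hτ s' hs', Subtype.ext hss']
  have hc : c ∈ Icc c d := left_mem_Icc.2 hcd.le
  have hd : d ∈ Icc c d := right_mem_Icc.2 hcd.le
  have ext_eq : ∀ t : I, β.extend t = β t := fun t => Path.extend_extends' β t
  have hout : ∀ p q : ℝ, 0 ≤ p → p ≤ q → q ≤ 1 →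
      (∀ s ∈ Icc c d, (τ s : ℝ) ≤ p ∨ q ≤ τ s) → D q = D p := by
    intro p q hp hpq hq hno
    refine (hD p q hp hpq hq).2 fun u hu hmem => ?_
    have hu1 : u ∈ I := ⟨hp.trans hu.1.le, hu.2.le.trans hq⟩
    rw [Path.extend_apply _ hu1] at hmem
    obtain ⟨s, hs, hsu⟩ := hSτ _ hmem
    have : (τ s : ℝ) = u := congrArg Subtype.val hsu
    rcases hno s hs with h | h
    · linarith [hu.1]
    · linarith [hu.2]
  have hin : ∀ p q : ℝ, 0 ≤ p → p ≤ q → q ≤ 1 →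
      Icc p q ⊆ (fun s => (τ s : ℝ)) '' Icc c d →
      D q - D p = r (β.extend q) - r (β.extend p) := by
    intro p q hp hpq hq hsub
    refine (hD p q hp hpq hq).1 fun u hu => ?_
    obtain ⟨s, hs, rfl⟩ := hsub (Ioo_subset_Icc_self hu)
    dsimp only
    rw [ext_eq, hτ s hs]
    exact ⟨s, hs, rfl⟩
  -- `D` is constant before and after the passage, and changes by `d - c` or `c - d` during it,
  -- depending on the direction.
  rcases ContinuousOn.strictMonoOn_of_injOn_Icc' hcd.le hτc hτi with hm | hm
  · have hle : (τ c : ℝ) ≤ τ d := hm.monotoneOn hc hd hcd.le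
    have h1 := hout 0 (τ c) le_rfl (τ c).2.1 (τ c).2.2
      (fun s hs => Or.inr (hm.monotoneOn hc hs hs.1))
    have h2 := hout (τ d) 1 (τ d).2.1 (τ d).2.2 le_rfl
      (fun s hs => Or.inl (hm.monotoneOn hs hd hs.2))
    have h3 := hin (τ c) (τ d) (τ c).2.1 hle (τ d).2.2 (intermediate_value_Icc hcd.le hτc)
    rw [ext_eq, ext_eq, hτ c hc, hτ d hd, hr c hc, hr d hd] at h3
    intro h
    linarith
  · have hle : (τ d : ℝ) ≤ τ c := hm.antitoneOn hc hd hcd.le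
    have h1 := hout 0 (τ d) le_rfl (τ d).2.1 (τ d).2.2
      (fun s hs => Or.inr (hm.antitoneOn hs hd hs.2))
    have h2 := hout (τ c) 1 (τ c).2.1 (τ c).2.2 le_rfl
      (fun s hs => Or.inl (hm.antitoneOn hc hs hs.1))
    have h3 := hin (τ d) (τ c) (τ d).2.1 hle (τ c).2.2 (intermediate_value_Icc' hcd.le hτc)
    rw [ext_eq, ext_eq, hτ c hc, hτ d hd, hr c hc, hr d hd] at h3
    intro h
    linarith

/-- Independent loops are separated by homomorphisms to the real line. -/
theorem IndependentLoops.exists_hom_real {x : M} {n : ℕ} {β : Fin n → PAPath E x x}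
    (hβ : IndependentLoops β) (i : Fin n) :
    ∃ h : LoopGroup E x →* Multiplicative ℝ, (h (loopClass (β i))).toAdd ≠ 0 ∧
      ∀ j, j ≠ i → h (loopClass (β j)) = 1 := by
  obtain ⟨m, e, hgraph, hind⟩ := hβ
  obtain ⟨k, hk, hk'⟩ := hind i
  have he := hgraph.isEdge k
  -- The middle half of the edge is a compact injective arc away from the vertices, so the other
  -- loops do not meet it. Any compact interval of positive length inside `(0, 1)` would serve.
  have hsub : Icc (1 / 4 : ℝ) (3 / 4) ⊆ Ioo 0 1 := fun s hs =>
    ⟨by linarith [hs.1], by linarith [hs.2]⟩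
  have hcd : (1 / 4 : ℝ) < 3 / 4 := by norm_num
  have hinj : InjOn (e k) (Icc (1 / 4 : ℝ) (3 / 4)) := he.injOn_Ioo.mono hsub
  have han : ∀ t ∈ Icc (1 / 4 : ℝ) (3 / 4), ContMDiffAt 𝓘(ℝ, ℝ) 𝓘(ℝ, E) ω (e k) t :=
    fun t ht => he.analytic t (Ioo_subset_Icc_self (hsub ht))
  let r : M → ℝ := Function.invFunOn (e k) (Icc (1 / 4 : ℝ) (3 / 4))
  have hr : ∀ s ∈ Icc (1 / 4 : ℝ) (3 / 4), r (e k s) = s := fun s hs =>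
    hinj.leftInvOn_invFunOn hs
  have hbreaks : ∀ {y z : M} (γ : PAPath E y z), ∃ V : Set ℝ, V.Finite ∧
      BreaksAlong γ.1.extend (e k '' Icc (1 / 4 : ℝ) (3 / 4)) V := fun γ =>
    γ.2.exists_breaks_arc han hcd hinj
  obtain ⟨h, hh⟩ := exists_development_hom hbreaks r x
  refine ⟨h, ?_, fun j hj => ?_⟩
  · obtain ⟨V, hV, hVb⟩ := hbreaks (β i)
    obtain ⟨D, hD⟩ := hVb.exists_isDevelopment hV r
    rw [hh _ D hD]
    exact hD.sub_ne_zero_of_existsUnique _ hcd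
      (fun t ht => (han t ht).continuousAt.continuousWithinAt) hinj
      (fun s hs => hk s (hsub hs)) hr
  · have hD : IsDevelopment (β j).1.extend (e k '' Icc (1 / 4 : ℝ) (3 / 4)) r 0 1
        (fun _ => 0) := by
      refine IsDevelopment.of_notMem ?_
      rintro t ht ⟨s, hs, hst⟩
      refine he.notMem_vertices (hsub hs) (hk' j hj ⟨⟨s, Ioo_subset_Icc_self (hsub hs), rfl⟩, ?_⟩)
      rw [hst, Path.extend_apply _ ht]
      exact mem_range_self _
    have := hh _ _ hD
    rw [sub_self] at this
    exact toAdd_eq_zero.1 this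

/-- The values of a `U(1)`-valued homomorphism on independent loops can be prescribed. -/
theorem IndependentLoops.exists_hom_circle {x : M} {n : ℕ} {β : Fin n → PAPath E x x}
    (hβ : IndependentLoops β) (z : Fin n → Circle) :
    ∃ H : LoopGroup E x →* Circle, ∀ k, H (loopClass (β k)) = z k := by
  choose h h1 h2 using hβ.exists_hom_real
  choose θ hθ using fun k => Circle.exp_surjective (z k)
  -- The rescaling makes `H i` take the value `z i` on `β i`, while it is trivial on the other
  -- loops; the product of the `H i` then has all the prescribed values.
  let H : Fin n → LoopGroup E x →* Circle := fun i =>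
    MonoidHom.mk' (fun α => Circle.exp (θ i / (h i (loopClass (β i))).toAdd * (h i α).toAdd))
      (fun a b => by rw [map_mul (h i), toAdd_mul, mul_add, Circle.exp_add])
  refine ⟨∏ i, H i, fun k => ?_⟩
  rw [MonoidHom.finsetProd_apply, Finset.prod_eq_single k]
  · change Circle.exp _ = _
    rw [div_mul_cancel₀ _ (h1 k), hθ]
  · intro i _ hik
    change Circle.exp _ = _
    rw [h2 i k hik.symm]
    simp
  · simp

end IndependentLoops

/-! ### The graph of a finite family of paths -/

section Graph

variable {E : Type*} [NormedAddCommGroup E] [NormedSpace ℝ E]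
  {M : Type*} [TopologicalSpace M] [ChartedSpace E M]

/-- An injective analytic curve, immersed in the interior, is an edge up to an affine change of
the parameter. -/
theorem IsArc.exists_isEdge [T2Space M] {f : ℝ → M} {a b : ℝ} (h : IsArc E f a b) (hab : a < b) :
    ∃ e : ℝ → M, IsEdge E e ∧ InjOn e (Icc 0 1) ∧ e '' Icc 0 1 = f '' Icc a b ∧
      e '' Ioo 0 1 = f '' Ioo a b ∧ e 0 = f a ∧ e 1 = f b := by
  obtain ⟨η, han, heq, hinj, hd⟩ := h
  have hba : 0 < b - a := sub_pos.2 hab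
  have hba' : b - a ≠ 0 := hba.ne'
  have hIcc : (fun s => (b - a) * s + a) '' Icc 0 1 = Icc a b := by
    rw [image_affine_Icc' hba]
    congr 1 <;> ring
  have hIoo : (fun s => (b - a) * s + a) '' Ioo 0 1 = Ioo a b := by
    rw [image_affine_Ioo hba]
    congr 1 <;> ring
  have hmem : ∀ s ∈ Icc (0 : ℝ) 1, (b - a) * s + a ∈ Icc a b := fun s hs =>
    hIcc ▸ mem_image_of_mem _ hs
  have hmem' : ∀ s ∈ Ioo (0 : ℝ) 1, (b - a) * s + a ∈ Ioo a b := fun s hs =>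
    hIoo ▸ mem_image_of_mem _ hs
  let e : ℝ → M := fun s => η ((b - a) * s + a)
  have hean : ∀ t ∈ Icc (0 : ℝ) 1, ContMDiffAt 𝓘(ℝ, ℝ) 𝓘(ℝ, E) ω e t := fun t ht =>
    (han _ (hmem t ht)).comp_affine
  have hei : InjOn e (Icc 0 1) := by
    intro s hs t ht hst
    have := hinj (hmem s hs) (hmem t ht) hst
    have := mul_left_cancel₀ hba' (add_right_cancel this)
    exact this
  refine ⟨e, ⟨hean, fun t ht h0 => ?_, ?_⟩, hei, ?_, ?_, ?_, ?_⟩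
  · refine hd _ (hmem' t ht) ?_
    have h1 : HasMFDerivAt 𝓘(ℝ, ℝ) 𝓘(ℝ, E) e t 0 := by
      rw [← h0]
      exact ((hean t (Ioo_subset_Icc_self ht)).mdifferentiableAt (by simp)).hasMFDerivAt
    -- The inverse of the affine change of parameter: since `e ∘ ψ = η`, a zero derivative of `e`
    -- would give one of `η`.
    let ψ : ℝ → ℝ := fun s => (b - a)⁻¹ * (s - a)
    have hψ : DifferentiableAt ℝ ψ ((b - a) * t + a) := by
      dsimp only [ψ]
      fun_prop
    have hψt : ψ ((b - a) * t + a) = t := by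
      simp only [ψ]
      field_simp
      ring
    have h2 : HasMFDerivAt 𝓘(ℝ, ℝ) 𝓘(ℝ, ℝ) ψ ((b - a) * t + a) (fderiv ℝ ψ ((b - a) * t + a)) :=
      hψ.hasFDerivAt.hasMFDerivAt
    have h3 : HasMFDerivAt 𝓘(ℝ, ℝ) 𝓘(ℝ, E) (e ∘ ψ) ((b - a) * t + a) 0 := by
      rw [← hψt] at h1
      have := h1.comp ((b - a) * t + a) h2
      rwa [ContinuousLinearMap.zero_comp] at this
    have h4 : e ∘ ψ = η := by
      funext s
      simp only [e, ψ, Function.comp_apply]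
      congr 1
      field_simp
      ring
    rw [h4] at h3
    exact h3.mfderiv
  · have hc : Continuous ((Icc (0 : ℝ) 1).domRestrict e) :=
      continuousOn_iff_continuous_domRestrict.1
        fun t ht => (hean t ht).continuousAt.continuousWithinAt
    have hce := hc.isClosedEmbedding (injOn_iff_injective.1 hei)
    exact hce.isEmbedding.comp (IsEmbedding.inclusion Ioo_subset_Icc_self)
  · rw [heq.image_eq, ← hIcc, image_image]
  · rw [(heq.mono Ioo_subset_Icc_self).image_eq, ← hIoo, image_image]
  · simp only [e]
    rw [heq (left_mem_Icc.2 hab.le)]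
    simp
  · simp only [e]
    rw [heq (right_mem_Icc.2 hab.le)]
    simp

/-- Allows pieces of curves to be compared through their interiors alone: equal open images give
equal closed images. -/
theorem image_Icc_eq_closure_image_Ioo {N : Type*} [TopologicalSpace N] [T2Space N] {f : ℝ → N}
    {a b : ℝ} (hab : a < b) (hf : ContinuousOn f (Icc a b)) :
    f '' Icc a b = closure (f '' Ioo a b) := by
  have h := closure_Ioo hab.ne
  rw [← image_closure_of_isCompact (by rw [h]; exact isCompact_Icc) (by rwa [h]), h]

/-- Points of a finite set enclosing an interval that avoids it. -/
theorem Set.Finite.exists_enclosing {W : Set ℝ} (hW : W.Finite) {p q a b : ℝ} (hp : p ∈ W)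
    (hq : q ∈ W) (hpa : p ≤ a) (hbq : b ≤ q) (hd : Disjoint (Ioo a b) W) :
    ∃ a' ∈ W, ∃ b' ∈ W, a' ≤ a ∧ b ≤ b' ∧ Disjoint (Ioo a' b') W := by
  obtain ⟨a', ⟨ha', ha'a⟩, hmax⟩ := (hW.subset (inter_subset_left (t := Iic a))).exists_maximal
    ⟨p, hp, hpa⟩
  obtain ⟨b', ⟨hb', hbb'⟩, hmin⟩ := (hW.subset (inter_subset_left (t := Ici b))).exists_minimal
    ⟨q, hq, hbq⟩
  refine ⟨a', ha', b', hb', ha'a, hbb', Set.disjoint_left.2 fun u hu huW => ?_⟩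
  rcases le_or_gt u a with h | h
  · exact absurd (hmax ⟨huW, h⟩ hu.1.le) (not_le.2 hu.1)
  rcases le_or_gt b u with h' | h'
  · exact absurd (hmin ⟨huW, h'⟩ hu.2.le) (not_le.2 hu.2)
  · exact Set.disjoint_left.1 hd ⟨h, h'⟩ huW

/-- Break points of a finite family of curves, fine enough that the pieces between them are
constant or arcs which have the same interior or meet at most in end points. -/
theorem exists_compatible_breaks [T2Space M] [CompleteSpace E] [IsManifold 𝓘(ℝ, E) ω M]
    {ι : Type*} [Finite ι] {x : M} (γ : ι → PAPath E x x) :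
    ∃ (V : ι → Set ℝ) (vert : Set M), (∀ i, (V i).Finite) ∧ (∀ i, V i ⊆ Icc 0 1) ∧
      (∀ i, 0 ∈ V i) ∧ (∀ i, 1 ∈ V i) ∧ (∀ i, MapsTo (γ i).1.extend (V i) vert) ∧
      ∀ i, ∀ a ∈ V i, ∀ b ∈ V i, a < b → Disjoint (Ioo a b) (V i) →
        (∀ s ∈ Icc a b, (γ i).1.extend s = (γ i).1.extend a) ∨
        (IsArc E (γ i).1.extend a b ∧ MapsTo (γ i).1.extend (Ioo a b) vertᶜ ∧
          ∀ j, ∀ c ∈ V j, ∀ d ∈ V j, c < d → Disjoint (Ioo c d) (V j) →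
            IsArc E (γ j).1.extend c d → MapsTo (γ j).1.extend (Ioo c d) vertᶜ →
            ((γ i).1.extend '' Ioo a b ∩ (γ j).1.extend '' Ioo c d).Nonempty →
            (γ i).1.extend '' Ioo a b ⊆ (γ j).1.extend '' Ioo c d) := by
  classical
  have hcont : ∀ i, Continuous (γ i).1.extend := fun i => (γ i).1.continuous_extend
  choose W₀ hW₀ hW₀b using fun i => (γ i).2.exists_breaks_isArc
  let W : ι → Set ℝ := fun i => insert 0 (insert 1 (W₀ i ∩ Icc 0 1))
  have hW : ∀ i, (W i).Finite := fun i => (((hW₀ i).subset inter_subset_left).insert _).insert _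
  have hWI : ∀ i, W i ⊆ Icc 0 1 := fun i => insert_subset (by simp)
    (insert_subset (by simp) inter_subset_right)
  have hWb : ∀ i a b, 0 ≤ a → b ≤ 1 → a < b → Disjoint (Ioo a b) (W i) →
      (∀ s ∈ Icc a b, (γ i).1.extend s = (γ i).1.extend a) ∨ IsArc E (γ i).1.extend a b := by
    intro i a b ha hb hab hd
    refine hW₀b i a b ha hb hab (Set.disjoint_left.2 fun u hu huW => ?_)
    exact Set.disjoint_left.1 hd hu (mem_insert_of_mem _ (mem_insert_of_mem _
      ⟨huW, ha.trans hu.1.le, hu.2.le.trans hb⟩))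
  let arcs : Set (ι × ℝ × ℝ) := {p | p.2.1 ∈ W p.1 ∧ p.2.2 ∈ W p.1 ∧ p.2.1 < p.2.2 ∧
    IsArc E (γ p.1).1.extend p.2.1 p.2.2}
  have harcs : arcs.Finite := by
    refine (Set.finite_iUnion fun i => ((hW i).prod (hW i)).image (fun q => (i, q))).subset ?_
    rintro ⟨i, a, b⟩ ⟨h1, h2, -, -⟩
    exact mem_iUnion.2 ⟨i, (a, b), ⟨h1, h2⟩, rfl⟩
  have hB : ∀ (i : ι) (p : ι × ℝ × ℝ), ∃ B : Set ℝ, B.Finite ∧ (p ∈ arcs →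
      BreaksAlong (γ i).1.extend ((γ p.1).1.extend '' Icc p.2.1 p.2.2) B) := by
    intro i p
    by_cases hp : p ∈ arcs
    · obtain ⟨-, -, hlt, η, han, heq, hinj, -⟩ := hp
      obtain ⟨B, hB, hBb⟩ := (γ i).2.exists_breaks_arc han hlt hinj
      refine ⟨B, hB, fun _ => ?_⟩
      rw [heq.image_eq]
      exact hBb
    · exact ⟨∅, Set.finite_empty, fun h => absurd h hp⟩
  choose B hBf hBb using hB
  -- The break points in `W i` cut the `i`-th path into arcs and constant pieces; those in `B i p`
  -- cut it where it enters or leaves the arc `p`. The images of all of them are the vertices.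
  let V₃ : ι → Set ℝ := fun i => W i ∪ ⋃ p ∈ arcs, B i p ∩ Icc 0 1
  have hV₃ : ∀ i, (V₃ i).Finite := fun i =>
    (hW i).union (harcs.biUnion fun p _ => (hBf i p).subset inter_subset_left)
  have hV₃I : ∀ i, V₃ i ⊆ Icc 0 1 := fun i =>
    union_subset (hWI i) (iUnion₂_subset fun p _ => inter_subset_right)
  let vert : Set M := ⋃ i, (γ i).1.extend '' V₃ i
  have hvert : vert.Finite := Set.finite_iUnion fun i => (hV₃ i).image _
  let Z : ι × ℝ × ℝ → Set ℝ := fun p => {u | u ∈ Icc p.2.1 p.2.2 ∧ (γ p.1).1.extend u ∈ vert}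
  have hZ : ∀ p ∈ arcs, (Z p).Finite := by
    intro p hp
    refine Set.Finite.of_finite_image (f := (γ p.1).1.extend) (hvert.subset ?_)
      (hp.2.2.2.injOn.mono fun u hu => hu.1)
    rintro _ ⟨u, hu, rfl⟩
    exact hu.2
  -- Every parameter at which an arc passes through a vertex is added; there are finitely many by
  -- injectivity. These points map to existing vertices, so no new vertices arise and one round of
  -- refinement suffices.
  let V : ι → Set ℝ := fun i => V₃ i ∪ ⋃ p ∈ {p | p ∈ arcs ∧ p.1 = i}, Z p
  have hV : ∀ i, (V i).Finite := fun i => (hV₃ i).union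
    ((harcs.subset fun p hp => hp.1).biUnion fun p hp => hZ p hp.1)
  have hVI : ∀ i, V i ⊆ Icc 0 1 := by
    refine fun i => union_subset (hV₃I i) (iUnion₂_subset fun p hp u hu => ?_)
    exact ⟨(hWI _ hp.1.1).1.trans hu.1.1, hu.1.2.trans (hWI _ hp.1.2.1).2⟩
  have hWV : ∀ i, W i ⊆ V i := fun i => subset_union_left.trans subset_union_left
  have hVvert : ∀ i, MapsTo (γ i).1.extend (V i) vert := by
    rintro i u (hu | hu)
    · exact mem_iUnion.2 ⟨i, mem_image_of_mem _ hu⟩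
    · obtain ⟨p, ⟨-, rfl⟩, hup⟩ := mem_iUnion₂.1 hu
      exact hup.2
  have hencl : ∀ i, ∀ a ∈ V i, ∀ b ∈ V i, a < b → Disjoint (Ioo a b) (V i) →
      (∀ s ∈ Icc a b, (γ i).1.extend s = (γ i).1.extend a) ∨
      ∃ a' b', (i, a', b') ∈ arcs ∧ a' ≤ a ∧ b ≤ b' := by
    intro i a ha b hb hab hd
    obtain ⟨a', ha', b', hb', haa', hbb', hd'⟩ := (hW i).exists_enclosing (p := 0) (q := 1)
      (by simp [W]) (by simp [W]) (hVI i ha).1 (hVI i hb).2 (hd.mono_right (hWV i))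
    have hlt : a' < b' := haa'.trans_lt (hab.trans_le hbb')
    rcases hWb i a' b' (hWI i ha').1 (hWI i hb').2 hlt hd' with h | h
    · left
      intro s hs
      rw [h s ⟨haa'.trans hs.1, hs.2.trans hbb'⟩, h a ⟨haa', hab.le.trans hbb'⟩]
    · exact Or.inr ⟨a', b', ⟨ha', hb', hlt, h⟩, haa', hbb'⟩
  refine ⟨V, vert, hV, hVI, fun i => hWV i (by simp [W]), fun i => hWV i (by simp [W]),
    hVvert, fun i a ha b hb hab hd => ?_⟩
  rcases hencl i a ha b hb hab hd with h | ⟨a', b', harc, haa', hbb'⟩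
  · exact Or.inl h
  right
  have hav : MapsTo (γ i).1.extend (Ioo a b) vertᶜ := by
    intro u hu huv
    refine Set.disjoint_left.1 hd hu (Or.inr (mem_iUnion₂.2 ⟨(i, a', b'), ⟨harc, rfl⟩, ?_, huv⟩))
    exact ⟨haa'.trans hu.1.le, hu.2.le.trans hbb'⟩
  refine ⟨harc.2.2.2.mono haa' hbb', hav, fun j c hc d hd' hcd hdisj hjarc hjv hne => ?_⟩
  rcases hencl j c hc d hd' hcd hdisj with h | ⟨c', d', harc', hcc', hdd'⟩
  · exact absurd (hjarc.injOn (left_mem_Icc.2 hcd.le) (right_mem_Icc.2 hcd.le)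
      (h d (right_mem_Icc.2 hcd.le)).symm) hcd.ne
  obtain ⟨_, ⟨u, hu, rfl⟩, w, hw, hwu⟩ := hne
  have hw' : w ∈ Icc c' d' := ⟨hcc'.trans hw.1.le, hw.2.le.trans hdd'⟩
  have hbreak : Disjoint (Ioo a b) (B i (j, c', d')) := by
    refine Set.disjoint_left.2 fun v hv hvB => Set.disjoint_left.1 hd hv (Or.inl (Or.inr ?_))
    exact mem_iUnion₂.2 ⟨_, harc', hvB, (hVI i ha).1.trans hv.1.le, hv.2.le.trans (hVI i hb).2⟩
  -- The piece has no break point relative to the large arc on `[c', d']` and meets it, so it runs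
  -- inside it.
  have hin : ∀ s ∈ Ioo a b, ∃ t ∈ Icc c' d', (γ j).1.extend t = (γ i).1.extend s := by
    refine (hBb i _ harc' a b (hVI i ha).1 (hVI i hb).2 hab hbreak).resolve_right fun h => ?_
    exact h hu ⟨w, hw', hwu⟩
  choose! h hhI hh using hin
  have hhc : ContinuousOn h (Ioo a b) := continuousOn_of_comp_injOn isCompact_Icc
    (hcont j).continuousOn harc'.2.2.2.injOn (hcont i).continuousOn hhI hh
  have hhu : h u = w := harc'.2.2.2.injOn (hhI u hu) hw' ((hh u hu).trans hwu.symm)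
  have hord : (h '' Ioo a b).OrdConnected := (isPreconnected_Ioo.image h hhc).ordConnected
  -- The lifted parameters form an interval. It avoids `V j`, because points of `V j` go to vertices
  -- and the piece avoids them; as it contains `w`, it cannot leave `(c, d)`.
  have hno : ∀ v ∈ V j, v ∉ h '' Ioo a b := by
    rintro v hv ⟨s, hs, rfl⟩
    exact hav hs (hh s hs ▸ hVvert j hv)
  have hwmem : w ∈ h '' Ioo a b := ⟨u, hu, hhu⟩
  rintro _ ⟨s, hs, rfl⟩
  refine ⟨h s, ⟨?_, ?_⟩, hh s hs⟩
  · by_contra hlt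
    exact hno c hc (hord.out (mem_image_of_mem h hs) hwmem ⟨not_lt.1 hlt, hw.1.le⟩)
  · by_contra hlt
    exact hno d hd' (hord.out hwmem (mem_image_of_mem h hs) ⟨hw.2.le, not_lt.1 hlt⟩)

/-- Finitely many piecewise analytic loops run in a finite embedded graph, along its edges. -/
theorem exists_graph [T2Space M] [CompleteSpace E] [IsManifold 𝓘(ℝ, E) ω M]
    {ι : Type*} [Finite ι] {x : M} (γ : ι → PAPath E x x) :
    ∃ (m : ℕ) (e : Fin m → ℝ → M), (∀ k, IsEdge E (e k)) ∧ (∀ k, InjOn (e k) (Icc 0 1)) ∧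
      (∀ k l, k ≠ l →
        e k '' Icc 0 1 ∩ e l '' Icc 0 1 ⊆ edgeVertices (e k) ∩ edgeVertices (e l)) ∧
      ∀ i, ∃ V : Set ℝ, V.Finite ∧ V ⊆ Icc 0 1 ∧ 0 ∈ V ∧ 1 ∈ V ∧
        ∀ a ∈ V, ∀ b ∈ V, a < b → Disjoint (Ioo a b) V →
          (∀ s ∈ Icc a b, (γ i).1.extend s = (γ i).1.extend a) ∨
          (InjOn (γ i).1.extend (Icc a b) ∧
            ∃ k, (γ i).1.extend '' Icc a b = e k '' Icc 0 1) := by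
  have hcont : ∀ i, Continuous (γ i).1.extend := fun i => (γ i).1.continuous_extend
  obtain ⟨V, vert, hV, hVI, hV0, hV1, hVvert, hpiece⟩ := exists_compatible_breaks γ
  let pieces : Set (ι × ℝ × ℝ) := {p | p.2.1 ∈ V p.1 ∧ p.2.2 ∈ V p.1 ∧ p.2.1 < p.2.2 ∧
    Disjoint (Ioo p.2.1 p.2.2) (V p.1) ∧ IsArc E (γ p.1).1.extend p.2.1 p.2.2 ∧
    MapsTo (γ p.1).1.extend (Ioo p.2.1 p.2.2) vertᶜ}
  have hpieces : pieces.Finite := by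
    refine (Set.finite_iUnion fun i => ((hV i).prod (hV i)).image (fun q => (i, q))).subset ?_
    rintro ⟨i, a, b⟩ ⟨h1, h2, -, -⟩
    exact mem_iUnion.2 ⟨i, (a, b), ⟨h1, h2⟩, rfl⟩
  let img : ι × ℝ × ℝ → Set M := fun p => (γ p.1).1.extend '' Ioo p.2.1 p.2.2
  have himg : ∀ p ∈ pieces, ∀ q ∈ pieces, (img p ∩ img q).Nonempty → img p = img q := by
    have sub : ∀ p ∈ pieces, ∀ q ∈ pieces, (img p ∩ img q).Nonempty → img p ⊆ img q := by
      rintro ⟨i, a, b⟩ ⟨ha, hb, hab, hd, harc, hv⟩ ⟨j, c, d⟩ ⟨hc, hd', hcd, hdd, harc', hv'⟩ hne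
      rcases hpiece i a ha b hb hab hd with h | h
      · exact absurd (harc.injOn (left_mem_Icc.2 hab.le) (right_mem_Icc.2 hab.le)
          (h b (right_mem_Icc.2 hab.le)).symm) hab.ne
      · exact h.2.2 j c hc d hd' hcd hdd harc' hv' hne
    exact fun p hp q hq hne => (sub p hp q hq hne).antisymm
      (sub q hq p hp (by rwa [inter_comm]))
  -- Open pieces have equal or disjoint images. The edges are indexed by the distinct images, with
  -- one piece chosen to parametrize each.
  have hfin : Finite (img '' pieces) := (hpieces.image img).to_subtype
  let ξ := Finite.equivFin (img '' pieces)
  choose p hp hpimg using fun k : img '' pieces => k.2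
  choose e he hei heI heO he0 he1 using fun k => (hp k).2.2.2.2.1.exists_isEdge (hp k).2.2.1
  have heO' : ∀ k, e k '' Ioo 0 1 = k := fun k => (heO k).trans (hpimg k)
  have hev : ∀ k, ∀ s ∈ Icc (0 : ℝ) 1, e k s ∈ vert → e k s ∈ edgeVertices (e k) := by
    intro k s hs hsv
    rcases hs.1.eq_or_lt with rfl | h0
    · exact Or.inl rfl
    rcases hs.2.eq_or_lt with rfl | h1
    · exact Or.inr rfl
    have hmem : e k s ∈ e k '' Ioo 0 1 := ⟨s, ⟨h0, h1⟩, rfl⟩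
    rw [heO k] at hmem
    obtain ⟨u, hu, hus⟩ := hmem
    exact absurd (hus ▸ hsv) ((hp k).2.2.2.2.2 hu)
  have hve : ∀ k, edgeVertices (e k) ⊆ vert := by
    rintro k _ (rfl | rfl)
    · rw [he0]
      exact hVvert _ (hp k).1
    · rw [he1]
      exact hVvert _ (hp k).2.1
  have hint : ∀ k l, k ≠ l →
      e k '' Icc 0 1 ∩ e l '' Icc 0 1 ⊆ edgeVertices (e k) ∩ edgeVertices (e l) := by
    rintro k l hkl y ⟨⟨s, hs, rfl⟩, t, ht, hts⟩
    -- A common point that is not a vertex would be interior to both edges, so their open images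
    -- would meet and thus coincide.
    have hyv : e k s ∈ vert := by
      by_contra hyv
      have inner : ∀ k', ∀ u ∈ Icc (0 : ℝ) 1, e k' u ∉ vert → e k' u ∈ (k' : Set M) := by
        intro k' u hu huv
        rw [← heO' k']
        refine ⟨u, ⟨hu.1.lt_of_ne ?_, hu.2.lt_of_ne ?_⟩, rfl⟩
        · rintro rfl
          exact huv (hve k' (Or.inl rfl))
        · rintro rfl
          exact huv (hve k' (Or.inr rfl))
      have h1 := inner k s hs hyv
      have h2 := inner l t ht (by rwa [hts])
      rw [hts] at h2
      have := himg (p k) (hp k) (p l) (hp l) ⟨e k s, by rwa [hpimg], by rwa [hpimg]⟩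
      rw [hpimg, hpimg] at this
      exact hkl (Subtype.ext this)
    exact ⟨hev k s hs hyv, hts ▸ hev l t ht (hts.symm ▸ hyv)⟩
  refine ⟨_, fun k => e (ξ.symm k), fun k => he _, fun k => hei _,
    fun k l hkl => hint _ _ fun h => hkl (ξ.symm.injective h), fun i => ?_⟩
  refine ⟨V i, hV i, hVI i, hV0 i, hV1 i, fun a ha b hb hab hd => ?_⟩
  rcases hpiece i a ha b hb hab hd with h | h
  · exact Or.inl h
  right
  have hmem : (i, a, b) ∈ pieces := ⟨ha, hb, hab, hd, h.1, h.2.1⟩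
  let k : img '' pieces := ⟨img (i, a, b), mem_image_of_mem img hmem⟩
  refine ⟨h.1.injOn, ξ k, ?_⟩
  change _ = e (ξ.symm (ξ k)) '' _
  rw [Equiv.symm_apply_apply, image_Icc_eq_closure_image_Ioo hab (hcont i).continuousOn,
    image_Icc_eq_closure_image_Ioo zero_lt_one
      (fun t ht => ((he k).analytic t ht).continuousAt.continuousWithinAt), heO']

end Graph

/-! ### Segments of paths -/

section Segments

variable {E : Type*} [NormedAddCommGroup E] [NormedSpace ℝ E]
  {M : Type*} [TopologicalSpace M] [ChartedSpace E M]

namespace PAPath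

theorem extend_zero {x y : M} (p : PAPath E x y) : p.1.extend 0 = x := Path.extend_zero _

theorem extend_one {x y : M} (p : PAPath E x y) : p.1.extend 1 = y := Path.extend_one _

theorem rel_of_extend {x y : M} (p q : PAPath E x y) (φ : ℝ → ℝ) (hφ : ContinuousOn φ (Icc 0 1))
    (hm : MonotoneOn φ (Icc 0 1)) (h0 : φ 0 = 0) (h1 : φ 1 = 1)
    (h : ∀ t ∈ Icc (0 : ℝ) 1, q.1.extend t = p.1.extend (φ t)) : elementarySetoid E x y p q := by
  have hI : ∀ t ∈ Icc (0 : ℝ) 1, φ t ∈ Icc (0 : ℝ) 1 := fun t ht =>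
    ⟨h0 ▸ hm (by simp) ht ht.1, h1 ▸ hm ht (by simp) ht.2⟩
  refine rel_reparam p q (fun t => ⟨φ t, hI t t.2⟩) ?_ ?_ (Subtype.ext h0) (Subtype.ext h1) ?_
  · exact (continuousOn_iff_continuous_domRestrict.1 hφ).subtype_mk _
  · exact fun s t hst => hm s.2 t.2 hst
  · intro t
    have := h t t.2
    rwa [Path.extend_apply _ t.2, Path.extend_apply _ (hI t t.2)] at this

theorem exists_segment {x y : M} (γ : PAPath E x y) {a b : ℝ} (ha : 0 ≤ a) (hab : a < b)
    (hb : b ≤ 1) : ∃ q : PAPath E (γ.1.extend a) (γ.1.extend b),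
      ∀ s ∈ Icc (0 : ℝ) 1, q.1.extend s = γ.1.extend ((b - a) * s + a) := by
  have hba : 0 < b - a := sub_pos.2 hab
  let P : Path (γ.1.extend a) (γ.1.extend b) :=
    { toFun := fun s => γ.1.extend ((b - a) * s + a)
      continuous_toFun := γ.1.continuous_extend.comp (by fun_prop)
      source' := by simp
      target' := by simp }
  have hP : ∀ s ∈ Icc (0 : ℝ) 1, P.extend s = γ.1.extend ((b - a) * s + a) := fun s hs =>
    Path.extend_apply _ hs
  refine ⟨⟨P, ?_⟩, hP⟩
  obtain ⟨n, t, ht, h0, h1, hp⟩ := γ.2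
  -- The partition of `γ`, rescaled to the segment and clamped to `[0, 1]`. Clamping may collapse an
  -- interval to a point, where a constant map does; an interval that does not collapse lies inside
  -- the rescaled original one.
  let u : ℕ → ℝ := fun k => max 0 (min 1 ((t k - a) / (b - a)))
  have hu01 : ∀ k, u k ∈ Icc (0 : ℝ) 1 := fun k =>
    ⟨le_max_left _ _, max_le zero_le_one (min_le_left _ _)⟩
  have hu : Monotone u := fun k l hkl => max_le_max le_rfl (min_le_min le_rfl
    (div_le_div_of_nonneg_right (sub_le_sub_right (ht hkl) a) hba.le))
  refine ⟨n, u, hu, ?_, ?_, fun k hk => ?_⟩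
  · refine max_eq_left ((min_le_right _ _).trans ?_)
    rw [h0]
    exact div_nonpos_of_nonpos_of_nonneg (by linarith) hba.le
  · have : 1 ≤ (t n - a) / (b - a) := by
      rw [h1, le_div_iff₀ hba]
      linarith
    simp only [u, min_eq_left this]
    norm_num
  · rcases (hu (Nat.le_succ k)).eq_or_lt with heq | hlt
    · refine ⟨fun _ => P.extend (u k), fun _ _ => contMDiffAt_const, fun s hs => ?_⟩
      rw [← Nat.succ_eq_add_one, ← heq, Icc_self] at hs
      rw [hs]
    · refine (hp k hk).comp_affine (b - a) a (fun s hs => ?_) (fun s hs => ?_)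
      · constructor
        · have h2 : (t k - a) / (b - a) ≤ s := by
            refine le_trans ?_ hs.1
            refine le_max_of_le_right (le_min ?_ le_rfl)
            by_contra hgt
            have : u k = 1 := by
              simp only [u, min_eq_left (not_le.1 hgt).le]
              norm_num
            linarith [(hu01 k.succ).2]
          rw [div_le_iff₀ hba] at h2
          linarith
        · have h2 : s ≤ (t (k + 1) - a) / (b - a) := by
            refine hs.2.trans (max_le ?_ (min_le_right _ _))
            by_contra hgt
            have : u k.succ = 0 := max_eq_left ((min_le_right _ _).trans (not_le.1 hgt).le)
            linarith [(hu01 k).1]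
          rw [le_div_iff₀ hba] at h2
          linarith
      · exact hP s ⟨(hu01 k).1.trans hs.1, hs.2.trans (hu01 (k + 1)).2⟩

theorem rel_trans_of_segments {x y z : M} {f : ℝ → M} {a v b : ℝ} (hav : a < v) (hvb : v < b)
    (q : PAPath E x z) (q₁ : PAPath E x y) (q₂ : PAPath E y z)
    (hq : ∀ s ∈ Icc (0 : ℝ) 1, q.1.extend s = f ((b - a) * s + a))
    (hq₁ : ∀ s ∈ Icc (0 : ℝ) 1, q₁.1.extend s = f ((v - a) * s + a))
    (hq₂ : ∀ s ∈ Icc (0 : ℝ) 1, q₂.1.extend s = f ((b - v) * s + v)) :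
    elementarySetoid E x z q (q₁.trans q₂) := by
  have hba : 0 < b - a := by linarith
  have hba' : b - a ≠ 0 := hba.ne'
  -- The piecewise linear bijection that moves the concatenation point `1/2` to `(v - a) / (b - a)`.
  let φ : ℝ → ℝ := fun s =>
    (v - a) / (b - a) * min (2 * s) 1 + (b - v) / (b - a) * max (2 * s - 1) 0
  have c1 : 0 ≤ (v - a) / (b - a) := div_nonneg (by linarith) hba.le
  have c2 : 0 ≤ (b - v) / (b - a) := div_nonneg (by linarith) hba.le
  have c3 : (v - a) / (b - a) + (b - v) / (b - a) = 1 := by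
    field_simp
    ring
  have hφ : Continuous φ := by fun_prop
  have hm : Monotone φ := fun s t hst => add_le_add
    (mul_le_mul_of_nonneg_left (min_le_min (by linarith) le_rfl) c1)
    (mul_le_mul_of_nonneg_left (max_le_max (by linarith) le_rfl) c2)
  have h0 : φ 0 = 0 := by simp [φ]
  have h1 : φ 1 = 1 := by
    simp only [φ]
    norm_num
    exact c3
  refine rel_of_extend q _ φ hφ.continuousOn (hm.monotoneOn _) h0 h1 fun t ht => ?_
  rw [hq _ ⟨h0 ▸ hm ht.1, h1 ▸ hm ht.2⟩]
  rcases le_total t (1 / 2) with h | h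
  · have e1 : (q₁.trans q₂).1.extend t = q₁.1.extend (2 * t) :=
      Path.extend_trans_of_le_half _ _ h
    rw [e1, hq₁ _ ⟨by linarith [ht.1], by linarith⟩]
    congr 1
    simp only [φ]
    rw [min_eq_left (by linarith), max_eq_right (by linarith)]
    field_simp
    ring
  · have e1 : (q₁.trans q₂).1.extend t = q₂.1.extend (2 * t - 1) :=
      Path.extend_trans_of_half_le _ _ h
    rw [e1, hq₂ _ ⟨by linarith, by linarith [ht.2]⟩]
    congr 1
    simp only [φ]
    rw [min_eq_right (by linarith), max_eq_left (by linarith)]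
    field_simp
    ring

/-- Two injective paths with the same image agree up to orientation and reparametrization. -/
theorem of_range_eq [T2Space M] {Q : ∀ u v : M, PAPath E u v → Prop}
    (hQ : ∀ {u v : M} (p q : PAPath E u v), elementarySetoid E u v p q → Q u v p → Q u v q)
    {u v u' v' : M} (p : PAPath E u' v') (q : PAPath E u v) (hp : InjOn p.1.extend (Icc 0 1))
    (hq : InjOn q.1.extend (Icc 0 1))
    (hpq : q.1.extend '' Icc 0 1 = p.1.extend '' Icc 0 1) (h : Q u' v' p)
    (h' : Q v' u' p.symm) : Q u v q := by
  -- The change of parameter `θ` from `q` to `p` is a continuous bijection of `[0, 1]`, hence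
  -- monotone or antitone; accordingly `q` is a reparametrization of `p` or of its reverse.
  have hex : ∀ s ∈ Icc (0 : ℝ) 1, ∃ t ∈ Icc (0 : ℝ) 1, p.1.extend t = q.1.extend s := by
    intro s hs
    have : q.1.extend s ∈ p.1.extend '' Icc 0 1 := hpq ▸ mem_image_of_mem _ hs
    exact this
  choose! θ hθI hθ using hex
  have hθc : ContinuousOn θ (Icc 0 1) := continuousOn_of_comp_injOn isCompact_Icc
    p.1.continuous_extend.continuousOn hp q.1.continuous_extend.continuousOn hθI hθ
  have hθi : InjOn θ (Icc 0 1) := by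
    intro s hs t ht hst
    refine hq hs ht ?_
    rw [← hθ s hs, ← hθ t ht, hst]
  have hsurj : ∀ t ∈ Icc (0 : ℝ) 1, ∃ s ∈ Icc (0 : ℝ) 1, θ s = t := by
    intro t ht
    have : p.1.extend t ∈ q.1.extend '' Icc 0 1 := hpq ▸ mem_image_of_mem _ ht
    obtain ⟨s, hs, hst⟩ := this
    exact ⟨s, hs, hp (hθI s hs) ht ((hθ s hs).trans hst)⟩
  have m0 : (0 : ℝ) ∈ Icc (0 : ℝ) 1 := by simp
  have m1 : (1 : ℝ) ∈ Icc (0 : ℝ) 1 := by simp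
  obtain ⟨s₀, hs₀, hs₀'⟩ := hsurj 0 m0
  obtain ⟨s₁, hs₁, hs₁'⟩ := hsurj 1 m1
  have hu := hθ 0 m0
  have hv := hθ 1 m1
  rw [q.extend_zero] at hu
  rw [q.extend_one] at hv
  rcases ContinuousOn.strictMonoOn_of_injOn_Icc' zero_le_one hθc hθi with hm | hm
  · have e0 : θ 0 = 0 :=
      le_antisymm (hs₀' ▸ hm.monotoneOn m0 hs₀ hs₀.1) (hθI 0 m0).1
    have e1 : θ 1 = 1 :=
      le_antisymm (hθI 1 m1).2 (hs₁'.symm.trans_le (hm.monotoneOn hs₁ m1 hs₁.2))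
    rw [e0, p.extend_zero] at hu
    rw [e1, p.extend_one] at hv
    -- The end points of `p` and `q` are identified only here. An equivalence of `p` with `q` could
    -- not be stated before, which is why the conclusion is about an invariant property `Q`.
    subst hu hv
    exact hQ p q (rel_of_extend p q θ hθc hm.monotoneOn e0 e1 fun t ht => (hθ t ht).symm) h
  · have e1 : θ 1 = 0 :=
      le_antisymm (hs₀' ▸ hm.antitoneOn hs₀ m1 hs₀.2) (hθI 1 m1).1
    have e0 : θ 0 = 1 :=
      le_antisymm (hθI 0 m0).2 (hs₁' ▸ hm.antitoneOn m0 hs₁ hs₁.1)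
    rw [e0, p.extend_one] at hu
    rw [e1, p.extend_zero] at hv
    subst hu hv
    refine hQ p.symm q (rel_of_extend p.symm q (fun t => 1 - θ t) (by fun_prop)
      (fun s hs t ht hst => sub_le_sub_left (hm.antitoneOn hs ht hst) 1) (by simp [e0])
      (by simp [e1]) fun t ht => ?_) h'
    have : p.symm.1.extend (1 - θ t) = p.1.extend (1 - (1 - θ t)) := Path.extend_symm_apply _ _
    rw [this, sub_sub_cancel, hθ t ht]

theorem loopClass_eq {x : M} {p q : PAPath E x x} (h : elementarySetoid E x x p q) :
    loopClass p = loopClass q := Quotient.sound h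

theorem loopClass_mul {x : M} (p q : PAPath E x x) :
    loopClass p * loopClass q = loopClass (p.trans q) := rfl

theorem loopClass_refl (x : M) : loopClass (refl x : PAPath E x x) = 1 := rfl

/-- Closing up paths through fixed connections to the base point is multiplicative, as the inner
`b⁻¹ b` is a retracing. Membership in a subgroup can thus be checked piece by piece. -/
theorem loopClass_conj_mul {x u v w : M} (a : PAPath E x u) (b : PAPath E x v) (c : PAPath E x w)
    (q : PAPath E u v) (q' : PAPath E v w) :
    loopClass (a.trans (q.trans b.symm)) * loopClass (b.trans (q'.trans c.symm)) =
      loopClass (a.trans ((q.trans q').trans c.symm)) := by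
  rw [loopClass_mul]
  refine loopClass_eq ?_
  have cancel : elementarySetoid E v x (b.symm.trans (b.trans (q'.trans c.symm)))
      (q'.trans c.symm) :=
    rel_tr (rel_assoc _ _ _) (rel_tr (rel_trans_left _ (rel_symm (rel_symm_trans b)))
      (rel_symm (rel_refl_trans _)))
  refine rel_tr (rel_symm (rel_assoc _ _ _)) (rel_trans_right a ?_)
  refine rel_tr (rel_symm (rel_assoc _ _ _)) ?_
  exact rel_tr (rel_trans_right q cancel) (rel_assoc _ _ _)

theorem loopClass_conj_inv {x u v : M} (a : PAPath E x u) (b : PAPath E x v) (q : PAPath E u v) :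
    (loopClass (a.trans (q.trans b.symm)))⁻¹ = loopClass (b.trans (q.symm.trans a.symm)) := by
  rw [inv_eq_iff_mul_eq_one, loopClass_conj_mul, ← loopClass_refl]
  refine loopClass_eq (rel_symm (rel_tr (rel_trans_symm a) (rel_trans_right a ?_)))
  exact rel_tr (rel_refl_trans _) (rel_trans_left _ (rel_trans_symm q))

theorem loopClass_conj_eq_one {x u v : M} (a : PAPath E x u) (b : PAPath E x v)
    (q : PAPath E u v) (h : elementarySetoid E x v (a.trans q) b) :
    loopClass (a.trans (q.trans b.symm)) = 1 := by
  rw [← loopClass_refl]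
  exact loopClass_eq (rel_tr (rel_assoc _ _ _) (rel_tr (rel_trans_left _ h)
    (rel_symm (rel_trans_symm b))))

end PAPath

/-- An edge as a path. -/
def IsEdge.path {e : ℝ → M} (he : IsEdge E e) : PAPath E (e 0) (e 1) :=
  ⟨{ toFun := fun t => e t
     continuous_toFun := continuousOn_iff_continuous_domRestrict.1
      fun t ht => (he.analytic t ht).continuousAt.continuousWithinAt
     source' := rfl
     target' := rfl }, 1, fun n => n, Nat.mono_cast, by simp, by simp, fun i hi =>
      ⟨e, fun s hs => he.analytic s (by
        obtain rfl : i = 0 := by omega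
        simpa using hs), fun s hs => Path.extend_apply _ (by
        obtain rfl : i = 0 := by omega
        simpa using hs)⟩⟩

theorem IsEdge.path_extend {e : ℝ → M} (he : IsEdge E e) {s : ℝ} (hs : s ∈ Icc (0 : ℝ) 1) :
    he.path.1.extend s = e s := Path.extend_apply _ hs

theorem IsEdge.range_path {e : ℝ → M} (he : IsEdge E e) : range he.path.1 = e '' Icc 0 1 := by
  rw [image_eq_range]
  rfl

end Segments

/-! ### Spanning trees and independent generators -/

section SpanningTree

variable {E : Type*} [NormedAddCommGroup E] [NormedSpace ℝ E]
  {M : Type*} [TopologicalSpace M] [ChartedSpace E M]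

/-- `T` is the edge set of a tree with vertex set `A` and root `x`, and `p v` is a path in the tree
from `x` to the vertex `v`. -/
structure IsRootedTree {m : ℕ} {e : Fin m → ℝ → M} (he : ∀ k, IsEdge E (e k)) (x : M) (A : Set M)
    (T : Set (Fin m)) (p : ∀ v ∈ A, PAPath E x v) : Prop where
  root_mem : x ∈ A
  root : elementarySetoid E x x (p x root_mem) (PAPath.refl x)
  edge : ∀ k ∈ T, ∃ (h0 : e k 0 ∈ A) (h1 : e k 1 ∈ A),
    elementarySetoid E x (e k 1) ((p _ h0).trans (he k).path) (p _ h1)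
  range_eq : ∀ v hv, ∃ S ⊆ T, range (p v hv).1 = {v} ∪ ⋃ k ∈ S, e k '' Icc 0 1

namespace IsRootedTree

variable {m : ℕ} {e : Fin m → ℝ → M} {he : ∀ k, IsEdge E (e k)} {x : M} {A : Set M}
  {T : Set (Fin m)} {p : ∀ v ∈ A, PAPath E x v}

/-- The condition on the new edge is imposed for an arbitrary extension `p'` of the tree paths, so
that the edge may lead to `w` or start at `w`. -/
theorem exists_insert (h : IsRootedTree he x A T p) {w : M} (hw : w ∉ A) (q : PAPath E x w)
    (k : Fin m)
    (hk : ∀ p' : ∀ v ∈ insert w A, PAPath E x v, (∀ v hv hvA, p' v hv = p v hvA) →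
      p' w (mem_insert _ _) = q → ∃ (h0 : e k 0 ∈ insert w A) (h1 : e k 1 ∈ insert w A),
        elementarySetoid E x (e k 1) ((p' _ h0).trans (he k).path) (p' _ h1))
    (hq : ∃ S ⊆ insert k T, range q.1 = {w} ∪ ⋃ k ∈ S, e k '' Icc 0 1) :
    ∃ p', IsRootedTree he x (insert w A) (insert k T) p' := by
  classical
  let p' : ∀ v ∈ insert w A, PAPath E x v := fun v hv =>
    if hvw : v = w then Eq.recOn (motive := fun y _ => PAPath E x y) hvw.symm q
    else p v (hv.resolve_left hvw)
  have h1 : ∀ v hv (hvA : v ∈ A), p' v hv = p v hvA := fun v hv hvA =>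
    dif_neg fun hvw : v = w => hw (hvw ▸ hvA)
  have h2 : p' w (mem_insert _ _) = q := dif_pos rfl
  refine ⟨p', ⟨mem_insert_of_mem _ h.root_mem, ?_, ?_, ?_⟩⟩
  · rw [h1 x (mem_insert_of_mem _ h.root_mem) h.root_mem]
    exact h.root
  · rintro l (rfl | hl)
    · exact hk p' h1 h2
    · obtain ⟨m0, m1, hr⟩ := h.edge l hl
      refine ⟨mem_insert_of_mem _ m0, mem_insert_of_mem _ m1, ?_⟩
      rwa [h1 _ (mem_insert_of_mem _ m0) m0, h1 _ (mem_insert_of_mem _ m1) m1]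
  · rintro v (rfl | hv)
    · rw [h2]
      exact hq
    · rw [h1 v (mem_insert_of_mem _ hv) hv]
      obtain ⟨S, hS, hS'⟩ := h.range_eq v hv
      exact ⟨S, hS.trans (subset_insert _ _), hS'⟩

/-- A rooted tree that does not contain all the edges meeting it can be enlarged. -/
theorem exists_enlarge (h : IsRootedTree he x A T p) {k : Fin m}
    (hk : ¬ (e k 0 ∈ A ↔ e k 1 ∈ A)) :
    ∃ (A' : Set M) (T' : Set (Fin m)) (p' : ∀ v ∈ A', PAPath E x v), IsRootedTree he x A' T' p' ∧
      A ⊆ A' ∧ e k 0 ∈ A' ∧ e k 1 ∈ A' := by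
  have hend0 : e k 0 ∈ e k '' Icc 0 1 := ⟨0, by simp, rfl⟩
  have hend1 : e k 1 ∈ e k '' Icc 0 1 := ⟨1, by simp, rfl⟩
  have range_aux : ∀ {u w : M} (hu : u ∈ A) (ε : PAPath E u w), u ∈ e k '' Icc 0 1 →
      w ∈ e k '' Icc 0 1 → range ε.1 = e k '' Icc 0 1 →
      ∃ S ⊆ insert k T, range ((p u hu).trans ε).1 = {w} ∪ ⋃ l ∈ S, e l '' Icc 0 1 := by
    intro u w hu ε hue hwe hε
    obtain ⟨S, hS, hS'⟩ := h.range_eq u hu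
    refine ⟨insert k S, insert_subset_insert hS, ?_⟩
    change range ((p u hu).1.trans ε.1) = _
    rw [Path.trans_range, hS', hε, biUnion_insert]
    ext y
    simp only [mem_union, mem_singleton_iff]
    constructor
    · rintro ((rfl | hy) | hy)
      · exact Or.inr (Or.inl hue)
      · exact Or.inr (Or.inr hy)
      · exact Or.inr (Or.inl hy)
    · rintro (rfl | hy | hy)
      · exact Or.inr hwe
      · exact Or.inr hy
      · exact Or.inl (Or.inr hy)
  by_cases h0 : e k 0 ∈ A
  · have h1 : e k 1 ∉ A := fun h1 => hk (iff_of_true h0 h1)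
    obtain ⟨p', hp'⟩ := h.exists_insert h1 ((p _ h0).trans (he k).path) k
      (fun p' hA hw => ⟨mem_insert_of_mem _ h0, mem_insert _ _, by
        rw [hA _ _ h0, hw]⟩)
      (range_aux h0 _ hend0 hend1 (he k).range_path)
    exact ⟨_, _, p', hp', subset_insert _ _, mem_insert_of_mem _ h0, mem_insert _ _⟩
  · have h1 : e k 1 ∈ A := by
      by_contra h1
      exact hk (iff_of_false h0 h1)
    obtain ⟨p', hp'⟩ := h.exists_insert h0 ((p _ h1).trans (he k).path.symm) k
      (fun p' hA hw => ⟨mem_insert _ _, mem_insert_of_mem _ h1, by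
        rw [hA _ _ h1, hw]
        exact PAPath.rel_tr (PAPath.rel_symm (PAPath.rel_assoc _ _ _))
          (PAPath.rel_tr (PAPath.rel_trans_right _ (PAPath.rel_symm (PAPath.rel_symm_trans _)))
            (PAPath.rel_symm (PAPath.rel_trans_refl _)))⟩)
      (range_aux h1 _ hend1 hend0 (by
        change range (he k).path.1.symm = _
        rw [Path.symm_range, (he k).range_path]))
    exact ⟨_, _, p', hp', subset_insert _ _, mem_insert _ _, mem_insert_of_mem _ h1⟩

end IsRootedTree

/-- Existence of a maximal tree. -/
theorem exists_maximal_tree {m : ℕ} {e : Fin m → ℝ → M} (he : ∀ k, IsEdge E (e k)) (x : M) :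
    ∃ (A : Set M) (T : Set (Fin m)) (p : ∀ v ∈ A, PAPath E x v), IsRootedTree he x A T p ∧
      ∀ k, e k 0 ∈ A ↔ e k 1 ∈ A := by
  -- Induction on the number of edges that do not have both ends in the tree. At the end no edge
  -- leaves `A`, although edges in other components may remain.
  have key : ∀ n : ℕ, ∀ (A : Set M) (T : Set (Fin m)) (p : ∀ v ∈ A, PAPath E x v),
      IsRootedTree he x A T p → {k | ¬ (e k 0 ∈ A ∧ e k 1 ∈ A)}.ncard = n →
      ∃ (A : Set M) (T : Set (Fin m)) (p : ∀ v ∈ A, PAPath E x v), IsRootedTree he x A T p ∧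
        ∀ k, e k 0 ∈ A ↔ e k 1 ∈ A := by
    intro n
    induction n using Nat.strong_induction_on with
    | _ n ih =>
      intro A T p h hn
      by_cases hall : ∀ k, e k 0 ∈ A ↔ e k 1 ∈ A
      · exact ⟨A, T, p, h, hall⟩
      obtain ⟨k, hk⟩ := not_forall.1 hall
      obtain ⟨A', T', p', h', hA, h0, h1⟩ := h.exists_enlarge hk
      refine ih _ ?_ A' T' p' h' rfl
      rw [← hn]
      refine ncard_lt_ncard ⟨fun l hl hl' => hl ⟨hA hl'.1, hA hl'.2⟩, fun hsub => ?_⟩ (toFinite _)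
      exact hsub (a := k) (fun h => hk (iff_of_true h.1 h.2)) ⟨h0, h1⟩
  refine key _ {x} ∅ (fun v hv => Eq.recOn (motive := fun y _ => PAPath E x y)
    (mem_singleton_iff.1 hv).symm (PAPath.refl x)) ⟨rfl, ?_, ?_, ?_⟩ rfl
  · exact (elementarySetoid E _ _).refl _
  · rintro k ⟨⟩
  · rintro v rfl
    refine ⟨∅, Subset.rfl, ?_⟩
    change range (Path.refl v) = _
    simp

/-- Finitely many loops are contained in the subgroup generated by an independent family. -/
theorem exists_independentLoops [T2Space M] [CompleteSpace E] [IsManifold 𝓘(ℝ, E) ω M]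
    {ι : Type*} [Finite ι] {x : M} (γ : ι → PAPath E x x) :
    ∃ (n : ℕ) (β : Fin n → PAPath E x x), IndependentLoops β ∧
      ∀ i, loopClass (γ i) ∈ generatedSubgroup β := by
  obtain ⟨m, e, he, hei, hint, hγ⟩ := exists_graph γ
  obtain ⟨A, T, p, htree, hmax⟩ := exists_maximal_tree he x
  -- The edges in the component of the base point that are not in the tree; each yields one
  -- generator, through the tree to `e k 0`, along the edge, and back through the tree.
  let N : Set (Fin m) := {k | k ∉ T ∧ e k 0 ∈ A}
  let ν := Finite.equivFin N
  have hN0 : ∀ k : N, e k 0 ∈ A := fun k => k.2.2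
  have hN1 : ∀ k : N, e k 1 ∈ A := fun k => (hmax k).1 k.2.2
  let β' : N → PAPath E x x := fun k =>
    (p _ (hN0 k)).trans ((he k).path.trans (p _ (hN1 k)).symm)
  let β : Fin (Nat.card N) → PAPath E x x := fun i => β' (ν.symm i)
  choose S hST hS using htree.range_eq
  let R : N → Set (Fin m) := fun k => insert (k : Fin m) (S _ (hN0 k) ∪ S _ (hN1 k))
  have hrange : ∀ k, range (β' k).1 = ⋃ l ∈ R k, e l '' Icc 0 1 := by
    intro k
    change range ((p _ (hN0 k)).1.trans ((he k).path.1.trans (p _ (hN1 k)).1.symm)) = _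
    rw [Path.trans_range, Path.trans_range, Path.symm_range, (he k).range_path, hS, hS]
    have hend0 : e k 0 ∈ e k '' Icc 0 1 := ⟨0, by simp, rfl⟩
    have hend1 : e k 1 ∈ e k '' Icc 0 1 := ⟨1, by simp, rfl⟩
    rw [biUnion_insert, biUnion_union]
    ext y
    simp only [mem_union, mem_singleton_iff]
    constructor
    · rintro ((rfl | hy) | hy | (rfl | hy))
      · exact Or.inl hend0
      · exact Or.inr (Or.inl hy)
      · exact Or.inl hy
      · exact Or.inl hend1
      · exact Or.inr (Or.inr hy)
    · rintro (hy | hy | hy)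
      · exact Or.inr (Or.inl hy)
      · exact Or.inl (Or.inr hy)
      · exact Or.inr (Or.inr (Or.inr hy))
  have hRT : ∀ k, ∀ l ∈ R k, l = k ∨ l ∈ T := by
    rintro k l (rfl | hl | hl)
    · exact Or.inl rfl
    · exact Or.inr (hST _ _ hl)
    · exact Or.inr (hST _ _ hl)
  have hoff : ∀ (k : N) (v : M) (hv : v ∈ A), v ∈ edgeVertices (e k) → ∀ s ∈ Ioo (0 : ℝ) 1,
      e k s ∉ range (p v hv).1 := by
    intro k v hv hvk s hs hmem
    rw [hS] at hmem
    rcases hmem with hmem | hmem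
    · exact (he k).notMem_vertices hs (mem_singleton_iff.1 hmem ▸ hvk)
    · obtain ⟨l, hl, hsl⟩ := mem_iUnion₂.1 hmem
      have hkl : (k : Fin m) ≠ l := fun h => k.2.1 (h ▸ hST _ _ hl)
      exact (he k).notMem_vertices hs
        (hint k l hkl ⟨⟨s, Ioo_subset_Icc_self hs, rfl⟩, hsl⟩).1
  have honce : ∀ (k : N), ∀ s ∈ Ioo (0 : ℝ) 1, ∃! t : I, (β' k).1 t = e k s := by
    intro k s hs
    -- With the nested concatenation, the edge is traversed for `t` in `[1/2, 3/4]` with parameter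
    -- `s = 2 * (2 * t - 1)`; the tree paths before and after avoid its interior.
    have hext : ∀ t ∈ Icc (0 : ℝ) 1, (β' k).1.extend t = e k s → t = (s + 2) / 4 := by
      intro t ht hts
      rcases le_total t (1 / 2) with h | h
      · have e1 : (β' k).1.extend t = (p _ (hN0 k)).1.extend (2 * t) :=
          Path.extend_trans_of_le_half _ _ h
        refine absurd ?_ (hoff k _ (hN0 k) (Or.inl rfl) s hs)
        rw [← hts, e1, Path.extend_apply _ (by constructor <;> linarith [ht.1])]
        exact mem_range_self _
      · have e1 : (β' k).1.extend t =
            ((he k).path.trans (p _ (hN1 k)).symm).1.extend (2 * t - 1) :=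
          Path.extend_trans_of_half_le _ _ h
        rcases le_total (2 * t - 1) (1 / 2) with h' | h'
        · have e2 : ((he k).path.trans (p _ (hN1 k)).symm).1.extend (2 * t - 1) =
              (he k).path.1.extend (2 * (2 * t - 1)) := Path.extend_trans_of_le_half _ _ h'
          have hI : 2 * (2 * t - 1) ∈ Icc (0 : ℝ) 1 := ⟨by linarith, by linarith⟩
          rw [e1, e2, (he k).path_extend hI] at hts
          have := hei k hI (Ioo_subset_Icc_self hs) hts
          linarith
        · have e2 : ((he k).path.trans (p _ (hN1 k)).symm).1.extend (2 * t - 1) =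
              (p _ (hN1 k)).symm.1.extend (2 * (2 * t - 1) - 1) :=
            Path.extend_trans_of_half_le _ _ h'
          refine absurd ?_ (hoff k _ (hN1 k) (Or.inr rfl) s hs)
          rw [← hts, e1, e2,
            Path.extend_apply _ (by constructor <;> linarith [ht.2])]
          change (p _ (hN1 k)).1.symm _ ∈ _
          rw [← Path.symm_range]
          exact mem_range_self _
    have hmem : e k s ∈ range (β' k).1 := by
      rw [hrange]
      exact mem_iUnion₂.2 ⟨k, mem_insert _ _, s, Ioo_subset_Icc_self hs, rfl⟩
    obtain ⟨t, ht⟩ := hmem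
    refine ⟨t, ht, fun t' ht' => Subtype.ext ?_⟩
    rw [hext t' t'.2 (by rw [Path.extend_apply _ t'.2]; exact ht'),
      hext t t.2 (by rw [Path.extend_apply _ t.2]; exact ht)]
  have hind : IndependentLoops β := by
    -- Only edges used by some generator are kept, since the graph has to equal the union of the
    -- images of the loops; it is empty if there are no generators.
    let U : Set (Fin m) := ⋃ k, R k
    let μ := Finite.equivFin U
    refine ⟨Nat.card U, fun j => e (μ.symm j), ⟨fun j => he _, fun j l hjl => hint _ _ fun h =>
      hjl (μ.symm.injective (Subtype.ext h)), ?_⟩, fun i => ?_⟩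
    · ext y
      simp only [mem_iUnion]
      constructor
      · rintro ⟨j, hy⟩
        obtain ⟨k, hk⟩ := mem_iUnion.1 (μ.symm j).2
        refine ⟨ν k, ?_⟩
        simp only [β, Equiv.symm_apply_apply, hrange]
        exact mem_iUnion₂.2 ⟨_, hk, hy⟩
      · rintro ⟨i, hy⟩
        rw [hrange] at hy
        obtain ⟨l, hl, hy⟩ := mem_iUnion₂.1 hy
        refine ⟨μ ⟨l, mem_iUnion.2 ⟨_, hl⟩⟩, ?_⟩
        rwa [Equiv.symm_apply_apply]
    · have hkU : (ν.symm i : Fin m) ∈ U := mem_iUnion.2 ⟨ν.symm i, mem_insert _ _⟩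
      refine ⟨μ ⟨_, hkU⟩, ?_, ?_⟩
      · change ∀ s ∈ Ioo (0 : ℝ) 1, ∃! t : I, (β' (ν.symm i)).1 t = e (μ.symm (μ ⟨_, hkU⟩)) s
        rw [Equiv.symm_apply_apply]
        exact honce (ν.symm i)
      · change ∀ j, j ≠ i → e (μ.symm (μ ⟨_, hkU⟩)) '' Icc 0 1 ∩ range (β' (ν.symm j)).1 ⊆
          edgeVertices (e (μ.symm (μ ⟨_, hkU⟩)))
        rw [Equiv.symm_apply_apply]
        rintro j hj y ⟨hy, hy'⟩
        rw [hrange] at hy'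
        obtain ⟨l, hl, hyl⟩ := mem_iUnion₂.1 hy'
        refine (hint (ν.symm i) l ?_ ⟨hy, hyl⟩).1
        rintro rfl
        rcases hRT _ _ hl with h | h
        · exact hj (ν.symm.injective (Subtype.ext h)).symm
        · exact (ν.symm i).2.1 h
  refine ⟨_, β, hind, ?_⟩
  -- Starting in the component implies ending in it; building this into the property provides the
  -- tree path at each intermediate vertex.
  let Good : ∀ u v : M, PAPath E u v → Prop := fun u v q => ∀ hu : u ∈ A, ∃ hv : v ∈ A,
    loopClass ((p u hu).trans (q.trans (p v hv).symm)) ∈ generatedSubgroup β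
  have good_rel : ∀ {u v : M} (q q' : PAPath E u v), elementarySetoid E u v q q' →
      Good u v q → Good u v q' := by
    intro u v q q' hr h hu
    obtain ⟨hv, h⟩ := h hu
    refine ⟨hv, ?_⟩
    rwa [← PAPath.loopClass_eq (PAPath.rel_trans_right _ (PAPath.rel_trans_left _ hr))]
  have good_trans : ∀ {u v w : M} (q : PAPath E u v) (q' : PAPath E v w), Good u v q →
      Good v w q' → Good u w (q.trans q') := by
    intro u v w q q' h h' hu
    obtain ⟨hv, h⟩ := h hu
    obtain ⟨hw, h'⟩ := h' hv
    refine ⟨hw, ?_⟩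
    rw [← PAPath.loopClass_conj_mul _ (p v hv)]
    exact mul_mem h h'
  have good_refl : ∀ u : M, Good u u (PAPath.refl u) := fun u hu => ⟨hu, by
    rw [PAPath.loopClass_conj_eq_one _ _ _ (PAPath.rel_symm (PAPath.rel_trans_refl _))]
    exact one_mem _⟩
  have good_edge_aux : ∀ k (h0 : e k 0 ∈ A) (h1 : e k 1 ∈ A),
      loopClass ((p _ h0).trans ((he k).path.trans (p _ h1).symm)) ∈ generatedSubgroup β := by
    intro k h0 h1
    by_cases hk : k ∈ T
    · obtain ⟨_, _, hr⟩ := htree.edge k hk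
      rw [PAPath.loopClass_conj_eq_one _ _ _ hr]
      exact one_mem _
    · refine Subgroup.subset_closure ⟨ν ⟨k, hk, h0⟩, ?_⟩
      simp only [β, Equiv.symm_apply_apply]
      rfl
  have good_edge : ∀ k, Good _ _ (he k).path := fun k h0 =>
    ⟨(hmax k).1 h0, good_edge_aux k h0 _⟩
  have good_edge_symm : ∀ k, Good _ _ (he k).path.symm := fun k h1 => ⟨(hmax k).2 h1, by
    rw [← PAPath.loopClass_conj_inv]
    exact inv_mem (good_edge_aux k _ h1)⟩
  intro i
  obtain ⟨V, hV, hVI, hV0, hV1, hpiece⟩ := hγ i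
  have key : ∀ {a b : ℝ}, a < b → a ∈ V → b ∈ V → ∀ (u v : M) (q : PAPath E u v),
      (∀ s ∈ Icc (0 : ℝ) 1, q.1.extend s = (γ i).1.extend ((b - a) * s + a)) → Good u v q := by
    intro a b hab
    refine hV.interval_induction (Q := fun a b => a ∈ V → b ∈ V → ∀ (u v : M) (q : PAPath E u v),
      (∀ s ∈ Icc (0 : ℝ) 1, q.1.extend s = (γ i).1.extend ((b - a) * s + a)) → Good u v q)
      ?_ ?_ hab
    · intro a b hab hd ha hb u v q hq
      have hba : 0 < b - a := sub_pos.2 hab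
      have hmem : ∀ s ∈ Icc (0 : ℝ) 1, (b - a) * s + a ∈ Icc a b := by
        intro s hs
        constructor <;> nlinarith [hs.1, hs.2]
      rcases hpiece a ha b hb hab hd with hc | ⟨hinj, k, hk⟩
      · have hu := hq 0 (by simp)
        have hv := hq 1 (by simp)
        rw [q.extend_zero, hc _ (hmem 0 (by simp))] at hu
        rw [q.extend_one, hc _ (hmem 1 (by simp)), ← hu] at hv
        subst hv
        refine good_rel (PAPath.refl v) q (PAPath.rel_of_extend _ _ id continuousOn_id
          (monotone_id.monotoneOn _) rfl rfl fun t ht => ?_) (good_refl v)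
        rw [hq t ht, hc _ (hmem t ht), ← hu]
        have : (Path.refl v).extend t = v := by rw [Path.refl_extend]; rfl
        exact this.symm
      · have hpe : EqOn (he k).path.1.extend (e k) (Icc 0 1) := fun s hs => (he k).path_extend hs
        refine PAPath.of_range_eq good_rel (he k).path q ((hei k).congr hpe.symm) ?_ ?_
          (good_edge k) (good_edge_symm k)
        · intro s hs t ht hst
          rw [hq s hs, hq t ht] at hst
          have := hinj (hmem s hs) (hmem t ht) hst
          exact mul_left_cancel₀ hba.ne' (add_right_cancel this)
        · rw [hpe.image_eq, ← hk]
          have hIcc : (fun s => (b - a) * s + a) '' Icc 0 1 = Icc a b := by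
            rw [image_affine_Icc' hba]
            congr 1 <;> ring
          rw [← hIcc, image_image]
          exact image_congr hq
    · intro a w b haw hwb hw h1 h2 ha hb u v q hq
      obtain ⟨q₁, hq₁⟩ := (γ i).exists_segment (hVI ha).1 haw (hVI hw).2
      obtain ⟨q₂, hq₂⟩ := (γ i).exists_segment (hVI hw).1 hwb (hVI hb).2
      have hu := hq 0 (by simp)
      have hv := hq 1 (by simp)
      rw [q.extend_zero, mul_zero, zero_add] at hu
      rw [q.extend_one, mul_one, sub_add_cancel] at hv
      subst hu hv
      exact good_rel _ _ (PAPath.rel_symm (PAPath.rel_trans_of_segments haw hwb q q₁ q₂ hq hq₁ hq₂))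
        (good_trans _ _ (h1 ha hw _ _ q₁ hq₁) (h2 hw hb _ _ q₂ hq₂))
  -- The tree path at the root is equivalent to the constant path, so closing up `γ i` does not
  -- change its class.
  obtain ⟨_, hfin⟩ := key zero_lt_one hV0 hV1 x x (γ i) (fun s _ => by simp) htree.root_mem
  rwa [PAPath.loopClass_eq (q := γ i)] at hfin
  have hroot := htree.root
  refine PAPath.rel_tr (PAPath.rel_trans hroot (PAPath.rel_trans_right _
    (PAPath.rel_inv hroot))) ?_
  refine PAPath.rel_tr (PAPath.rel_symm (PAPath.rel_refl_trans _)) ?_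
  have : (PAPath.refl x : PAPath E x x).symm = PAPath.refl x := Subtype.ext Path.refl_symm
  rw [this]
  exact PAPath.rel_symm (PAPath.rel_trans_refl _)

end SpanningTree

/-! ### Harmonic analysis on compact groups -/

section Haar

variable {G G' : Type*} [Group G] [TopologicalSpace G] [IsTopologicalGroup G] [CompactSpace G]
  [MeasurableSpace G] [BorelSpace G] [Group G'] [TopologicalSpace G'] [IsTopologicalGroup G']
  [CompactSpace G'] [MeasurableSpace G'] [BorelSpace G']

instance : (normHaar G).IsHaarMeasure := by
  unfold normHaar
  infer_instance

instance : (normHaar G).Regular := by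
  unfold normHaar
  infer_instance

instance : IsProbabilityMeasure (normHaar G) :=
  ⟨by simpa [normHaar] using
    Measure.haarMeasure_self (K₀ := (⊤ : TopologicalSpace.PositiveCompacts G))⟩

/-- A continuous surjective homomorphism of compact groups preserves normalized Haar measure. -/
theorem measurePreserving_normHaar (π : G →* G') (hπ : Continuous π)
    (hsurj : Function.Surjective π) : MeasurePreserving π (normHaar G) (normHaar G') := by
  refine ⟨hπ.measurable, ?_⟩
  have : ((normHaar G).map π).IsHaarMeasure :=
    Measure.isHaarMeasure_map_of_isFiniteMeasure (normHaar G) π hπ hsurj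
  have : IsProbabilityMeasure ((normHaar G).map π) :=
    Measure.isProbabilityMeasure_map hπ.aemeasurable
  exact Measure.isHaarMeasure_eq_of_isProbabilityMeasure _ _

theorem IsPullback.unique {π : G' → G} {i j : HaarL2 G → HaarL2 G'} (hi : IsPullback π i)
    (hj : IsPullback π j) (ψ : HaarL2 G) : i ψ = j ψ :=
  Lp.ext ((hi ψ).trans (hj ψ).symm)

theorem isPullback_id : IsPullback (id : G → G) (id : HaarL2 G → HaarL2 G) :=
  fun _ => Filter.EventuallyEq.rfl

theorem IsPullback.comp {G'' : Type*} [Group G''] [TopologicalSpace G''] [IsTopologicalGroup G'']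
    [CompactSpace G''] [MeasurableSpace G''] [BorelSpace G''] {π : G' → G} {π' : G'' → G'}
    {i : HaarL2 G → HaarL2 G'} {i' : HaarL2 G' → HaarL2 G''} (hi : IsPullback π i)
    (hi' : IsPullback π' i') (hπ' : MeasurePreserving π' (normHaar G'') (normHaar G')) :
    IsPullback (π ∘ π') (fun ψ => i' (i ψ)) := by
  intro ψ
  have h : (i ψ : G' → ℂ) ∘ π' =ᵐ[normHaar G''] (fun H => ψ (π H)) ∘ π' :=
    hπ'.quasiMeasurePreserving.ae_eq_comp (hi ψ)
  exact (hi' (i ψ)).trans h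

theorem isPullback_compMeasurePreserving {π : G' → G}
    (hπ : MeasurePreserving π (normHaar G') (normHaar G)) :
    IsPullback π (Lp.compMeasurePreservingₗᵢ (E := ℂ) (p := 2) ℂ π hπ) :=
  fun ψ => Lp.coeFn_compMeasurePreserving ψ hπ

/-- Pull-back by an isomorphism of compact groups is unitary. -/
theorem exists_unitary_isPullback (e : G' ≃ₜ* G) :
    ∃ U : HaarL2 G ≃ₗᵢ[ℂ] HaarL2 G', IsPullback e U := by
  have h1 : MeasurePreserving e (normHaar G') (normHaar G) :=
    measurePreserving_normHaar (e : G' →* G) e.continuous e.surjective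
  have h2 : MeasurePreserving e.symm (normHaar G) (normHaar G') :=
    measurePreserving_normHaar (e.symm : G →* G') e.symm.continuous e.symm.surjective
  refine ⟨LinearIsometryEquiv.ofSurjective (Lp.compMeasurePreservingₗᵢ ℂ e h1) fun ψ =>
    ⟨Lp.compMeasurePreservingₗᵢ ℂ e.symm h2 ψ, ?_⟩, isPullback_compMeasurePreserving h1⟩
  have h := (isPullback_compMeasurePreserving h2).comp (isPullback_compMeasurePreserving h1) h1
  have hid : (e.symm : G → G') ∘ (e : G' → G) = id := funext fun g => e.symm_apply_apply g
  rw [hid] at h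
  exact h.unique isPullback_id ψ

/-- A character as a continuous complex-valued function. -/
noncomputable def charMap (χ : PontryaginDual G) : C(G, ℂ) :=
  ⟨fun g => (χ g : ℂ), by fun_prop⟩

/-- A character as an element of `L²`. -/
noncomputable def charLp (χ : PontryaginDual G) : HaarL2 G :=
  ContinuousMap.toLp 2 (normHaar G) ℂ (charMap χ)

theorem coeFn_charLp (χ : PontryaginDual G) :
    (charLp χ : G → ℂ) =ᵐ[normHaar G] fun g => (χ g : ℂ) :=
  ContinuousMap.coeFn_toLp (normHaar G) (charMap χ)

theorem inner_charLp (χ : PontryaginDual G) (ψ : HaarL2 G) :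
    inner ℂ (charLp χ) ψ = ∫ g, conj (χ g : ℂ) * ψ g ∂normHaar G := by
  rw [L2.inner_def]
  refine integral_congr_ae ?_
  filter_upwards [coeFn_charLp χ] with g hg
  rw [hg, RCLike.inner_apply, mul_comm]

/-- For distinct characters, translation by a point `a` where they differ multiplies the integrand
by a constant `c ≠ 1` but preserves its integral, which must vanish. -/
theorem orthonormal_charLp : Orthonormal ℂ (charLp (G := G)) := by
  classical
  rw [orthonormal_iff_ite]
  intro χ ψ
  have h1 : inner ℂ (charLp χ) (charLp ψ) =
      ∫ g, conj (χ g : ℂ) * (ψ g : ℂ) ∂normHaar G := by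
    rw [inner_charLp]
    refine integral_congr_ae ?_
    filter_upwards [coeFn_charLp ψ] with g hg
    rw [hg]
  rw [h1]
  split_ifs with h
  · subst h
    have : ∀ g, conj (χ g : ℂ) * (χ g : ℂ) = 1 := fun g => by
      rw [mul_comm, Complex.mul_conj, Circle.normSq_coe, Complex.ofReal_one]
    simp [this]
  · obtain ⟨a, ha⟩ : ∃ a, χ a ≠ ψ a := by
      by_contra hall
      exact h (PontryaginDual.ext fun a => not_not.1 fun hne => hall ⟨a, hne⟩)
    set c : ℂ := conj (χ a : ℂ) * (ψ a : ℂ) with hc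
    have hc1 : c ≠ 1 := by
      intro hc1
      apply ha
      apply Circle.ext
      have h2 : (χ a : ℂ) * conj (χ a : ℂ) = 1 := by
        rw [Complex.mul_conj, Circle.normSq_coe, Complex.ofReal_one]
      calc (χ a : ℂ) = (χ a : ℂ) * c := by rw [hc1, mul_one]
        _ = ψ a := by rw [hc, ← mul_assoc, h2, one_mul]
    have h2 := integral_mul_left_eq_self (μ := normHaar G)
      (fun g => conj (χ g : ℂ) * (ψ g : ℂ)) a
    have h3 : ∀ g, conj (χ (a * g) : ℂ) * (ψ (a * g) : ℂ) =
        c * (conj (χ g : ℂ) * (ψ g : ℂ)) := by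
      intro g
      rw [map_mul, map_mul, Circle.coe_mul, Circle.coe_mul, map_mul, hc]
      ring
    simp only [h3] at h2
    rw [integral_const_mul] at h2
    have h4 : (c - 1) * ∫ g, conj (χ g : ℂ) * (ψ g : ℂ) ∂normHaar G = 0 := by
      rw [sub_mul, one_mul, h2, sub_self]
    exact (mul_eq_zero.1 h4).resolve_left (sub_ne_zero.2 hc1)

end Haar

/-! ### Completeness of the Wilson functions -/

section Wilson

variable {Λ : Type*} [Group Λ]

/-- The Wilson functions as a monoid homomorphism to the algebra of continuous functions. -/
noncomputable def wilsonMap : Λ →* C(HomU1 Λ, ℂ) where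
  toFun α := charMap (HomU1.wilson α)
  map_one' := by
    ext H
    change ((H 1 : Circle) : ℂ) = 1
    simp
  map_mul' a b := by
    ext H
    change ((H (a * b) : Circle) : ℂ) = H a * H b
    simp

/-- The star subalgebra spanned by the Wilson functions. -/
noncomputable def wilsonSubalgebra (Λ : Type*) [Group Λ] : StarSubalgebra ℂ C(HomU1 Λ, ℂ) where
  toSubalgebra := Algebra.adjoin ℂ (range (wilsonMap (Λ := Λ)))
  star_mem' := by
    change Algebra.adjoin ℂ (range wilsonMap) ≤ star (Algebra.adjoin ℂ (range wilsonMap))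
    refine Algebra.adjoin_le ?_
    rintro - ⟨α, rfl⟩
    refine Algebra.subset_adjoin ⟨α⁻¹, ?_⟩
    ext H
    change ((H α⁻¹ : Circle) : ℂ) = conj (H α : ℂ)
    rw [map_inv, Circle.coe_inv_eq_conj]

/-- Products of Wilson functions are Wilson functions, so the algebra they generate is already their
linear span. -/
theorem wilsonSubalgebra_eq_span :
    Subalgebra.toSubmodule (wilsonSubalgebra Λ).toSubalgebra =
      Submodule.span ℂ (range (wilsonMap (Λ := Λ))) := by
  change Subalgebra.toSubmodule (Algebra.adjoin ℂ (range (wilsonMap (Λ := Λ)))) = _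
  rw [Algebra.adjoin_eq_span, ← MonoidHom.coe_mrange, Submonoid.closure_eq]

/-- Stone-Weierstrass: distinct homomorphisms differ on some `α`, so the Wilson functions separate
points. -/
theorem span_wilsonMap_closure_eq_top :
    (Submodule.span ℂ (range (wilsonMap (Λ := Λ)))).topologicalClosure = ⊤ := by
  rw [← wilsonSubalgebra_eq_span]
  refine congr_arg (Subalgebra.toSubmodule <| StarSubalgebra.toSubalgebra ·)
    (ContinuousMap.starSubalgebra_topologicalClosure_eq_top_of_separatesPoints
      (wilsonSubalgebra Λ) ?_)
  intro H H' hne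
  obtain ⟨α, hα⟩ : ∃ α, H α ≠ H' α := by
    by_contra hall
    exact hne (DFunLike.ext _ _ fun a => not_not.1 fun h => hall ⟨a, h⟩)
  exact ⟨_, ⟨wilsonMap α, Algebra.subset_adjoin ⟨α, rfl⟩, rfl⟩, fun h => hα (Circle.ext h)⟩

/-- The Wilson functions span a dense subspace of `L²`. -/
theorem span_wilson_closure_eq_top :
    (Submodule.span ℂ (range fun α : Λ => charLp (HomU1.wilson α))).topologicalClosure = ⊤ := by
  have h := (ContinuousMap.toLp_denseRange ℂ (normHaar (HomU1 Λ)) ℂ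
    (p := 2) (by simp)).topologicalClosure_map_submodule (span_wilsonMap_closure_eq_top (Λ := Λ))
  rw [← h, Submodule.map_span, ← range_comp]
  rfl

/-- Expansion in a family of characters that contains the Wilson functions is unitary. -/
theorem exists_unitary_of_characters {κ : Type*} (χ : κ → PontryaginDual (HomU1 Λ))
    (hinj : Function.Injective χ) (hw : ∀ α : Λ, ∃ k, χ k = HomU1.wilson α) :
    ∃ F : HaarL2 (HomU1 Λ) ≃ₗᵢ[ℂ] DiscreteL2 κ, ∀ ψ k,
      F ψ k = ∫ H, conj (χ k H : ℂ) * ψ H ∂normHaar (HomU1 Λ) := by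
  -- Orthonormality holds for any distinct characters, and completeness is inherited from the Wilson
  -- functions. No description of all characters is needed, so the same argument serves the full
  -- dual group and the group of hoops.
  have hon : Orthonormal ℂ (fun k => charLp (χ k)) := orthonormal_charLp.comp χ hinj
  have hsp : ⊤ ≤ (Submodule.span ℂ (range fun k => charLp (χ k))).topologicalClosure := by
    rw [← span_wilson_closure_eq_top (Λ := Λ)]
    refine Submodule.topologicalClosure_mono (Submodule.span_mono ?_)
    rintro _ ⟨α, rfl⟩
    obtain ⟨k, hk⟩ := hw α
    exact ⟨k, congrArg charLp hk⟩
  let b := HilbertBasis.mk hon hsp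
  refine ⟨b.repr, fun ψ k => ?_⟩
  rw [b.repr_apply_apply, HilbertBasis.coe_mk, inner_charLp]

end Wilson

/-! ### Inductive limits -/

section Limits

variable {J : Type*} [PartialOrder J]
  {𝓗 : J → Type*} [∀ a, NormedAddCommGroup (𝓗 a)] [∀ a, InnerProductSpace ℂ (𝓗 a)]
  {𝓗' : J → Type*} [∀ a, NormedAddCommGroup (𝓗' a)] [∀ a, InnerProductSpace ℂ (𝓗' a)]
  {𝓚 : Type*} [NormedAddCommGroup 𝓚] [InnerProductSpace ℂ 𝓚]
  {𝓚' : Type*} [NormedAddCommGroup 𝓚'] [InnerProductSpace ℂ 𝓚']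
  {i : ∀ a b, a ≤ b → 𝓗 a →ₗᵢ[ℂ] 𝓗 b} {ι : ∀ a, 𝓗 a →ₗᵢ[ℂ] 𝓚}
  {i' : ∀ a b, a ≤ b → 𝓗' a →ₗᵢ[ℂ] 𝓗' b} {ι' : ∀ a, 𝓗' a →ₗᵢ[ℂ] 𝓚'}
  {φ : ∀ a, 𝓗 a ≃ₗᵢ[ℂ] 𝓗' a} {Φ : 𝓚 ≃ₗᵢ[ℂ] 𝓚'}

/-- Unitary maps transport inductive limits. -/
theorem IsInductiveLimit.transport (h : IsInductiveLimit i ι)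
    (hi : ∀ a b (hab : a ≤ b) x, i' a b hab (φ a x) = φ b (i a b hab x))
    (hι : ∀ a x, ι' a (φ a x) = Φ (ι a x)) : IsInductiveLimit i' ι' := by
  obtain ⟨⟨hne, hdir, hid, hcomp⟩, hK, hcompat, V, hV, hVd⟩ := h
  refine ⟨⟨hne, hdir, fun a x => ?_, fun a b c hab hbc x => ?_⟩, ?_, fun a b hab x => ?_, ?_⟩
  · obtain ⟨y, rfl⟩ := (φ a).surjective x
    rw [hi, hid]
  · obtain ⟨y, rfl⟩ := (φ a).surjective x
    rw [hi, hi, hi, hcomp]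
  · exact (completeSpace_congr (e := Φ.toLinearEquiv.toEquiv) Φ.isometry.isUniformEmbedding).1 hK
  · obtain ⟨y, rfl⟩ := (φ a).surjective x
    rw [hi, hι, hι, hcompat]
  · refine ⟨V.map (Φ.toLinearEquiv : 𝓚 →ₗ[ℂ] 𝓚'), ?_, ?_⟩
    · have : ((V.map (Φ.toLinearEquiv : 𝓚 →ₗ[ℂ] 𝓚') : Submodule ℂ 𝓚') : Set 𝓚') =
          Φ '' (V : Set 𝓚) := rfl
      rw [this, hV, image_iUnion]
      refine iUnion_congr fun a => ?_
      rw [← range_comp, ← (φ a).surjective.range_comp (ι' a)]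
      exact congrArg range (funext fun x => (hι a x).symm)
    · exact Φ.surjective.denseRange.dense_image Φ.continuous hVd

/-- A compatible unitary map between inductive limits is the inductive limit of the family. -/
theorem IsInductiveLimit.isInductiveLimitOfUnitaries (h : IsInductiveLimit i ι)
    (hi : ∀ a b (hab : a ≤ b) x, i' a b hab (φ a x) = φ b (i a b hab x))
    (hι : ∀ a x, ι' a (φ a x) = Φ (ι a x)) : IsInductiveLimitOfUnitaries i i' ι ι' φ Φ := by
  refine ⟨hi, fun a x => (hι a x).symm, fun Ψ hΨ => ?_⟩
  obtain ⟨V, hV, hVd⟩ := h.dense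
  refine DFunLike.coe_injective (Continuous.ext_on hVd Ψ.continuous Φ.continuous fun y hy => ?_)
  rw [hV] at hy
  obtain ⟨a, x, rfl⟩ := mem_iUnion.1 hy
  rw [hΨ, hι]

end Limits

/-! ### Restriction and evaluation of generalized connections -/

section Restriction

namespace HomU1

variable {Λ : Type*} [Group Λ]

theorem continuous_of_eval {X : Type*} [TopologicalSpace X] {f : X → HomU1 Λ}
    (h : ∀ g, Continuous fun x => f x g) : Continuous f :=
  continuous_induced_rng.2 (continuous_pi h)

theorem continuous_restrict (L : Subgroup Λ) : Continuous (restrict L) :=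
  continuous_of_eval fun g => continuous_eval (g : Λ)

theorem continuous_restrictLE {L L' : Subgroup Λ} (h : L ≤ L') : Continuous (restrictLE h) :=
  continuous_of_eval fun g => continuous_eval (Subgroup.inclusion h g)

theorem measurePreserving_restrict {L : Subgroup Λ} (hL : Function.Surjective (restrict L)) :
    MeasurePreserving (restrict L) (normHaar (HomU1 Λ)) (normHaar (HomU1 L)) :=
  measurePreserving_normHaar (MonoidHom.mk' (restrict L) fun _ _ => rfl) (continuous_restrict L) hL

/-- A homomorphism on `L` extends to `Λ` by assumption, hence to `L'`; so restriction from `L'` is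
onto as well. -/
theorem measurePreserving_restrictLE {L L' : Subgroup Λ} (h : L ≤ L')
    (hL : Function.Surjective (restrict L)) :
    MeasurePreserving (restrictLE h) (normHaar (HomU1 L')) (normHaar (HomU1 L)) :=
  measurePreserving_normHaar (MonoidHom.mk' (restrictLE h) fun _ _ => rfl)
    (continuous_restrictLE h) fun H => by
      obtain ⟨H', rfl⟩ := hL H
      exact ⟨restrict L' H', rfl⟩

/-- The pull-back of a Wilson function is a Wilson function. -/
theorem isPullback_wilson {L : Subgroup Λ} (hL : Function.Surjective (restrict L))
    {i : HaarL2 (HomU1 L) → HaarL2 (HomU1 Λ)} (hi : IsPullback (restrict L) i) (α : L) :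
    i (charLp (wilson α)) = charLp (wilson (α : Λ)) := by
  have h : (charLp (wilson α) : HomU1 L → ℂ) ∘ restrict L =ᵐ[normHaar (HomU1 Λ)]
      (fun H => (wilson α H : ℂ)) ∘ restrict L :=
    (measurePreserving_restrict hL).quasiMeasurePreserving.ae_eq_comp (coeFn_charLp _)
  have h' : (fun H => (wilson α H : ℂ)) ∘ restrict L = fun H => (wilson (α : Λ) H : ℂ) := rfl
  exact Lp.ext ((hi _).trans (h.trans (h' ▸ (coeFn_charLp (wilson (α : Λ))).symm)))

end HomU1

variable {E : Type*} [NormedAddCommGroup E] [NormedSpace ℝ E]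
  {M : Type*} [TopologicalSpace M] [ChartedSpace E M]

theorem eq_of_eq_on_generators {x : M} {n : ℕ} {β : Fin n → PAPath E x x}
    {H H' : HomU1 (generatedSubgroup β)}
    (h : ∀ k, H ⟨loopClass (β k), Subgroup.subset_closure (mem_range_self k)⟩ =
      H' ⟨loopClass (β k), Subgroup.subset_closure (mem_range_self k)⟩) : H = H' := by
  refine DFunLike.ext _ _ ?_
  rintro ⟨g, hg⟩
  have key : ∀ g (hg : g ∈ generatedSubgroup β), H ⟨g, hg⟩ = H' ⟨g, hg⟩ := by
    intro g hg
    refine Subgroup.closure_induction (p := fun g hg => H ⟨g, hg⟩ = H' ⟨g, hg⟩) ?_ ?_ ?_ ?_ hg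
    · rintro _ ⟨k, rfl⟩
      exact h k
    · exact (map_one H).trans (map_one H').symm
    · intro a b ha hb h1 h2
      have e1 := map_mul H ⟨a, ha⟩ ⟨b, hb⟩
      have e2 := map_mul H' ⟨a, ha⟩ ⟨b, hb⟩
      rw [h1, h2, ← e2] at e1
      exact e1
    · intro a ha h1
      have e1 := map_inv H ⟨a, ha⟩
      have e2 := map_inv H' ⟨a, ha⟩
      rw [h1, ← e2] at e1
      exact e1
  exact key g hg

theorem IndependentLoops.restrict_surjective [T2Space M] {x : M} {n : ℕ}
    {β : Fin n → PAPath E x x} (hβ : IndependentLoops β) :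
    Function.Surjective (HomU1.restrict (generatedSubgroup β)) := by
  intro H
  obtain ⟨H', hH'⟩ := hβ.exists_hom_circle fun k =>
    H ⟨loopClass (β k), Subgroup.subset_closure (mem_range_self k)⟩
  exact ⟨H', eq_of_eq_on_generators hH'⟩

instance (n : ℕ) : T2Space (Torus n) := inferInstanceAs (T2Space (Fin n → Circle))

/-- Evaluation on an independent family is an isomorphism onto the torus. -/
theorem IndependentLoops.exists_evalEquiv [T2Space M] {x : M} {n : ℕ} {β : Fin n → PAPath E x x}
    (hβ : IndependentLoops β) :
    ∃ e : HomU1 (generatedSubgroup β) ≃ₜ* Torus n,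
      ∀ H k, e H k = H ⟨loopClass (β k), Subgroup.subset_closure (mem_range_self k)⟩ := by
  let ev : HomU1 (generatedSubgroup β) →* Torus n := MonoidHom.mk'
    (fun H k => H ⟨loopClass (β k), Subgroup.subset_closure (mem_range_self k)⟩) fun _ _ => rfl
  have hbij : Function.Bijective ev := by
    refine ⟨fun H H' h => eq_of_eq_on_generators fun k => congrFun h k, fun z => ?_⟩
    obtain ⟨H, hH⟩ := hβ.exists_hom_circle z
    exact ⟨HomU1.restrict _ H, funext hH⟩
  have hcont : Continuous ev := continuous_pi fun k => HomU1.continuous_eval _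
  let e := MulEquiv.ofBijective ev hbij
  have hcont' : Continuous (e : HomU1 (generatedSubgroup β) ≃ Torus n) := hcont
  exact ⟨{ e with
    continuous_toFun := hcont
    continuous_invFun := hcont'.continuous_symm_of_equiv_compact_to_t2 }, fun _ _ => rfl⟩

theorem LoopIndex.restrict_surjective [T2Space M] {x : M} (L : LoopIndex E x) :
    Function.Surjective (HomU1.restrict L.1) := by
  obtain ⟨L, n, β, hβ, rfl⟩ := L
  exact hβ.restrict_surjective

variable [T2Space M] [CompleteSpace E] [IsManifold 𝓘(ℝ, E) ω M]

/-- The generators of both subgroups together form a finite family, which lies in the subgroup of a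
single independent family. -/
theorem LoopIndex.exists_le_le {x : M} (L L' : LoopIndex E x) :
    ∃ L'' : LoopIndex E x, L ≤ L'' ∧ L' ≤ L'' := by
  obtain ⟨L, n, β, hβ, rfl⟩ := L
  obtain ⟨L', n', β', hβ', rfl⟩ := L'
  obtain ⟨m, δ, hδ, hmem⟩ := exists_independentLoops (Sum.elim β β')
  refine ⟨⟨generatedSubgroup δ, m, δ, hδ, rfl⟩, ?_, ?_⟩
  · refine (Subgroup.closure_le _).2 ?_
    rintro _ ⟨k, rfl⟩
    exact hmem (Sum.inl k)
  · refine (Subgroup.closure_le _).2 ?_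
    rintro _ ⟨k, rfl⟩
    exact hmem (Sum.inr k)

theorem LoopIndex.exists_mem {x : M} (α : LoopGroup E x) : ∃ L : LoopIndex E x, α ∈ L.1 := by
  induction α using Quotient.ind with
  | _ γ =>
    obtain ⟨m, δ, hδ, hmem⟩ := exists_independentLoops fun _ : Unit => γ
    exact ⟨⟨generatedSubgroup δ, m, δ, hδ, rfl⟩, hmem ()⟩

/-- The square integrable functions form the inductive limit of the square integrable functions
of finitely many independent loops. -/
theorem isInductiveLimit_of_isPullback {x : M}
    {i : ∀ L L' : LoopIndex E x, L ≤ L' →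
      HaarL2 (GenConnAt E L) →ₗᵢ[ℂ] HaarL2 (GenConnAt E L')}
    {iLim : ∀ L : LoopIndex E x, HaarL2 (GenConnAt E L) →ₗᵢ[ℂ] HaarL2 (GenConn E x)}
    (hi : ∀ (L L' : LoopIndex E x) (h : L ≤ L'),
      IsPullback (HomU1.restrictLE (Subtype.coe_le_coe.2 h)) (i L L' h))
    (hiLim : ∀ L, IsPullback (HomU1.restrict L.1) (iLim L)) : IsInductiveLimit i iLim := by
  have hne : Nonempty (LoopIndex E x) := ⟨(LoopIndex.exists_mem 1).choose⟩
  have hcompat : ∀ L L' (h : L ≤ L') ψ, iLim L' (i L L' h ψ) = iLim L ψ := fun L L' h ψ =>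
    ((hi L L' h).comp (hiLim L') (HomU1.measurePreserving_restrict L'.restrict_surjective)).unique
      (hiLim L) ψ
  refine ⟨⟨hne, LoopIndex.exists_le_le, fun L ψ => ?_, fun L L' L'' h h' ψ => ?_⟩,
    inferInstance, hcompat, ?_⟩
  · exact (hi L L le_rfl).unique isPullback_id ψ
  · exact ((hi L L' h).comp (hi L' L'' h')
      (HomU1.measurePreserving_restrictLE _ L'.restrict_surjective)).unique
      (hi L L'' (h.trans h')) ψ
  -- Directedness makes the union of the ranges a linear subspace, equal to their supremum; it is
  -- dense because it contains all Wilson functions.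
  · have hdir : Directed (· ≤ ·) fun L => LinearMap.range (iLim L).toLinearMap := by
      intro L L'
      obtain ⟨L'', h, h'⟩ := LoopIndex.exists_le_le L L'
      refine ⟨L'', ?_, ?_⟩
      · rintro _ ⟨ψ, rfl⟩
        exact ⟨i L L'' h ψ, hcompat L L'' h ψ⟩
      · rintro _ ⟨ψ, rfl⟩
        exact ⟨i L' L'' h' ψ, hcompat L' L'' h' ψ⟩
    refine ⟨⨆ L, LinearMap.range (iLim L).toLinearMap, ?_, ?_⟩
    · rw [Submodule.coe_iSup_of_directed _ hdir]
      rfl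
    · rw [Submodule.dense_iff_topologicalClosure_eq_top, eq_top_iff,
        ← span_wilson_closure_eq_top (Λ := LoopGroup E x)]
      refine Submodule.topologicalClosure_mono (Submodule.span_le.2 ?_)
      rintro _ ⟨α, rfl⟩
      obtain ⟨L, hL⟩ := LoopIndex.exists_mem α
      exact Submodule.mem_iSup_of_mem L
        ⟨charLp (HomU1.wilson ⟨α, hL⟩),
          HomU1.isPullback_wilson L.restrict_surjective (hiLim L) ⟨α, hL⟩⟩

end Restriction

/-! ### The loop transform as an inductive limit -/

theorem mainTheorem1 {E : Type*} [NormedAddCommGroup E] [NormedSpace ℝ E] [FiniteDimensional ℝ E]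
    {M : Type*} [TopologicalSpace M] [T2Space M] [SecondCountableTopology M] [ChartedSpace E M]
    [IsManifold 𝓘(ℝ, E) ω M] (x : M) :
    -- evaluation on an independent family identifies `Hom(L, U(1))` with a torus,
    -- and the `L²` spaces accordingly
    (∀ (n : ℕ) (β : Fin n → PAPath E x x), IndependentLoops β →
      ∃ e : HomU1 (generatedSubgroup β) ≃ₜ* Torus n,
        (∀ H k, e H k = H ⟨loopClass (β k), Subgroup.subset_closure (mem_range_self k)⟩) ∧
        ∃ U : HaarL2 (Torus n) ≃ₗᵢ[ℂ] HaarL2 (HomU1 (generatedSubgroup β)), IsPullback e U) ∧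
    ∃ (i : ∀ L L' : LoopIndex E x, L ≤ L' → HaarL2 (GenConnAt E L) →ₗᵢ[ℂ] HaarL2 (GenConnAt E L'))
      (iLim : ∀ L : LoopIndex E x, HaarL2 (GenConnAt E L) →ₗᵢ[ℂ] HaarL2 (GenConn E x))
      (F : ∀ L : LoopIndex E x,
        HaarL2 (GenConnAt E L) ≃ₗᵢ[ℂ] DiscreteL2 (PontryaginDual (GenConnAt E L)))
      (T : HaarL2 (GenConn E x) ≃ₗᵢ[ℂ] DiscreteL2 (HoopGroup E x))
      (j : ∀ L L' : LoopIndex E x, L ≤ L' → DiscreteL2 (PontryaginDual (GenConnAt E L)) →ₗᵢ[ℂ]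
        DiscreteL2 (PontryaginDual (GenConnAt E L')))
      (jLim : ∀ L : LoopIndex E x,
        DiscreteL2 (PontryaginDual (GenConnAt E L)) →ₗᵢ[ℂ] DiscreteL2 (HoopGroup E x)),
      -- the inclusions are the pull-backs by the restriction maps
      (∀ (L L' : LoopIndex E x) (h : L ≤ L'),
        IsPullback (HomU1.restrictLE (Subtype.coe_le_coe.2 h)) (i L L' h)) ∧
      (∀ L, IsPullback (HomU1.restrict L.1) (iLim L)) ∧
      -- the unitary maps are the Fourier transforms and the loop transform
      (∀ L, IsFourierTransform (F L)) ∧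
      IsLoopTransform T ∧
      -- the inclusions on the dual side are the transported ones
      (∀ L L' (h : L ≤ L') ψ, j L L' h (F L ψ) = F L' (i L L' h ψ)) ∧
      (∀ L ψ, jLim L (F L ψ) = T (iLim L ψ)) ∧
      -- the three inductive limits
      IsInductiveLimit i iLim ∧
      IsInductiveLimit j jLim ∧
      IsInductiveLimitOfUnitaries i j iLim jLim F T := by
  have : CompleteSpace E := FiniteDimensional.complete ℝ E
  refine ⟨fun n β hβ => ?_, ?_⟩
  · obtain ⟨e, he⟩ := hβ.exists_evalEquiv
    exact ⟨e, he, exists_unitary_isPullback e⟩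
  have mp : ∀ L : LoopIndex E x, MeasurePreserving (HomU1.restrict L.1)
      (normHaar (GenConn E x)) (normHaar (GenConnAt E L)) := fun L =>
    HomU1.measurePreserving_restrict L.restrict_surjective
  have mpLE : ∀ (L L' : LoopIndex E x) (h : L ≤ L'),
      MeasurePreserving (HomU1.restrictLE (Subtype.coe_le_coe.2 h))
        (normHaar (GenConnAt E L')) (normHaar (GenConnAt E L)) := fun L L' h =>
    HomU1.measurePreserving_restrictLE _ L.restrict_surjective
  let i : ∀ L L' : LoopIndex E x, L ≤ L' →
      HaarL2 (GenConnAt E L) →ₗᵢ[ℂ] HaarL2 (GenConnAt E L') := fun L L' h =>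
    Lp.compMeasurePreservingₗᵢ ℂ _ (mpLE L L' h)
  let iLim : ∀ L : LoopIndex E x, HaarL2 (GenConnAt E L) →ₗᵢ[ℂ] HaarL2 (GenConn E x) := fun L =>
    Lp.compMeasurePreservingₗᵢ ℂ _ (mp L)
  have hi : ∀ (L L' : LoopIndex E x) (h : L ≤ L'),
      IsPullback (HomU1.restrictLE (Subtype.coe_le_coe.2 h)) (i L L' h) := fun L L' h =>
    isPullback_compMeasurePreserving (mpLE L L' h)
  have hiLim : ∀ L, IsPullback (HomU1.restrict L.1) (iLim L) := fun L =>
    isPullback_compMeasurePreserving (mp L)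
  choose F hF using fun L : LoopIndex E x => exists_unitary_of_characters
    (Λ := L.1) (fun χ : PontryaginDual (GenConnAt E L) => χ) Function.injective_id
    fun α => ⟨_, rfl⟩
  obtain ⟨T, hT⟩ := exists_unitary_of_characters (Λ := LoopGroup E x)
    (fun χ : HoopGroup E x => (χ : PontryaginDual (GenConn E x))) Subtype.val_injective
    fun α => ⟨hoop α, rfl⟩
  have hlim : IsInductiveLimit i iLim := isInductiveLimit_of_isPullback hi hiLim
  let j : ∀ L L' : LoopIndex E x, L ≤ L' → DiscreteL2 (PontryaginDual (GenConnAt E L)) →ₗᵢ[ℂ]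
      DiscreteL2 (PontryaginDual (GenConnAt E L')) := fun L L' h =>
    (F L').toLinearIsometry.comp ((i L L' h).comp (F L).symm.toLinearIsometry)
  let jLim : ∀ L : LoopIndex E x,
      DiscreteL2 (PontryaginDual (GenConnAt E L)) →ₗᵢ[ℂ] DiscreteL2 (HoopGroup E x) := fun L =>
    T.toLinearIsometry.comp ((iLim L).comp (F L).symm.toLinearIsometry)
  have hj : ∀ L L' (h : L ≤ L') ψ, j L L' h (F L ψ) = F L' (i L L' h ψ) := fun L L' h ψ => by
    simp [j]
  have hjLim : ∀ L ψ, jLim L (F L ψ) = T (iLim L ψ) := fun L ψ => by simp [jLim]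
  exact ⟨i, iLim, F, T, j, jLim, hi, hiLim, hF, fun ψ α => hT ψ (hoop α), hj, hjLim, hlim,
    hlim.transport hj hjLim, hlim.isInductiveLimitOfUnitaries hj hjLim⟩
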